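/- Let $\mathcal H$ be a complex Hilbert space. A closed real subspace $V\subseteq\mathcal H$ is called a standard subspace if $V\cap iV=\{0\}$ and $V+iV$ is dense in $\mathcal H$. An antiunitary representation of $\mathbb R^\times$ on $\mathcal H$ is a strongly continuous homomorphism $U$ from $\mathbb R^\times$ into the group of unitary and antiunitary operators on $\mathcal H$ such that $U_g$ is unitary for $g>0$ and antiunitary for $g<0$. For a selfadjoint operator $\Delta>0$ (positive and injective), $\Delta^z$ is defined by the spectral calculus. (1) For every antiunitary representation $U$ of $\mathbb R^\times$ on $\mathcal H$ there is a unique selfadjoint operator $\Delta>0$ with $U_{e^t}=\Delta^{-it/2\pi}$ for all $t\in\mathbb R$. With $J:=U_{-1}$, the set $$V_U:=\mathrm{Fix}(J\Delta^{1/2})=\{x\in\mathcal D(\Delta^{1/2}) : J\Delta^{1/2}x=x\}$$ is a standard subspace. (2) For every standard subspace $V\subseteq\mathcal H$, the antilinear operator $S_V\colon V+iV\to\mathcal H$, $S_V(x+iy)=x-iy$ for $x,y\in V$, is closed and satisfies $S_V^2=\mathrm{id}_{V+iV}$. The operator $\Delta_V:=S_V^*S_V$ is selfadjoint with $\Delta_V>0$,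 and there is a unique antiunitary operator $J_V$ on $\mathcal H$ with $S_V=J_V\Delta_V^{1/2}$ (the polar decomposition). (3) The map $U\mapsto V_U$ is a bijection from the set of antiunitary representations of $\mathbb R^\times$ on $\mathcal H$ onto the set of standard subspaces of $\mathcal H$. Its inverse $V\mapsto U^V$ is given by $U^V_{e^t}=\Delta_V^{-it/2\pi}$ for $t\in\mathbb R$ and $U^V_{-1}=J_V$. -/

import Mathlib

open MeasureTheory
open scoped ENNReal ComplexInnerProductSpace ComplexConjugate

/-! ## Spectral measures and spectral integrals -/

/-- A spectral measure (projection-valued measure) on the Borel sets of `ℝ`: orthogonal projections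
with total mass the identity, countably additive in the strong operator topology. -/
structure SpectralMeasure (H : Type*) [NormedAddCommGroup H] [InnerProductSpace ℂ H]
    [CompleteSpace H] where
  /-- The projection `P(s)`; its values at non-measurable `s` are irrelevant. -/
  proj : Set ℝ → H →L[ℂ] H
  isStarProjection : ∀ s, MeasurableSet s → IsStarProjection (proj s)
  proj_univ : proj Set.univ = 1
  hasSum_iUnion : ∀ f : ℕ → Set ℝ, (∀ n, MeasurableSet (f n)) →
    Pairwise (fun i j => Disjoint (f i) (f j)) →
    ∀ x : H, HasSum (fun n => proj (f n) x) (proj (⋃ n, f n) x)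

namespace SpectralMeasure

variable {H : Type*} [NormedAddCommGroup H] [InnerProductSpace ℂ H] [CompleteSpace H]

theorem proj_empty (P : SpectralMeasure H) : P.proj ∅ = 0 := by
  ext x
  have h := P.hasSum_iUnion (fun _ => ∅) (fun _ => MeasurableSet.empty) (fun _ _ _ => by simp) x
  have h0 := h.summable.tendsto_atTop_zero
  exact tendsto_nhds_unique tendsto_const_nhds h0

theorem inner_proj (P : SpectralMeasure H) {s : Set ℝ} (hs : MeasurableSet s) (x : H) :
    RCLike.re ⟪x, P.proj s x⟫ = ‖P.proj s x‖ ^ 2 := by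
  have hp := P.isStarProjection s hs
  have h1 : P.proj s (P.proj s x) = P.proj s x := by
    rw [← mul_apply_eq_comp, hp.isIdempotentElem.eq]
  have h2 : ContinuousLinearMap.adjoint (P.proj s) = P.proj s := hp.isSelfAdjoint
  have h3 : ⟪x, P.proj s x⟫ = ⟪P.proj s x, P.proj s x⟫ := by
    conv_lhs => rw [← h1, ← h2, ContinuousLinearMap.adjoint_inner_right, h2]
  rw [h3, inner_self_eq_norm_sq]

/-- The scalar spectral measure `s ↦ ⟪x, P(s) x⟫ = ‖P(s) x‖²` of the vector `x`. -/
noncomputable def scalarMeasure (P : SpectralMeasure H) (x : H) : Measure ℝ :=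
  Measure.ofMeasurable (fun s _ => ENNReal.ofReal (‖P.proj s x‖ ^ 2))
    (by simp [P.proj_empty])
    (fun f hf hd => by
      have h := P.hasSum_iUnion f hf hd x
      have h' : HasSum (fun n => ‖P.proj (f n) x‖ ^ 2) (‖P.proj (⋃ n, f n) x‖ ^ 2) := by
        have := (RCLike.reCLM (K := ℂ)).hasSum ((innerSL ℂ x).hasSum h)
        simp only [innerSL_apply_apply, RCLike.reCLM_apply] at this
        rw [P.inner_proj (MeasurableSet.iUnion hf)] at this
        exact this.congr_fun fun n => (P.inner_proj (hf n) x).symm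
      change ENNReal.ofReal (‖P.proj (⋃ n, f n) x‖ ^ 2) = _
      rw [← h'.tsum_eq, ENNReal.ofReal_tsum_of_nonneg (fun n => by positivity) h'.summable])

theorem scalarMeasure_apply (P : SpectralMeasure H) (x : H) {s : Set ℝ} (hs : MeasurableSet s) :
    P.scalarMeasure x s = ENNReal.ofReal (‖P.proj s x‖ ^ 2) :=
  Measure.ofMeasurable_apply s hs

/-- `B = ∫ f dP` as an unbounded operator: its domain consists of the `x` with
`∫ |f|² dμ_x < ∞`, and `⟪x, B x⟫ = ∫ f dμ_x` on the domain, where `μ_x` is the scalar spectral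
measure of `x`. (By polarization this determines `B`.) -/
structure IsIntegral (P : SpectralMeasure H) (f : ℝ → ℂ) (B : H →ₗ.[ℂ] H) : Prop where
  mem_domain_iff : ∀ x : H, x ∈ B.domain ↔ ∫⁻ l, ‖f l‖ₑ ^ 2 ∂(P.scalarMeasure x) < ∞
  inner_apply : ∀ x : B.domain, ⟪(x : H), B x⟫ = ∫ l, f l ∂(P.scalarMeasure (x : H))

end SpectralMeasure

namespace LinearPMap

variable {H : Type*} [NormedAddCommGroup H] [InnerProductSpace ℂ H] [CompleteSpace H]

/-- `A > 0`: a (densely defined) selfadjoint operator that is positive and injective. -/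
structure IsStrictlyPositiveOp (A : H →ₗ.[ℂ] H) : Prop where
  isSelfAdjoint : IsSelfAdjoint A
  nonneg : ∀ x : A.domain, 0 ≤ RCLike.re ⟪(x : H), A x⟫
  injective : Function.Injective A

/-- `B = A ^ z` for a selfadjoint operator `A > 0`, by the spectral calculus: if `P` is the spectral
measure of `A`, i.e. `A = ∫ l dP(l)`, which lives on `(0, ∞)`, then `B = ∫ l ^ z dP(l)`. -/
def IsCPow (A : H →ₗ.[ℂ] H) (z : ℂ) (B : H →ₗ.[ℂ] H) : Prop :=
  ∃ P : SpectralMeasure H, P.IsIntegral (fun l => (l : ℂ)) A ∧ P.proj (Set.Iic 0) = 0 ∧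
    P.IsIntegral (fun l => (l : ℂ) ^ z) B

end LinearPMap

/-! ## Antiunitary representations of `ℝˣ` -/

/-- An antiunitary representation of the topological group `ℝˣ` on `H`: a strongly continuous
homomorphism into the group of surjective isometries that are unitary (i.e. `ℂ`-linear) on the
identity component (the positive reals) and antiunitary (i.e. conjugate linear) off it. -/
structure AntiunitaryRep (H : Type*) [NormedAddCommGroup H] [InnerProductSpace ℂ H] extends
    ℝˣ →* (H ≃ₗᵢ[ℝ] H) where
  map_smul_of_pos : ∀ g : ℝˣ, 0 < (g : ℝ) → ∀ (c : ℂ) (x : H), toFun g (c • x) = c • toFun g x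
  map_smul_of_neg : ∀ g : ℝˣ, (g : ℝ) < 0 → ∀ (c : ℂ) (x : H),
    toFun g (c • x) = conj c • toFun g x
  continuous_apply : ∀ x : H, Continuous fun g : ℝˣ => toFun g x

namespace AntiunitaryRep

variable {H : Type*} [NormedAddCommGroup H] [InnerProductSpace ℂ H]

noncomputable instance : CoeFun (AntiunitaryRep H) (fun _ => ℝˣ → (H ≃ₗᵢ[ℝ] H)) :=
  ⟨fun U => U.toMonoidHom⟩

/-- The unitary operator `U(e^t)`, as a `ℂ`-linear map. -/
noncomputable def unitaryGroup (U : AntiunitaryRep H) (t : ℝ) : H →ₗ[ℂ] H where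
  toFun x := U (Units.mk0 (Real.exp t) (Real.exp_ne_zero t)) x
  map_add' := map_add _
  map_smul' := U.map_smul_of_pos _ (Real.exp_pos t)

/-- `Δ` is the modular operator of `U`: a selfadjoint operator `Δ > 0` such that
`U(e^t) = Δ ^ (-it/2π)` for all `t`. -/
def HasModularOperator [CompleteSpace H] (U : AntiunitaryRep H) (D : H →ₗ.[ℂ] H) : Prop :=
  D.IsStrictlyPositiveOp ∧
    ∀ t : ℝ, D.IsCPow (-(Complex.I * t / (2 * Real.pi))) ((U.unitaryGroup t).toPMap ⊤)

end AntiunitaryRep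

/-! ## Modular objects of a standard subspace -/

namespace StandardSubspace

variable {H : Type*} [NormedAddCommGroup H] [InnerProductSpace ℂ H]

/-- `V ∩ iV = 0` in terms of elements. -/
theorem add_I_smul_injective (V : StandardSubspace H) {v w v' w' : H}
    (hv : v ∈ V.toClosedSubmodule) (hw : w ∈ V.toClosedSubmodule)
    (hv' : v' ∈ V.toClosedSubmodule) (hw' : w' ∈ V.toClosedSubmodule)
    (h : v + Complex.I • w = v' + Complex.I • w') : v = v' ∧ w = w' := by
  have h1 : v - v' = Complex.I • (w' - w) := by
    rw [smul_sub, sub_eq_sub_iff_add_eq_add, h, add_comm]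
  have h2 : v - v' ∈ V.toClosedSubmodule ⊓ V.toClosedSubmodule.mulI := by
    refine ⟨V.toClosedSubmodule.toSubmodule.sub_mem hv hv', ?_⟩
    change v - v' ∈ V.toClosedSubmodule.mulI
    rw [h1]
    exact (ClosedSubmodule.mem_mapEquiv_iff' (scalarSMulCLE H Complex.UnitI)
      V.toClosedSubmodule (w' - w)).2 (V.toClosedSubmodule.toSubmodule.sub_mem hw' hw)
  rw [V.IsSeparating] at h2
  have h3 : v - v' = 0 := h2
  refine ⟨sub_eq_zero.1 h3, ?_⟩
  rw [h3] at h1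
  have h4 : w' - w = 0 := by
    rcases smul_eq_zero.1 h1.symm with h5 | h5
    · exact absurd h5 Complex.I_ne_zero
    · exact h5
  exact (sub_eq_zero.1 h4).symm

theorem smul_add_I_smul (c : ℂ) (v w : H) :
    c • (v + Complex.I • w) = (c.re • v - c.im • w) + Complex.I • (c.im • v + c.re • w) := by
  simp only [← Complex.coe_smul]
  conv_lhs => rw [← Complex.re_add_im c]
  match_scalars
  · ring
  · linear_combination (c.im : ℂ) * Complex.I_mul_I

theorem conj_smul_sub_I_smul (c : ℂ) (v w : H) :
    (c.re • v - c.im • w) - Complex.I • (c.im • v + c.re • w) =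
      conj c • (v - Complex.I • w) := by
  have hc : conj c = (c.re : ℂ) - c.im * Complex.I := by
    apply Complex.ext <;> simp
  rw [hc]
  simp only [← Complex.coe_smul]
  match_scalars
  · ring
  · linear_combination (-c.im : ℂ) * Complex.I_mul_I

/-- The complex subspace `V + iV`. -/
def tomitaDomain (V : StandardSubspace H) : Submodule ℂ H where
  carrier := {x | ∃ v ∈ V.toClosedSubmodule, ∃ w ∈ V.toClosedSubmodule, x = v + Complex.I • w}
  zero_mem' := ⟨0, V.toClosedSubmodule.toSubmodule.zero_mem, 0,
    V.toClosedSubmodule.toSubmodule.zero_mem, by simp⟩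
  add_mem' := by
    rintro _ _ ⟨v, hv, w, hw, rfl⟩ ⟨v', hv', w', hw', rfl⟩
    exact ⟨v + v', V.toClosedSubmodule.toSubmodule.add_mem hv hv', w + w',
      V.toClosedSubmodule.toSubmodule.add_mem hw hw', by rw [smul_add]; abel⟩
  smul_mem' := by
    rintro c _ ⟨v, hv, w, hw, rfl⟩
    refine ⟨c.re • v - c.im • w, V.toClosedSubmodule.toSubmodule.sub_mem
      (V.toClosedSubmodule.toSubmodule.smul_mem _ hv)
      (V.toClosedSubmodule.toSubmodule.smul_mem _ hw), c.im • v + c.re • w,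
      V.toClosedSubmodule.toSubmodule.add_mem (V.toClosedSubmodule.toSubmodule.smul_mem _ hv)
      (V.toClosedSubmodule.toSubmodule.smul_mem _ hw), ?_⟩
    exact smul_add_I_smul c v w

theorem exists_decomp (V : StandardSubspace H) (x : V.tomitaDomain) :
    ∃ p : H × H, p.1 ∈ V.toClosedSubmodule ∧ p.2 ∈ V.toClosedSubmodule ∧
      (x : H) = p.1 + Complex.I • p.2 := by
  obtain ⟨v, hv, w, hw, h⟩ := x.2
  exact ⟨(v, w), hv, hw, h⟩

/-- The value `v - iw` of the Tomita operator at `x = v + iw`. -/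
noncomputable def tomitaFun (V : StandardSubspace H) (x : V.tomitaDomain) : H :=
  (V.exists_decomp x).choose.1 - Complex.I • (V.exists_decomp x).choose.2

theorem tomitaFun_eq (V : StandardSubspace H) (x : V.tomitaDomain) {v w : H}
    (hv : v ∈ V.toClosedSubmodule) (hw : w ∈ V.toClosedSubmodule)
    (hx : (x : H) = v + Complex.I • w) : V.tomitaFun x = v - Complex.I • w := by
  obtain ⟨h1, h2, h3⟩ := (V.exists_decomp x).choose_spec
  obtain ⟨h4, h5⟩ := V.add_I_smul_injective h1 h2 hv hw (h3.symm.trans hx)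
  rw [tomitaFun, h4, h5]

/-- The Tomita operator `S_V : V + iV → H`, `S_V (v + iw) = v - iw`, as an unbounded antilinear
operator. -/
noncomputable def tomita (V : StandardSubspace H) : H →ₛₗ.[starRingEnd ℂ] H where
  domain := V.tomitaDomain
  toFun :=
    { toFun := V.tomitaFun
      map_add' := by
        intro x y
        obtain ⟨v, hv, w, hw, h⟩ := x.2
        obtain ⟨v', hv', w', hw', h'⟩ := y.2
        rw [V.tomitaFun_eq x hv hw h, V.tomitaFun_eq y hv' hw' h',
          V.tomitaFun_eq (x + y) (V.toClosedSubmodule.toSubmodule.add_mem hv hv')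
            (V.toClosedSubmodule.toSubmodule.add_mem hw hw')
            (by rw [Submodule.coe_add, h, h', smul_add]; abel)]
        rw [smul_add]; abel
      map_smul' := by
        intro c x
        obtain ⟨v, hv, w, hw, h⟩ := x.2
        rw [V.tomitaFun_eq x hv hw h,
          V.tomitaFun_eq (c • x) (v := c.re • v - c.im • w) (w := c.im • v + c.re • w)
            (V.toClosedSubmodule.toSubmodule.sub_mem
              (V.toClosedSubmodule.toSubmodule.smul_mem _ hv)
              (V.toClosedSubmodule.toSubmodule.smul_mem _ hw))
            (V.toClosedSubmodule.toSubmodule.add_mem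
              (V.toClosedSubmodule.toSubmodule.smul_mem _ hv)
              (V.toClosedSubmodule.toSubmodule.smul_mem _ hw))
            (by rw [Submodule.coe_smul, h, smul_add_I_smul])]
        exact conj_smul_sub_I_smul c v w }

theorem tomita_apply (V : StandardSubspace H) (x : V.tomita.domain) {v w : H}
    (hv : v ∈ V.toClosedSubmodule) (hw : w ∈ V.toClosedSubmodule)
    (hx : (x : H) = v + Complex.I • w) : V.tomita x = v - Complex.I • w :=
  V.tomitaFun_eq x hv hw hx

theorem dense_tomita_domain (V : StandardSubspace H) : Dense (V.tomita.domain : Set H) := by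
  intro x
  have hx : x ∈ V.toClosedSubmodule ⊔ V.toClosedSubmodule.mulI := by
    rw [V.IsCyclic]; trivial
  rw [ClosedSubmodule.mem_sup] at hx
  refine closure_mono ?_ hx
  intro y hy
  obtain ⟨v, hv, u, hu, rfl⟩ := Submodule.mem_sup.1 hy
  obtain ⟨w, hw, rfl⟩ := hu
  exact ⟨v, hv, w, hw, rfl⟩

/-- The graph of `S_V* S_V`: the pairs `(x, y)` with `x ∈ D(S_V)`, `S_V x ∈ D(S_V*)` and
`S_V* S_V x = y`. Here the adjoint of an antilinear operator `S` is given by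
`S* w = y ↔ ∀ z ∈ D(S), ⟪S z, w⟫ = ⟪y, z⟫`. -/
def modularGraph (V : StandardSubspace H) : Submodule ℂ (H × H) where
  carrier := {p | ∃ x : V.tomita.domain, (x : H) = p.1 ∧
    ∀ z : V.tomita.domain, ⟪V.tomita z, V.tomita x⟫ = ⟪p.2, (z : H)⟫}
  zero_mem' := ⟨0, rfl, fun z => by simp⟩
  add_mem' := by
    rintro _ _ ⟨x, hx, h⟩ ⟨y, hy, h'⟩
    refine ⟨x + y, by simp [hx, hy], fun z => ?_⟩
    rw [LinearPMap.map_add, inner_add_right, h, h', Prod.snd_add, inner_add_left]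
  smul_mem' := by
    rintro c _ ⟨x, hx, h⟩
    refine ⟨c • x, by simp [hx], fun z => ?_⟩
    rw [LinearPMap.map_smulₛₗ, inner_smul_right, h, Prod.smul_snd, inner_smul_left]

/-- The modular operator `Δ_V = S_V* S_V`. -/
noncomputable def modularOperator (V : StandardSubspace H) : H →ₗ.[ℂ] H :=
  V.modularGraph.toLinearPMap

theorem graph_modularOperator (V : StandardSubspace H) :
    V.modularOperator.graph = V.modularGraph := by
  refine Submodule.toLinearPMap_graph_eq _ ?_
  rintro ⟨x, y⟩ ⟨⟨x', hx'⟩, hx, h⟩ (h0 : x = 0)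
  change x' = x at hx
  subst hx
  subst h0
  have h1 : (⟨0, hx'⟩ : V.tomita.domain) = 0 := rfl
  refine V.dense_tomita_domain.eq_zero_of_inner_left ℂ fun z hz => ?_
  have := h ⟨z, hz⟩
  rw [h1, LinearPMap.map_zero, inner_zero_right] at this
  exact this.symm

/-- `J` is the modular conjugation `J_V`: the antiunitary operator in the polar decomposition
`S_V = J_V Δ_V^{1/2}` (an equality of unbounded operators, including domains). -/
structure IsModularConjugation [CompleteSpace H] (V : StandardSubspace H) (J : H ≃ₗᵢ[ℝ] H) :
    Prop where
  antilinear : ∀ (c : ℂ) (x : H), J (c • x) = conj c • J x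
  polar : ∃ B : H →ₗ.[ℂ] H, V.modularOperator.IsCPow (1 / 2) B ∧
    V.tomita.domain = B.domain ∧
    ∀ (x : V.tomita.domain) (y : B.domain), (x : H) = y → V.tomita x = J (B y)

end StandardSubspace

open Filter Topology

set_option linter.unusedSectionVars false

/-! Representations and standard subspaces are two descriptions of the same data, a `ModularPair`: a
spectral measure `P` on the positive half-line and an antiunitary involution `J` such that the
scalar measure of `J x` is the image of that of `x` under `l ↦ 1/l`. With `Δ = ∫ l dP` this symmetry
reads `J Δ J = Δ⁻¹`. It makes `S = J Δ^{1/2}` an involution on the domain of `Δ^{1/2}`; its fixed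
points form a standard subspace with Tomita operator `S`, and `S* S = Δ`
(`ModularPair.modularOperator_standard`).

From a representation `U` to a pair: Stone's theorem (`UnitaryFlow.exists_spectralMeasure`) writes
`U(e^t)` as `∫ exp(i t a) dP`, and pushing `P` forward along `exp(-2π a)` gives the spectral measure
of `Δ`. As `U(-1)` is antiunitary and commutes with the flow, comparing Mellin transforms yields the
inversion symmetry (`AntiunitaryRep.exists_modularPair`).

From a standard subspace `V` to a pair (`StandardSubspace.exists_standard_eq`): let `p`, `q` be the
real orthogonal projections onto `V` and `iV`. Then `T = (p + q)/2` is complex linear, `K = (p -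
q)/2` is antilinear, `K² = T - T²` and `K T = (1 - T) K`. The first operator is the resolvent `(1 +
Δ)⁻¹` of `Δ = S* S`, which produces `P`. Since `C = Δ^{1/2} (1 + Δ)⁻¹` satisfies `C² = T - T²`, the
assignment `C x ↦ K x` is isometric and extends to `J`. The commutation rule for `K` and `T` becomes
`J Δ J = Δ⁻¹`, and `V` is recovered because `p = T + K`.

Bijectivity is a matter of uniqueness: an operator determines its scalar measures
(`SpectralMeasure.scalarMeasure_eq_of_isIntegral`), and the polar decomposition determines `J`
(`ModularPair.eq_J`).

The spectral theory rests on one construction, `L2Calculus`: an isometric calculus on a dense class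
of functions extends to `L²` of each scalar measure. Applied to the continuous calculus of a bounded
normal operator it gives the spectral theorem; applied to simple functions of a spectral measure it
gives unbounded integrals. Stone's theorem is reduced to the bounded normal operator `∫₀^∞ e^{-t}
U(t) dt`. -/

/-- A linear family of bounded operators `op a`, indexed by a module `A` of functions `ev a` on a
measurable space, together with finite measures `meas x` for which `ev a ↦ op a x` is isometric
from `L²(meas x)`. Such a calculus extends from `A` to square integrable functions. -/
structure L2Calculus (H : Type*) [NormedAddCommGroup H] [InnerProductSpace ℂ H]
    (X : Type*) [MeasurableSpace X] (A : Type*) [AddCommGroup A] [Module ℂ A] where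
  /-- The function with index `a`. -/
  ev : A →ₗ[ℂ] (X → ℂ)
  /-- The operator with index `a`. -/
  op : A →ₗ[ℂ] (H →L[ℂ] H)
  /-- The scalar measure of a vector. -/
  meas : H → Measure X
  finite : ∀ x, IsFiniteMeasure (meas x)
  memLp_ev : ∀ (a : A) (ν : Measure X) [IsFiniteMeasure ν], MemLp (ev a) 2 ν
  inner_op : ∀ a b x, ⟪op a x, op b x⟫ = ∫ l, conj (ev a l) * ev b l ∂(meas x)
  dense_ev : ∀ (ν : Measure X) [IsFiniteMeasure ν] (f : X → ℂ), MemLp f 2 ν → ∀ ε : ℝ≥0∞, ε ≠ 0 →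
    ∃ a, eLpNorm (f - ev a) 2 ν ≤ ε
  /-- The index of the unit. -/
  unit : A
  ev_unit : ev unit = 1
  op_unit : op unit = 1

theorem MeasureTheory.memLp_two_iff_lintegral {X E : Type*} [MeasurableSpace X]
    [NormedAddCommGroup E] {ν : Measure X} {f : X → E} (hf : AEStronglyMeasurable f ν) :
    MemLp f 2 ν ↔ ∫⁻ l, ‖f l‖ₑ ^ 2 ∂ν < ∞ := by
  have h := eLpNorm_lt_top_iff_lintegral_rpow_enorm_lt_top (μ := ν) (f := f) (p := 2)
    (by simp) (by simp)
  simp only [ENNReal.toReal_ofNat, ENNReal.rpow_ofNat] at h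
  exact ⟨fun h' => h.1 h'.2, fun h' => ⟨hf, h.2 h'⟩⟩

theorem MeasureTheory.MemLp.two_add_measure {X E : Type*} [MeasurableSpace X]
    [NormedAddCommGroup E] {ν ν' : Measure X} {f : X → E} (h : MemLp f 2 ν) (h' : MemLp f 2 ν') :
    MemLp f 2 (ν + ν') := by
  rw [memLp_two_iff_lintegral (h.1.add_measure h'.1), lintegral_add_measure, ENNReal.add_lt_top]
  exact ⟨(memLp_two_iff_lintegral h.1).1 h, (memLp_two_iff_lintegral h'.1).1 h'⟩

/-! ### Extending an isometric calculus to square integrable functions -/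

namespace L2Calculus

variable {H : Type*} [NormedAddCommGroup H] [InnerProductSpace ℂ H] [CompleteSpace H]
  {X : Type*} [MeasurableSpace X] {A : Type*} [AddCommGroup A] [Module ℂ A]

instance (C : L2Calculus H X A) (x : H) : IsFiniteMeasure (C.meas x) := C.finite x

/-- The class of `ev a` in `L²(meas x)`. -/
noncomputable def evLp (C : L2Calculus H X A) (x : H) : A →ₗ[ℂ] Lp ℂ 2 (C.meas x) where
  toFun a := (C.memLp_ev a _).toLp _
  map_add' a b := by
    rw [← MemLp.toLp_add]; congr 1; exact map_add _ _ _
  map_smul' c a := by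
    rw [RingHom.id_apply, ← MemLp.toLp_const_smul]; congr 1; exact map_smul _ _ _

/-- The map `a ↦ op a x`. -/
noncomputable def opAt (C : L2Calculus H X A) (x : H) : A →ₗ[ℂ] H :=
  (ContinuousLinearMap.apply ℂ H x).toLinearMap ∘ₗ C.op

theorem opAt_apply (C : L2Calculus H X A) (x : H) (a : A) : C.opAt x a = C.op a x := rfl

theorem norm_opAt (C : L2Calculus H X A) (x : H) (a : A) : ‖C.opAt x a‖ = ‖C.evLp x a‖ := by
  have h : (⟪C.opAt x a, C.opAt x a⟫ : ℂ) = ⟪C.evLp x a, C.evLp x a⟫ := by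
    rw [opAt_apply, C.inner_op, L2.inner_def]
    refine integral_congr_ae ?_
    filter_upwards [(C.memLp_ev a (C.meas x)).coeFn_toLp] with l hl
    simp only [evLp, LinearMap.coe_mk, AddHom.coe_mk, hl, RCLike.inner_apply]
    ring
  rw [inner_self_eq_norm_sq_to_K, inner_self_eq_norm_sq_to_K] at h
  have h' : ‖C.opAt x a‖ ^ 2 = ‖C.evLp x a‖ ^ 2 := by exact_mod_cast h
  exact (sq_eq_sq₀ (norm_nonneg _) (norm_nonneg _)).1 h'

theorem denseRange_evLp (C : L2Calculus H X A) (x : H) : DenseRange (C.evLp x) := by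
  intro f
  rw [Metric.mem_closure_range_iff]
  intro ε hε
  obtain ⟨a, ha⟩ := C.dense_ev (C.meas x) f (Lp.memLp f) (ENNReal.ofReal (ε / 2))
    (by simpa using hε)
  refine ⟨a, ?_⟩
  rw [dist_eq_norm, ← Lp.toLp_coeFn f (Lp.memLp f)]
  change ‖_ - (C.memLp_ev a (C.meas x)).toLp _‖ < ε
  rw [← MemLp.toLp_sub, Lp.norm_toLp]
  have := ENNReal.toReal_mono ENNReal.ofReal_ne_top ha
  rw [ENNReal.toReal_ofReal (by positivity)] at this
  linarith

/-- The isometric extension of `ev a ↦ op a x` to `L²(meas x)`. -/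
noncomputable def ext (C : L2Calculus H X A) (x : H) : Lp ℂ 2 (C.meas x) →ₗᵢ[ℂ] H where
  toLinearMap := (C.opAt x).extendOfNorm (C.evLp x)
  norm_map' := by
    refine (C.denseRange_evLp x).induction ?_ (isClosed_eq (by
      exact ((C.opAt x).extendOfNorm (C.evLp x)).continuous.norm) continuous_norm)
    rintro _ ⟨a, rfl⟩
    change ‖(C.opAt x).extendOfNorm (C.evLp x) _‖ = _
    rw [LinearMap.extendOfNorm_eq (C.denseRange_evLp x) ⟨1, fun a => by
      rw [one_mul, norm_opAt]⟩, norm_opAt]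

theorem ext_evLp (C : L2Calculus H X A) (x : H) (a : A) : C.ext x (C.evLp x a) = C.op a x :=
  LinearMap.extendOfNorm_eq (C.denseRange_evLp x) ⟨1, fun a => by
      rw [one_mul, norm_opAt]⟩ a

open Classical in
/-- The value `(∫ f) x`; it is `0` unless `f ∈ L²(meas x)`. -/
noncomputable def vec (C : L2Calculus H X A) (f : X → ℂ) (x : H) : H :=
  if h : MemLp f 2 (C.meas x) then C.ext x (h.toLp f) else 0

theorem vec_of_memLp (C : L2Calculus H X A) {f : X → ℂ} {x : H} (h : MemLp f 2 (C.meas x)) :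
    C.vec f x = C.ext x (h.toLp f) := dif_pos h

theorem vec_ev (C : L2Calculus H X A) (a : A) (x : H) : C.vec (C.ev a) x = C.op a x := by
  rw [C.vec_of_memLp (C.memLp_ev a _), ← ext_evLp]; rfl

theorem inner_vec (C : L2Calculus H X A) {f g : X → ℂ} {x : H} (hf : MemLp f 2 (C.meas x))
    (hg : MemLp g 2 (C.meas x)) :
    ⟪C.vec f x, C.vec g x⟫ = ∫ l, conj (f l) * g l ∂(C.meas x) := by
  rw [C.vec_of_memLp hf, C.vec_of_memLp hg, LinearIsometry.inner_map_map, L2.inner_def]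
  refine integral_congr_ae ?_
  filter_upwards [hf.coeFn_toLp, hg.coeFn_toLp] with l h1 h2
  simp only [h1, h2, RCLike.inner_apply]
  ring

theorem vec_congr (C : L2Calculus H X A) {f g : X → ℂ} {x : H} (h : f =ᵐ[C.meas x] g) :
    C.vec f x = C.vec g x := by
  by_cases hf : MemLp f 2 (C.meas x)
  · rw [C.vec_of_memLp hf, C.vec_of_memLp ((memLp_congr_ae h).1 hf)]
    congr 1
    exact MemLp.toLp_congr _ _ h
  · rw [vec, vec, dif_neg hf, dif_neg (fun h' => hf ((memLp_congr_ae h).2 h'))]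

theorem vec_add_fun (C : L2Calculus H X A) {f g : X → ℂ} {x : H} (hf : MemLp f 2 (C.meas x))
    (hg : MemLp g 2 (C.meas x)) : C.vec (f + g) x = C.vec f x + C.vec g x := by
  rw [C.vec_of_memLp hf, C.vec_of_memLp hg, C.vec_of_memLp (hf.add hg), MemLp.toLp_add, map_add]

theorem vec_smul_fun (C : L2Calculus H X A) (c : ℂ) {f : X → ℂ} {x : H}
    (hf : MemLp f 2 (C.meas x)) : C.vec (c • f) x = c • C.vec f x := by
  rw [C.vec_of_memLp hf, C.vec_of_memLp (hf.const_smul c), MemLp.toLp_const_smul, map_smul]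

/-- Square integrable functions for a finite measure are limits of functions `ev a`. -/
theorem exists_seq (C : L2Calculus H X A) (ν : Measure X) [IsFiniteMeasure ν] {f : X → ℂ}
    (hf : MemLp f 2 ν) :
    ∃ a : ℕ → A, Tendsto (fun n => eLpNorm (C.ev (a n) - f) 2 ν) atTop (𝓝 0) := by
  choose a ha using fun n : ℕ => C.dense_ev ν f hf ((n : ℝ≥0∞) + 1)⁻¹ (by simp)
  refine ⟨a, ?_⟩
  refine tendsto_of_tendsto_of_tendsto_of_le_of_le tendsto_const_nhds
    (g := fun _ => 0) (h := fun n : ℕ => ((n : ℝ≥0∞) + 1)⁻¹) ?_ (fun n => zero_le) ?_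
  · have := ENNReal.tendsto_inv_nat_nhds_zero.comp (tendsto_add_atTop_nat 1)
    refine this.congr fun n => ?_
    simp
  · intro n
    change eLpNorm (C.ev (a n) - f) 2 ν ≤ _
    rw [eLpNorm_sub_comm]
    exact ha n

theorem tendsto_vec (C : L2Calculus H X A) {x : H} {f : X → ℂ} (hf : MemLp f 2 (C.meas x))
    {a : ℕ → A} (ha : Tendsto (fun n => eLpNorm (C.ev (a n) - f) 2 (C.meas x)) atTop (𝓝 0)) :
    Tendsto (fun n => C.op (a n) x) atTop (𝓝 (C.vec f x)) := by
  rw [C.vec_of_memLp hf]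
  have h := (Lp.tendsto_Lp_iff_tendsto_eLpNorm'' (fun n => C.ev (a n))
    (fun n => C.memLp_ev (a n) (C.meas x)) f hf).2 ha
  refine (((C.ext x).continuous.tendsto _).comp h).congr fun n => ?_
  exact C.ext_evLp x (a n)

theorem tendsto_eLpNorm_mono {ν ν' : Measure X} (h : ν ≤ ν') {f : ℕ → X → ℂ}
    (hf : Tendsto (fun n => eLpNorm (f n) 2 ν') atTop (𝓝 0)) :
    Tendsto (fun n => eLpNorm (f n) 2 ν) atTop (𝓝 0) :=
  tendsto_of_tendsto_of_tendsto_of_le_of_le tendsto_const_nhds hf (fun _ => zero_le)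
    fun n => eLpNorm_mono_measure (f n) h

/-- The three vectors have three different scalar measures. One sequence approximating `f` in `L²`
of the sum of these measures converges for all of them at once, so linearity of each `op a` passes
to the limit. -/
theorem vec_add (C : L2Calculus H X A) {f : X → ℂ} {x y : H} (hx : MemLp f 2 (C.meas x))
    (hy : MemLp f 2 (C.meas y)) (hxy : MemLp f 2 (C.meas (x + y))) :
    C.vec f (x + y) = C.vec f x + C.vec f y := by
  obtain ⟨a, ha⟩ := C.exists_seq (C.meas x + (C.meas y + C.meas (x + y)))
    (hx.two_add_measure (hy.two_add_measure hxy))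
  have h1 := C.tendsto_vec hx (tendsto_eLpNorm_mono (Measure.le_add_right le_rfl) ha)
  have h2 := C.tendsto_vec hy (tendsto_eLpNorm_mono
    (Measure.le_add_left (Measure.le_add_right le_rfl)) ha)
  have h3 := C.tendsto_vec hxy (tendsto_eLpNorm_mono
    (Measure.le_add_left (Measure.le_add_left le_rfl)) ha)
  refine tendsto_nhds_unique h3 ((h1.add h2).congr fun n => ?_)
  rw [map_add]

theorem vec_smul (C : L2Calculus H X A) {f : X → ℂ} {x : H} (c : ℂ) (hx : MemLp f 2 (C.meas x))
    (hcx : MemLp f 2 (C.meas (c • x))) : C.vec f (c • x) = c • C.vec f x := by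
  obtain ⟨a, ha⟩ := C.exists_seq (C.meas x + C.meas (c • x)) (hx.two_add_measure hcx)
  have h1 := C.tendsto_vec hx (tendsto_eLpNorm_mono (Measure.le_add_right le_rfl) ha)
  have h2 := C.tendsto_vec hcx (tendsto_eLpNorm_mono (Measure.le_add_left le_rfl) ha)
  refine tendsto_nhds_unique h2 ((h1.const_smul c).congr fun n => ?_)
  rw [map_smul]

end L2Calculus

/-- Complex polarization. Operators are identified throughout by comparing quadratic forms, that is,
integrals against scalar measures. -/
theorem ContinuousLinearMap.ext_of_inner_self {H : Type*} [NormedAddCommGroup H]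
    [InnerProductSpace ℂ H] {S T : H →L[ℂ] H} (h : ∀ x, ⟪x, S x⟫ = ⟪x, T x⟫) : S = T := by
  have := (ext_inner_map S.toLinearMap T.toLinearMap).1 fun x => by
    simp only [ContinuousLinearMap.coe_coe]
    rw [← inner_conj_symm, h x, inner_conj_symm]
  exact ContinuousLinearMap.coe_injective this

/-! ### Bounded functions and the spectral measure of a calculus -/

namespace L2Calculus

variable {H : Type*} [NormedAddCommGroup H] [InnerProductSpace ℂ H] [CompleteSpace H]
  {X : Type*} [MeasurableSpace X] {A : Type*} [AddCommGroup A] [Module ℂ A]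

theorem norm_sq_vec (C : L2Calculus H X A) {f : X → ℂ} {x : H} (hf : MemLp f 2 (C.meas x)) :
    ‖C.vec f x‖ ^ 2 = ∫ l, ‖f l‖ ^ 2 ∂(C.meas x) := by
  have h := C.inner_vec hf hf
  rw [inner_self_eq_norm_sq_to_K] at h
  have : ∀ l, conj (f l) * f l = ((‖f l‖ ^ 2 : ℝ) : ℂ) := fun l => by
    rw [Complex.conj_mul']; push_cast; rfl
  simp_rw [this] at h
  rw [integral_complex_ofReal] at h
  refine Complex.ofReal_injective ?_
  rw [Complex.ofReal_pow]
  exact h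

theorem vec_sub_fun (C : L2Calculus H X A) {f g : X → ℂ} {x : H} (hf : MemLp f 2 (C.meas x))
    (hg : MemLp g 2 (C.meas x)) : C.vec (f - g) x = C.vec f x - C.vec g x := by
  rw [C.vec_of_memLp hf, C.vec_of_memLp hg, C.vec_of_memLp (hf.sub hg), MemLp.toLp_sub, map_sub]

theorem vec_one (C : L2Calculus H X A) (x : H) : C.vec 1 x = x := by
  rw [← C.ev_unit, C.vec_ev, C.op_unit]; rfl

theorem memLp_one (C : L2Calculus H X A) (x : H) : MemLp (1 : X → ℂ) 2 (C.meas x) := by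
  rw [← C.ev_unit]; exact C.memLp_ev _ _

theorem inner_self_vec (C : L2Calculus H X A) {f : X → ℂ} {x : H} (hf : MemLp f 2 (C.meas x)) :
    ⟪x, C.vec f x⟫ = ∫ l, f l ∂(C.meas x) := by
  conv_lhs => rw [← C.vec_one x]
  rw [vec_one, ← C.vec_one x, C.vec_one x]
  have := C.inner_vec (C.memLp_one x) hf
  simpa [C.vec_one x] using this

theorem meas_univ (C : L2Calculus H X A) (x : H) : (C.meas x).real Set.univ = ‖x‖ ^ 2 := by
  have := C.norm_sq_vec (C.memLp_one x)
  rw [C.vec_one] at this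
  simpa using this.symm

/-- By isometry the squared distance to the limit is `∫ ‖F i - f‖²`, to which dominated convergence
applies with bound `(2 G)²`. -/
theorem tendsto_vec_of_dominated (C : L2Calculus H X A) {ι : Type*} {p : Filter ι}
    [p.IsCountablyGenerated] {F : ι → X → ℂ} {f : X → ℂ} {x : H} (G : X → ℝ)
    (hF : ∀ i, AEStronglyMeasurable (F i) (C.meas x)) (hf : AEStronglyMeasurable f (C.meas x))
    (hG : MemLp G 2 (C.meas x)) (hFG : ∀ i, ∀ᵐ l ∂(C.meas x), ‖F i l‖ ≤ G l)
    (hfG : ∀ᵐ l ∂(C.meas x), ‖f l‖ ≤ G l)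
    (hlim : ∀ᵐ l ∂(C.meas x), Tendsto (fun i => F i l) p (𝓝 (f l))) :
    Tendsto (fun i => C.vec (F i) x) p (𝓝 (C.vec f x)) := by
  have hFm : ∀ i, MemLp (F i) 2 (C.meas x) := fun i => hG.mono' (hF i) (hFG i)
  have hfm : MemLp f 2 (C.meas x) := hG.mono' hf hfG
  rw [tendsto_iff_norm_sub_tendsto_zero]
  have h1 : ∀ i, ‖C.vec (F i) x - C.vec f x‖ =
      Real.sqrt (∫ l, ‖F i l - f l‖ ^ 2 ∂(C.meas x)) := fun i => by
    rw [← C.vec_sub_fun (hFm i) hfm]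
    have := C.norm_sq_vec ((hFm i).sub hfm)
    simp only [Pi.sub_apply] at this
    rw [← this, Real.sqrt_sq (norm_nonneg _)]
  simp_rw [h1]
  have h2 : Tendsto (fun i => ∫ l, ‖F i l - f l‖ ^ 2 ∂(C.meas x)) p
      (𝓝 (∫ _, (0 : ℝ) ∂(C.meas x))) := by
    refine tendsto_integral_filter_of_dominated_convergence (fun l => (2 * G l) ^ 2) ?_ ?_ ?_ ?_
    · exact Eventually.of_forall fun i => (((hF i).sub hf).norm.pow 2)
    · refine Eventually.of_forall fun i => ?_
      filter_upwards [hFG i, hfG] with l hl1 hl2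
      rw [Real.norm_of_nonneg (by positivity)]
      have := norm_sub_le (F i l) (f l)
      gcongr
      linarith
    · exact (hG.const_mul 2).integrable_sq
    · filter_upwards [hlim] with l hl
      have h3 := (tendsto_iff_norm_sub_tendsto_zero.1 hl).pow 2
      simpa using h3
  have h3 := (Real.continuous_sqrt.tendsto _).comp h2
  rwa [integral_zero, Real.sqrt_zero] at h3

theorem memLp_of_bounded {ν : Measure X} [IsFiniteMeasure ν] {f : X → ℂ} (hf : Measurable f)
    {M : ℝ} (hM : ∀ l, ‖f l‖ ≤ M) : MemLp f 2 ν :=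
  MemLp.of_bound hf.aestronglyMeasurable M (Eventually.of_forall hM)

open Classical in
/-- The bounded operator `∫ f` for a bounded measurable function `f`. -/
noncomputable def bop (C : L2Calculus H X A) (f : X → ℂ) : H →L[ℂ] H :=
  if h : ∃ T : H →L[ℂ] H, ∀ x, T x = C.vec f x then h.choose else 0

theorem bop_apply (C : L2Calculus H X A) {f : X → ℂ} (hf : Measurable f) {M : ℝ}
    (hM : ∀ l, ‖f l‖ ≤ M) (x : H) : C.bop f x = C.vec f x := by
  have hm : ∀ x, MemLp f 2 (C.meas x) := fun x => memLp_of_bounded hf hM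
  have h : ∃ T : H →L[ℂ] H, ∀ x, T x = C.vec f x := by
    refine ⟨LinearMap.mkContinuous ⟨⟨C.vec f, fun x y => C.vec_add (hm _) (hm _) (hm _)⟩,
      fun c x => C.vec_smul c (hm _) (hm _)⟩ |M| fun x => ?_, fun x => rfl⟩
    change ‖C.vec f x‖ ≤ |M| * ‖x‖
    refine le_of_sq_le_sq ?_ (by positivity)
    rw [C.norm_sq_vec (hm x), mul_pow, ← C.meas_univ x]
    have : ∫ _, M ^ 2 ∂(C.meas x) = |M| ^ 2 * (C.meas x).real Set.univ := by
      rw [integral_const, smul_eq_mul, mul_comm, sq_abs]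
    rw [← this]
    refine integral_mono (hm x).integrable_norm_pow' (integrable_const _) fun l => ?_
    have := hM l
    simp only
    gcongr
  rw [bop, dif_pos h]
  exact h.choose_spec x

/-- The spectral measure `s ↦ ∫ 1_{ψ⁻¹ s}`. -/
noncomputable def toSpectralMeasure (C : L2Calculus H X A) (ψ : X → ℝ) (hψ : Measurable ψ) :
    SpectralMeasure H :=
  have hm : ∀ s, MeasurableSet s → Measurable ((ψ ⁻¹' s).indicator (1 : X → ℂ)) :=
    fun s hs => measurable_one.indicator (hψ hs)
  have hb : ∀ s l, ‖(ψ ⁻¹' s).indicator (1 : X → ℂ) l‖ ≤ 1 := fun s l => by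
    by_cases h : l ∈ ψ ⁻¹' s <;> simp [h]
  { proj := fun s => C.bop ((ψ ⁻¹' s).indicator 1)
    isStarProjection := fun s hs => by
      set T := C.bop ((ψ ⁻¹' s).indicator 1)
      -- This one identity yields both selfadjointness, as its left side is selfadjoint, and
      -- idempotence. It holds since an indicator equals its own squared modulus.
      have h1 : star T * T = T := by
        refine ContinuousLinearMap.ext_of_inner_self fun x => ?_
        rw [ContinuousLinearMap.star_eq_adjoint, mul_apply_eq_comp,
          ContinuousLinearMap.adjoint_inner_right]
        simp only [T, C.bop_apply (hm s hs) (hb s)]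
        have hL := memLp_of_bounded (ν := C.meas x) (hm s hs) (hb s)
        rw [C.inner_vec hL hL, C.inner_self_vec hL]
        congr 1
        ext l
        by_cases h : l ∈ ψ ⁻¹' s <;> simp [h]
      have h2 : star T = T := by rw [← h1, star_mul, star_star]
      exact ⟨by rw [h2] at h1; exact h1, h2⟩
    proj_univ := by
      ext x
      rw [C.bop_apply (hm _ MeasurableSet.univ) (hb _), Set.preimage_univ, Set.indicator_univ,
        C.vec_one]
      rfl
    hasSum_iUnion := fun f hf hd x => by
      classical
      rw [C.bop_apply (hm _ (MeasurableSet.iUnion hf)) (hb _)]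
      have h0 : ∀ n, C.bop ((ψ ⁻¹' f n).indicator 1) x = C.vec ((ψ ⁻¹' f n).indicator 1) x :=
        fun n => C.bop_apply (hm _ (hf n)) (hb _) x
      simp_rw [h0]
      have hL : ∀ n, MemLp ((ψ ⁻¹' f n).indicator (1 : X → ℂ)) 2 (C.meas x) := fun n =>
        memLp_of_bounded (hm _ (hf n)) (hb _)
      have h1 : ∀ F : Finset ℕ, ∑ n ∈ F, C.vec ((ψ ⁻¹' f n).indicator 1) x =
          C.vec ((ψ ⁻¹' (⋃ n ∈ F, f n)).indicator 1) x := by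
        intro F
        induction F using Finset.induction_on with
        | empty =>
          have := C.vec_smul_fun 0 (C.memLp_one x)
          simp only [zero_smul] at this
          simp only [Finset.sum_empty, Finset.notMem_empty, Set.iUnion_of_empty, Set.iUnion_empty,
            Set.preimage_empty, Set.indicator_empty']
          exact this.symm
        | insert a F ha ih =>
          rw [Finset.sum_insert ha, ih, Finset.set_biUnion_insert, Set.preimage_union,
            Set.indicator_union_of_disjoint, ← C.vec_add_fun (hL a)]
          · rfl
          · exact memLp_of_bounded (hm _ (F.measurableSet_biUnion fun n _ => hf n)) (hb _)
          · refine Disjoint.preimage _ (Set.disjoint_iUnion₂_right.2 fun n hn => hd ?_)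
            rintro rfl
            exact ha hn
      change Tendsto _ _ _
      simp_rw [h1]
      refine C.tendsto_vec_of_dominated (fun _ => 1) (fun F => ?_) ?_ (memLp_const 1) ?_ ?_ ?_
      · exact (hm _ (F.measurableSet_biUnion fun n _ => hf n)).aestronglyMeasurable
      · exact (hm _ (MeasurableSet.iUnion hf)).aestronglyMeasurable
      · exact fun F => Eventually.of_forall (hb _)
      · exact Eventually.of_forall (hb _)
      · refine Eventually.of_forall fun l => tendsto_nhds_of_eventually_eq ?_
        by_cases h : ∃ n, ψ l ∈ f n
        · obtain ⟨n, hn⟩ := h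
          filter_upwards [eventually_ge_atTop {n}] with F hF
          rw [Set.indicator_of_mem, Set.indicator_of_mem]
          · exact Set.mem_iUnion_of_mem n hn
          · exact Set.mem_biUnion (hF (Finset.mem_singleton_self n)) hn
        · refine Eventually.of_forall fun F => ?_
          rw [Set.indicator_of_notMem, Set.indicator_of_notMem] <;>
          · simp only [Set.mem_preimage, Set.mem_iUnion]
            push Not at h
            simp [h] }

theorem scalarMeasure_toSpectralMeasure (C : L2Calculus H X A) (ψ : X → ℝ) (hψ : Measurable ψ)
    (x : H) : (C.toSpectralMeasure ψ hψ).scalarMeasure x = (C.meas x).map ψ := by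
  ext s hs
  have hm : Measurable ((ψ ⁻¹' s).indicator (1 : X → ℂ)) := measurable_one.indicator (hψ hs)
  have hb : ∀ l, ‖(ψ ⁻¹' s).indicator (1 : X → ℂ) l‖ ≤ 1 := fun l => by
    by_cases h : l ∈ ψ ⁻¹' s <;> simp [h]
  rw [SpectralMeasure.scalarMeasure_apply _ _ hs, Measure.map_apply hψ hs]
  change ENNReal.ofReal (‖C.bop ((ψ ⁻¹' s).indicator 1) x‖ ^ 2) = _
  rw [C.bop_apply hm hb, C.norm_sq_vec (memLp_of_bounded hm hb)]
  have : ∀ l, ‖(ψ ⁻¹' s).indicator (1 : X → ℂ) l‖ ^ 2 = (ψ ⁻¹' s).indicator (1 : X → ℝ) l :=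
    fun l => by by_cases h : l ∈ ψ ⁻¹' s <;> simp [h]
  simp_rw [this]
  rw [integral_indicator_one (hψ hs), measureReal_def, ENNReal.ofReal_toReal (by finiteness)]

end L2Calculus

/-! ### Scalar measures of a representation of `C(X)` -/

section ContinuousCalculus

variable {H : Type*} [NormedAddCommGroup H] [InnerProductSpace ℂ H] [CompleteSpace H]
  {X : Type*} [TopologicalSpace X] [CompactSpace X] [T2Space X]

/-- A real continuous function as a complex one. -/
noncomputable def ContinuousMap.complexOfReal : C(X, ℝ) →ₗ[ℝ] C(X, ℂ) where
  toFun f := ⟨fun l => (f l : ℂ), by fun_prop⟩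
  map_add' f g := by ext; simp
  map_smul' c f := by ext; simp

theorem ContinuousMap.complexOfReal_apply (f : C(X, ℝ)) (l : X) :
    ContinuousMap.complexOfReal f l = (f l : ℂ) := rfl

theorem StarAlgHom.inner_star_mul (π : C(X, ℂ) →⋆ₐ[ℂ] (H →L[ℂ] H)) (f g : C(X, ℂ)) (x : H) :
    ⟪π f x, π g x⟫ = ⟪x, π (star f * g) x⟫ := by
  rw [map_mul, map_star, mul_apply_eq_comp, ContinuousLinearMap.star_eq_adjoint,
    ContinuousLinearMap.adjoint_inner_right]

/-- A nonnegative `f` is `star g * g` with `g = √f`, so the form equals `‖π g x‖²`. This positivity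
is what the Riesz representation theorem needs. -/
theorem StarAlgHom.re_inner_nonneg (π : C(X, ℂ) →⋆ₐ[ℂ] (H →L[ℂ] H)) (x : H) {f : C(X, ℝ)}
    (hf : 0 ≤ f) : 0 ≤ (⟪x, π (ContinuousMap.complexOfReal f) x⟫ : ℂ).re := by
  let g : C(X, ℂ) := ⟨fun l => ((Real.sqrt (f l) : ℝ) : ℂ), by fun_prop⟩
  have hg : ContinuousMap.complexOfReal f = star g * g := by
    ext l
    simp only [ContinuousMap.complexOfReal_apply, ContinuousMap.mul_apply, ContinuousMap.star_apply,
      g, ContinuousMap.coe_mk, RCLike.star_def, Complex.conj_ofReal, ← Complex.ofReal_mul]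
    rw [Real.mul_self_sqrt (show (0 : ℝ) ≤ f l from hf l)]
  rw [hg, ← π.inner_star_mul]
  exact inner_self_nonneg (𝕜 := ℂ)

variable [MeasurableSpace X] [BorelSpace X]

/-- The positive functional `f ↦ ⟪x, π f x⟫` on real continuous functions. -/
noncomputable def StarAlgHom.functional (π : C(X, ℂ) →⋆ₐ[ℂ] (H →L[ℂ] H)) (x : H) :
    CompactlySupportedContinuousMap X ℝ →ₚ[ℝ] ℝ :=
  PositiveLinearMap.mk₀
    { toFun := fun f => (⟪x, π (ContinuousMap.complexOfReal f.toContinuousMap) x⟫ : ℂ).re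
      map_add' := fun f g => by
        have : (f + g).toContinuousMap = f.toContinuousMap + g.toContinuousMap := rfl
        rw [this, map_add, map_add, add_apply, inner_add_right, Complex.add_re]
      map_smul' := fun c f => by
        have : (c • f).toContinuousMap = c • f.toContinuousMap := rfl
        have h2 : (c • ContinuousMap.complexOfReal f.toContinuousMap) =
          (c : ℂ) • ContinuousMap.complexOfReal f.toContinuousMap := by ext; simp
        rw [this, map_smul, h2, map_smul, smul_apply, inner_smul_right]
        simp }
    fun f hf => π.re_inner_nonneg x fun l => hf l

/-- The measure with `⟪x, π f x⟫ = ∫ f`. -/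
noncomputable def StarAlgHom.scalarMeasure (π : C(X, ℂ) →⋆ₐ[ℂ] (H →L[ℂ] H)) (x : H) : Measure X :=
  RealRMK.rieszMeasure (π.functional x)

instance (π : C(X, ℂ) →⋆ₐ[ℂ] (H →L[ℂ] H)) (x : H) : IsFiniteMeasure (π.scalarMeasure x) := by
  unfold StarAlgHom.scalarMeasure; infer_instance

theorem StarAlgHom.integral_ofReal (π : C(X, ℂ) →⋆ₐ[ℂ] (H →L[ℂ] H)) (x : H) (f : C(X, ℝ)) :
    ⟪x, π (ContinuousMap.complexOfReal f) x⟫ = ((∫ l, f l ∂(π.scalarMeasure x) : ℝ) : ℂ) := by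
  have h := RealRMK.integral_rieszMeasure (π.functional x)
    (CompactlySupportedContinuousMap.continuousMapEquiv f)
  change ∫ l, f l ∂(π.scalarMeasure x) =
    (⟪x, π (ContinuousMap.complexOfReal f) x⟫ : ℂ).re at h
  rw [h]
  have hs : star (ContinuousMap.complexOfReal f) = ContinuousMap.complexOfReal f := by
    ext l; simp [ContinuousMap.complexOfReal_apply]
  have h1 : conj (⟪x, π (ContinuousMap.complexOfReal f) x⟫ : ℂ) =
      ⟪x, π (ContinuousMap.complexOfReal f) x⟫ := by
    rw [inner_conj_symm]
    conv_rhs => rw [← hs, map_star, ContinuousLinearMap.star_eq_adjoint,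
      ContinuousLinearMap.adjoint_inner_right]
  exact (Complex.conj_eq_iff_re.1 h1).symm

theorem StarAlgHom.integral_eq (π : C(X, ℂ) →⋆ₐ[ℂ] (H →L[ℂ] H)) (x : H) (f : C(X, ℂ)) :
    ⟪x, π f x⟫ = ∫ l, f l ∂(π.scalarMeasure x) := by
  let u : C(X, ℝ) := ⟨fun l => (f l).re, by fun_prop⟩
  let v : C(X, ℝ) := ⟨fun l => (f l).im, by fun_prop⟩
  have hf : f = ContinuousMap.complexOfReal u + Complex.I • ContinuousMap.complexOfReal v := by
    ext l
    simp [ContinuousMap.complexOfReal_apply, u, v, mul_comm Complex.I, Complex.re_add_im]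
  have hi : Integrable f (π.scalarMeasure x) := by
    obtain ⟨M, hM⟩ := (isCompact_range f.continuous).isBounded.exists_norm_le
    exact Integrable.of_bound f.continuous.aestronglyMeasurable M
      (Eventually.of_forall fun l => hM _ ⟨l, rfl⟩)
  have h2 := integral_re_add_im hi
  rw [← h2]
  conv_lhs => rw [hf, map_add, map_smul, add_apply,
    smul_apply, inner_add_right, inner_smul_right, π.integral_ofReal,
    π.integral_ofReal]
  rw [mul_comm Complex.I]
  rfl

end ContinuousCalculus

/-! ### The spectral theorem for bounded normal operators -/

section Normal

variable {H : Type*} [NormedAddCommGroup H] [InnerProductSpace ℂ H] [CompleteSpace H]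
  {X : Type*} [MetricSpace X] [CompactSpace X] [MeasurableSpace X] [BorelSpace X]

/-- A `*`-homomorphism on continuous functions extends to measurable functions. -/
noncomputable def StarAlgHom.calculus (π : C(X, ℂ) →⋆ₐ[ℂ] (H →L[ℂ] H)) :
    L2Calculus H X C(X, ℂ) where
  ev := ContinuousMap.coeFnLinearMap ℂ
  op := (π : C(X, ℂ) →ₐ[ℂ] (H →L[ℂ] H)).toLinearMap
  meas := π.scalarMeasure
  finite x := inferInstance
  memLp_ev f ν _ := by
    obtain ⟨M, hM⟩ := (isCompact_range f.continuous).isBounded.exists_norm_le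
    exact MemLp.of_bound f.continuous.aestronglyMeasurable M
      (Eventually.of_forall fun l => hM _ ⟨l, rfl⟩)
  inner_op f g x := (π.inner_star_mul f g x).trans (π.integral_eq x _)
  dense_ev ν _ f hf ε hε := by
    obtain ⟨g, hg, -⟩ := hf.exists_boundedContinuous_eLpNorm_sub_le (by simp) hε
    exact ⟨g.toContinuousMap, hg⟩
  unit := 1
  ev_unit := rfl
  op_unit := map_one π

/-- The spectral theorem for bounded normal operators. -/
theorem ContinuousLinearMap.exists_spectralMeasure (N : H →L[ℂ] H) (hN : IsStarNormal N) :
    ∃ (P : SpectralMeasure H) (g : ℝ → ℂ), Measurable g ∧ (∃ M : ℝ, ∀ l, ‖g l‖ ≤ M) ∧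
      ∀ x, ⟪x, N x⟫ = ∫ l, g l ∂(P.scalarMeasure x) := by
  have hc : IsCompact (spectrum ℂ N) := spectrum.isCompact N
  have : CompactSpace (spectrum ℂ N) := isCompact_iff_compactSpace.1 hc
  -- The spectrum lies in `ℂ` but a `SpectralMeasure` lives on `ℝ`; a Borel isomorphism moves it
  -- there. The function integrated is then the inverse isomorphism, cut off outside the spectrum to
  -- keep it bounded.
  let e : ℂ ≃ᵐ ℝ := PolishSpace.measurableEquivOfNotCountable
    (by
      rw [← Cardinal.mk_le_aleph0_iff, Cardinal.mk_complex, not_le]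
      exact Cardinal.aleph0_lt_continuum)
    (by
      rw [← Cardinal.mk_le_aleph0_iff, Cardinal.mk_real, not_le]
      exact Cardinal.aleph0_lt_continuum)
  have he : Measurable fun l : spectrum ℂ N => e l := e.measurable.comp measurable_subtype_coe
  refine ⟨(cfcHom hN).calculus.toSpectralMeasure (fun l => e l) he,
    fun l => (spectrum ℂ N).indicator id (e.symm l), ?_, ?_, fun x => ?_⟩
  · exact (measurable_id.indicator hc.measurableSet).comp e.symm.measurable
  · obtain ⟨M, hM⟩ := hc.isBounded.exists_norm_le
    refine ⟨max M 0, fun l => ?_⟩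
    by_cases h : e.symm l ∈ spectrum ℂ N
    · simp only [Set.indicator_of_mem h, id]
      exact (hM _ h).trans (le_max_left _ _)
    · simp [h]
  · rw [L2Calculus.scalarMeasure_toSpectralMeasure, integral_map he.aemeasurable]
    · simp only [MeasurableEquiv.symm_apply_apply, Subtype.coe_prop, Set.indicator_of_mem, id]
      have h := (cfcHom hN).integral_eq x ((ContinuousMap.id ℂ).restrict (spectrum ℂ N))
      rw [cfcHom_id hN] at h
      exact h
    · exact ((measurable_id.indicator hc.measurableSet).comp
        e.symm.measurable).aestronglyMeasurable

end Normal

/-! ### Multiplicativity of spectral projections -/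

namespace SpectralMeasure

variable {H : Type*} [NormedAddCommGroup H] [InnerProductSpace ℂ H] [CompleteSpace H]

theorem proj_union (P : SpectralMeasure H) {s t : Set ℝ} (hs : MeasurableSet s)
    (ht : MeasurableSet t) (hd : Disjoint s t) : P.proj (s ∪ t) = P.proj s + P.proj t := by
  ext x
  let f : ℕ → Set ℝ := fun n => if n = 0 then s else if n = 1 then t else ∅
  have hf : ∀ n, MeasurableSet (f n) := fun n => by
    simp only [f]; split_ifs <;> simp [hs, ht]
  have hp : Pairwise fun i j => Disjoint (f i) (f j) := fun i j hij => by
    simp only [f]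
    split_ifs <;> first | omega | exact hd | exact hd.symm | simp
  have hU : (⋃ n, f n) = s ∪ t := by
    ext l
    simp only [Set.mem_iUnion, Set.mem_union, f]
    constructor
    · rintro ⟨n, hn⟩
      split_ifs at hn
      exacts [Or.inl hn, Or.inr hn, hn.elim]
    · rintro (h | h)
      exacts [⟨0, by simpa using h⟩, ⟨1, by simpa using h⟩]
  have h := P.hasSum_iUnion f hf hp x
  rw [hU] at h
  have h2 : HasSum (fun n => P.proj (f n) x) (∑ n ∈ {0, 1}, P.proj (f n) x) :=
    hasSum_sum_of_ne_finset_zero fun n hn => by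
      simp only [Finset.mem_insert, Finset.mem_singleton, not_or] at hn
      simp [f, hn.1, hn.2, P.proj_empty]
  rw [h.unique h2]
  simp [f]

theorem proj_mul_self (P : SpectralMeasure H) {s : Set ℝ} (hs : MeasurableSet s) :
    P.proj s * P.proj s = P.proj s := (P.isStarProjection s hs).isIdempotentElem

/-- If `a`, `b` and `a + b` are idempotent, then `a b + b a = 0`. Multiplying by `a` on the left and
on the right gives `a b = -a b a = b a`, whence `2 a b = 0`. -/
theorem proj_mul_of_disjoint (P : SpectralMeasure H) {s t : Set ℝ} (hs : MeasurableSet s)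
    (ht : MeasurableSet t) (hd : Disjoint s t) : P.proj s * P.proj t = 0 := by
  have h := P.proj_mul_self (hs.union ht)
  have h1 := P.proj_mul_self hs
  have h2 := P.proj_mul_self ht
  rw [P.proj_union hs ht hd] at h
  set a := P.proj s
  set b := P.proj t
  have h3 : a * b + b * a = 0 := by
    have : (a + b) * (a + b) = a * a + b * b + (a * b + b * a) := by noncomm_ring
    rw [h, h1, h2] at this
    simpa using this
  have h4 : a * b + a * b * a = 0 := by
    calc a * b + a * b * a = (a * a) * b + a * b * a := by rw [h1]
      _ = a * (a * b + b * a) := by noncomm_ring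
      _ = 0 := by rw [h3, mul_zero]
  have h5 : a * b * a + b * a = 0 := by
    calc a * b * a + b * a = a * b * a + b * (a * a) := by rw [h1]
      _ = (a * b + b * a) * a := by noncomm_ring
      _ = 0 := by rw [h3, zero_mul]
  have h6 : a * b = b * a := by
    rw [eq_neg_of_add_eq_zero_left h4, eq_neg_of_add_eq_zero_right h5]
  rw [← h6, ← two_smul ℂ] at h3
  exact (smul_eq_zero.1 h3).resolve_left two_ne_zero

theorem proj_mul (P : SpectralMeasure H) {s t : Set ℝ} (hs : MeasurableSet s)
    (ht : MeasurableSet t) : P.proj s * P.proj t = P.proj (s ∩ t) := by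
  have h1 : P.proj s = P.proj (s ∩ t) + P.proj (s \ t) := by
    rw [← P.proj_union (hs.inter ht) (hs.diff ht) Set.disjoint_sdiff_inter.symm,
      Set.inter_union_sdiff]
  have h2 : P.proj t = P.proj (s ∩ t) + P.proj (t \ s) := by
    rw [← P.proj_union (hs.inter ht) (ht.diff hs) (by
      rw [Set.inter_comm]; exact Set.disjoint_sdiff_inter.symm), Set.inter_comm,
      Set.inter_union_sdiff]
  rw [h1, h2, add_mul, mul_add, mul_add, P.proj_mul_self (hs.inter ht),
    P.proj_mul_of_disjoint (hs.inter ht) (ht.diff hs), P.proj_mul_of_disjoint (hs.diff ht)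
    (hs.inter ht), P.proj_mul_of_disjoint (hs.diff ht) (ht.diff hs)]
  · simp
  · exact disjoint_sdiff_sdiff
  · exact Set.disjoint_sdiff_inter.mono_right (by intro; simp +contextual)
  · exact Set.disjoint_left.2 fun l h h' => h'.2 h.1

instance (P : SpectralMeasure H) (x : H) : IsFiniteMeasure (P.scalarMeasure x) :=
  ⟨by rw [P.scalarMeasure_apply x MeasurableSet.univ]; exact ENNReal.ofReal_lt_top⟩

theorem real_scalarMeasure (P : SpectralMeasure H) (x : H) {s : Set ℝ} (hs : MeasurableSet s) :
    (P.scalarMeasure x).real s = ‖P.proj s x‖ ^ 2 := by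
  rw [measureReal_def, P.scalarMeasure_apply x hs, ENNReal.toReal_ofReal (by positivity)]

theorem inner_proj_proj (P : SpectralMeasure H) {s t : Set ℝ} (hs : MeasurableSet s)
    (ht : MeasurableSet t) (x : H) :
    ⟪P.proj s x, P.proj t x⟫ = (((P.scalarMeasure x).real (s ∩ t) : ℝ) : ℂ) := by
  have h1 : ∀ {s}, MeasurableSet s → ∀ y z, ⟪P.proj s y, z⟫ = ⟪y, P.proj s z⟫ := by
    intro s hs y z
    rw [← ContinuousLinearMap.adjoint_inner_right]
    exact congrArg (fun T : H →L[ℂ] H => ⟪y, T z⟫) (P.isStarProjection s hs).isSelfAdjoint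
  rw [h1 hs, ← mul_apply_eq_comp, P.proj_mul hs ht, P.real_scalarMeasure x (hs.inter ht),
    ← P.proj_mul_self (hs.inter ht), mul_apply_eq_comp, ← h1 (hs.inter ht),
    inner_self_eq_norm_sq_to_K, ← mul_apply_eq_comp, P.proj_mul_self (hs.inter ht)]
  push_cast
  rfl

end SpectralMeasure

/-! ### The calculus of simple functions -/

/-- The linear combination of indicator functions with coefficients `a`. -/
noncomputable def Finsupp.sumIndicator : ({s : Set ℝ // MeasurableSet s} →₀ ℂ) →ₗ[ℂ] (ℝ → ℂ) :=
  Finsupp.linearCombination ℂ fun s : {s : Set ℝ // MeasurableSet s} =>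
    (s : Set ℝ).indicator (1 : ℝ → ℂ)

theorem Finsupp.sumIndicator_single (s : {s : Set ℝ // MeasurableSet s}) (c : ℂ) :
    Finsupp.sumIndicator (Finsupp.single s c) = c • (s : Set ℝ).indicator (1 : ℝ → ℂ) :=
  Finsupp.linearCombination_single ℂ c s

theorem Finsupp.memLp_sumIndicator (a : {s : Set ℝ // MeasurableSet s} →₀ ℂ) (ν : Measure ℝ)
    [IsFiniteMeasure ν] : MemLp (Finsupp.sumIndicator a) 2 ν := by
  induction a using Finsupp.induction_linear with
  | zero => rw [map_zero]; exact MemLp.zero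
  | add f g hf hg => rw [map_add]; exact hf.add hg
  | single s c =>
    rw [Finsupp.sumIndicator_single]
    have h : MemLp ((s : Set ℝ).indicator (1 : ℝ → ℂ)) 2 ν :=
      MemLp.indicator s.2 (memLp_const (1 : ℂ))
    exact h.const_smul c

theorem Finsupp.exists_sumIndicator_eq (g : SimpleFunc ℝ ℂ) :
    ∃ a, Finsupp.sumIndicator a = g := by
  refine SimpleFunc.induction (motive := fun g => ∃ a, Finsupp.sumIndicator a = g) ?_ ?_ g
  · intro c s hs
    refine ⟨Finsupp.single ⟨s, hs⟩ c, ?_⟩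
    rw [Finsupp.sumIndicator_single]
    ext l
    by_cases h : l ∈ s <;> simp [h]
  · rintro f g - ⟨a, ha⟩ ⟨b, hb⟩
    exact ⟨a + b, by rw [map_add, ha, hb]; rfl⟩

namespace SpectralMeasure

variable {H : Type*} [NormedAddCommGroup H] [InnerProductSpace ℂ H] [CompleteSpace H]

/-- The linear combination of spectral projections with coefficients `a`. -/
noncomputable def sumProj (P : SpectralMeasure H) :
    ({s : Set ℝ // MeasurableSet s} →₀ ℂ) →ₗ[ℂ] (H →L[ℂ] H) :=
  Finsupp.linearCombination ℂ fun s : {s : Set ℝ // MeasurableSet s} => P.proj s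

theorem sumProj_single (P : SpectralMeasure H) (s : {s : Set ℝ // MeasurableSet s}) (c : ℂ) :
    P.sumProj (Finsupp.single s c) = c • P.proj s :=
  Finsupp.linearCombination_single ℂ c s

theorem inner_sumProj (P : SpectralMeasure H) (a b : {s : Set ℝ // MeasurableSet s} →₀ ℂ) (x : H) :
    ⟪P.sumProj a x, P.sumProj b x⟫ =
      ∫ l, conj (Finsupp.sumIndicator a l) * Finsupp.sumIndicator b l ∂(P.scalarMeasure x) := by
  have hI : ∀ a b : {s : Set ℝ // MeasurableSet s} →₀ ℂ, Integrable (fun l =>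
      conj (Finsupp.sumIndicator a l) * Finsupp.sumIndicator b l) (P.scalarMeasure x) :=
    fun a b => (Finsupp.memLp_sumIndicator a _).star.integrable_mul (Finsupp.memLp_sumIndicator b _)
  induction a using Finsupp.induction_linear with
  | zero => simp
  | add f g hf hg =>
    simp only [map_add, Pi.add_apply, add_mul, add_apply, inner_add_left, hf, hg]
    rw [integral_add (hI f b) (hI g b)]
  | single s c =>
    induction b using Finsupp.induction_linear with
    | zero => simp
    | add f g hf hg =>
      simp only [map_add, Pi.add_apply, mul_add, add_apply, inner_add_right, hf, hg]
      rw [integral_add (hI _ f) (hI _ g)]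
    | single t d =>
      simp only [Finsupp.sumIndicator_single, sumProj_single, smul_apply, inner_smul_left,
        inner_smul_right, P.inner_proj_proj s.2 t.2, Pi.smul_apply, smul_eq_mul, map_mul]
      have : ∀ l, conj c * conj ((s : Set ℝ).indicator (1 : ℝ → ℂ) l) *
          (d * (t : Set ℝ).indicator (1 : ℝ → ℂ) l) =
          conj c * (d * ((((s : Set ℝ) ∩ t).indicator (1 : ℝ → ℝ) l : ℝ) : ℂ)) := fun l => by
        by_cases h1 : l ∈ (s : Set ℝ) <;> by_cases h2 : l ∈ (t : Set ℝ) <;> simp [h1, h2]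
      simp_rw [this]
      rw [integral_const_mul, integral_const_mul, integral_complex_ofReal,
        integral_indicator_one (s.2.inter t.2)]
      ring

/-- Integration of finite linear combinations of indicator functions of Borel sets, extended to
square integrable functions. -/
noncomputable def calculus (P : SpectralMeasure H) :
    L2Calculus H ℝ ({s : Set ℝ // MeasurableSet s} →₀ ℂ) where
  ev := Finsupp.sumIndicator
  op := P.sumProj
  meas := P.scalarMeasure
  finite x := inferInstance
  memLp_ev a ν _ := Finsupp.memLp_sumIndicator a ν
  inner_op := P.inner_sumProj
  dense_ev ν _ f hf ε hε := by
    obtain ⟨g, hg, -⟩ := hf.exists_simpleFunc_eLpNorm_sub_lt (by simp) hε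
    obtain ⟨a, ha⟩ := Finsupp.exists_sumIndicator_eq g
    exact ⟨a, by rw [ha]; exact hg.le⟩
  unit := Finsupp.single ⟨Set.univ, MeasurableSet.univ⟩ 1
  ev_unit := by rw [Finsupp.sumIndicator_single]; simp
  op_unit := by rw [sumProj_single]; simp [P.proj_univ]

theorem vec_indicator (P : SpectralMeasure H) {s : Set ℝ} (hs : MeasurableSet s) (x : H) :
    P.calculus.vec (s.indicator 1) x = P.proj s x := by
  have h := P.calculus.vec_ev (Finsupp.single ⟨s, hs⟩ 1) x
  change P.calculus.vec (Finsupp.sumIndicator _) x = P.sumProj _ x at h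
  rwa [Finsupp.sumIndicator_single, sumProj_single, one_smul, one_smul] at h

end SpectralMeasure

theorem L2Calculus.tendsto_vec_of_eLpNorm {H : Type*} [NormedAddCommGroup H]
    [InnerProductSpace ℂ H] [CompleteSpace H] {X : Type*} [MeasurableSpace X] {A : Type*}
    [AddCommGroup A] [Module ℂ A] (C : L2Calculus H X A) {x : H} {F : ℕ → X → ℂ} {f : X → ℂ}
    (hF : ∀ n, MemLp (F n) 2 (C.meas x)) (hf : MemLp f 2 (C.meas x))
    (h : Tendsto (fun n => eLpNorm (F n - f) 2 (C.meas x)) atTop (𝓝 0)) :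
    Tendsto (fun n => C.vec (F n) x) atTop (𝓝 (C.vec f x)) := by
  rw [C.vec_of_memLp hf]
  have h := (Lp.tendsto_Lp_iff_tendsto_eLpNorm'' F hF f hf).2 h
  refine (((C.ext x).continuous.tendsto _).comp h).congr fun n => ?_
  exact (C.vec_of_memLp (hF n)).symm

theorem MeasureTheory.eLpNorm_two_withDensity {X : Type*} [MeasurableSpace X] {ν : Measure X}
    {f g : X → ℂ} (hf : Measurable f) (hg : Measurable g) :
    eLpNorm g 2 (ν.withDensity fun l => ‖f l‖ₑ ^ 2) = eLpNorm (g * f) 2 ν := by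
  rw [eLpNorm_eq_lintegral_rpow_enorm_toReal (by simp) (by simp),
    eLpNorm_eq_lintegral_rpow_enorm_toReal (by simp) (by simp)]
  simp only [ENNReal.toReal_ofNat, ENNReal.rpow_ofNat]
  rw [lintegral_withDensity_eq_lintegral_mul _ (hf.enorm.pow_const 2) (hg.enorm.pow_const 2)]
  congr 1
  refine lintegral_congr fun l => ?_
  simp only [Pi.mul_apply, enorm_mul, mul_pow, mul_comm]

theorem Finsupp.measurable_sumIndicator (a : {s : Set ℝ // MeasurableSet s} →₀ ℂ) :
    Measurable (Finsupp.sumIndicator a) := by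
  induction a using Finsupp.induction_linear with
  | zero => rw [map_zero]; exact measurable_zero
  | add f g hf hg => rw [map_add]; exact hf.add hg
  | single s c =>
    rw [Finsupp.sumIndicator_single]
    exact (measurable_one.indicator s.2).const_smul c

/-! ### Unbounded integrals against a spectral measure -/

namespace SpectralMeasure

variable {H : Type*} [NormedAddCommGroup H] [InnerProductSpace ℂ H] [CompleteSpace H]

/-- From `‖a + b‖² ≤ 2‖a‖² + 2‖b‖²`. It makes the square integrability condition define a linear
domain. -/
theorem scalarMeasure_add_le (P : SpectralMeasure H) (x y : H) :
    P.scalarMeasure (x + y) ≤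
      (2 : ℝ≥0∞) • P.scalarMeasure x + (2 : ℝ≥0∞) • P.scalarMeasure y := by
  refine Measure.le_iff.2 fun s hs => ?_
  simp only [Measure.add_apply, Measure.smul_apply, smul_eq_mul, P.scalarMeasure_apply _ hs]
  have h2 : (2 : ℝ≥0∞) = ENNReal.ofReal 2 := by simp
  rw [h2, ← ENNReal.ofReal_mul (by norm_num), ← ENNReal.ofReal_mul (by norm_num),
    ← ENNReal.ofReal_add (by positivity) (by positivity), map_add]
  refine ENNReal.ofReal_le_ofReal ?_
  have := norm_add_le (P.proj s x) (P.proj s y)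
  nlinarith [sq_nonneg (‖P.proj s x‖ - ‖P.proj s y‖), norm_nonneg (P.proj s x + P.proj s y)]

theorem scalarMeasure_smul (P : SpectralMeasure H) (c : ℂ) (x : H) :
    P.scalarMeasure (c • x) = ENNReal.ofReal (‖c‖ ^ 2) • P.scalarMeasure x := by
  ext s hs
  simp only [Measure.smul_apply, smul_eq_mul, P.scalarMeasure_apply _ hs, map_smul, norm_smul,
    mul_pow]
  rw [ENNReal.ofReal_mul (by positivity)]

theorem memLp_add (P : SpectralMeasure H) {f : ℝ → ℂ} {x y : H}
    (hx : MemLp f 2 (P.scalarMeasure x)) (hy : MemLp f 2 (P.scalarMeasure y)) :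
    MemLp f 2 (P.scalarMeasure (x + y)) :=
  ((hx.smul_measure (by simp)).two_add_measure (hy.smul_measure (by simp))).mono_measure
    (P.scalarMeasure_add_le x y)

theorem memLp_smul (P : SpectralMeasure H) {f : ℝ → ℂ} {x : H} (c : ℂ)
    (hx : MemLp f 2 (P.scalarMeasure x)) : MemLp f 2 (P.scalarMeasure (c • x)) := by
  rw [P.scalarMeasure_smul]; exact hx.smul_measure (by simp)

/-- The vector `(∫ f dP) x`. -/
noncomputable def vec (P : SpectralMeasure H) (f : ℝ → ℂ) (x : H) : H := P.calculus.vec f x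

/-- The unbounded operator `∫ f dP`. -/
noncomputable def integral (P : SpectralMeasure H) (f : ℝ → ℂ) : H →ₗ.[ℂ] H where
  domain :=
    { carrier := {x | MemLp f 2 (P.scalarMeasure x)}
      add_mem' := fun hx hy => P.memLp_add hx hy
      zero_mem' := by
        have := P.scalarMeasure_smul 0 0
        simp only [smul_zero, norm_zero, ne_eq, OfNat.ofNat_ne_zero, not_false_eq_true, zero_pow,
          ENNReal.ofReal_zero, zero_smul] at this
        change MemLp f 2 _
        rw [this]
        exact ⟨aestronglyMeasurable_zero_measure _, by simp⟩
      smul_mem' := fun c x hx => P.memLp_smul c hx }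
  toFun :=
    { toFun := fun x => P.vec f x
      map_add' := fun x y => P.calculus.vec_add x.2 y.2 (P.memLp_add x.2 y.2)
      map_smul' := fun c x => P.calculus.vec_smul c x.2 (P.memLp_smul c x.2) }

theorem integral_apply (P : SpectralMeasure H) {f : ℝ → ℂ} (x : (P.integral f).domain) :
    P.integral f x = P.vec f x := rfl

theorem inner_self_vec (P : SpectralMeasure H) {f : ℝ → ℂ} {x : H}
    (hf : MemLp f 2 (P.scalarMeasure x)) : ⟪x, P.vec f x⟫ = ∫ l, f l ∂(P.scalarMeasure x) :=
  P.calculus.inner_self_vec hf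

theorem norm_sq_vec (P : SpectralMeasure H) {f : ℝ → ℂ} {x : H}
    (hf : MemLp f 2 (P.scalarMeasure x)) :
    ‖P.vec f x‖ ^ 2 = ∫ l, ‖f l‖ ^ 2 ∂(P.scalarMeasure x) := P.calculus.norm_sq_vec hf

theorem vec_one (P : SpectralMeasure H) (x : H) : P.vec 1 x = x := P.calculus.vec_one x

theorem vec_congr (P : SpectralMeasure H) {f g : ℝ → ℂ} {x : H}
    (h : f =ᵐ[P.scalarMeasure x] g) : P.vec f x = P.vec g x := P.calculus.vec_congr h

theorem vec_add_fun (P : SpectralMeasure H) {f g : ℝ → ℂ} {x : H}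
    (hf : MemLp f 2 (P.scalarMeasure x)) (hg : MemLp g 2 (P.scalarMeasure x)) :
    P.vec (f + g) x = P.vec f x + P.vec g x := P.calculus.vec_add_fun hf hg

theorem vec_smul_fun (P : SpectralMeasure H) (c : ℂ) {f : ℝ → ℂ} {x : H}
    (hf : MemLp f 2 (P.scalarMeasure x)) : P.vec (c • f) x = c • P.vec f x :=
  P.calculus.vec_smul_fun c hf

theorem scalarMeasure_univ (P : SpectralMeasure H) (x : H) :
    (P.scalarMeasure x).real Set.univ = ‖x‖ ^ 2 := P.calculus.meas_univ x

theorem isIntegral_integral (P : SpectralMeasure H) {f : ℝ → ℂ} (hf : Measurable f) :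
    P.IsIntegral f (P.integral f) where
  mem_domain_iff _ := memLp_two_iff_lintegral hf.aestronglyMeasurable
  inner_apply x := P.inner_self_vec x.2

theorem proj_sumProj (P : SpectralMeasure H) {s : Set ℝ} (hs : MeasurableSet s)
    (a : {s : Set ℝ // MeasurableSet s} →₀ ℂ) (x : H) :
    P.proj s (P.sumProj a x) = P.vec (s.indicator (Finsupp.sumIndicator a)) x := by
  have hm : ∀ a : {s : Set ℝ // MeasurableSet s} →₀ ℂ,
      MemLp (s.indicator (Finsupp.sumIndicator a)) 2 (P.scalarMeasure x) :=
    fun a => (Finsupp.memLp_sumIndicator a _).indicator hs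
  induction a using Finsupp.induction_linear with
  | zero =>
    have h := P.vec_smul_fun 0 (hm 0)
    rw [zero_smul, zero_smul] at h
    rw [map_zero, map_zero, Set.indicator_zero', h]
    simp
  | add f g hf hg =>
    rw [map_add, map_add, add_apply, map_add, hf, hg, ← P.vec_add_fun (hm f) (hm g),
      Set.indicator_add']
  | single t c =>
    rw [sumProj_single, Finsupp.sumIndicator_single, smul_apply, map_smul, ← mul_apply_eq_comp,
      P.proj_mul hs t.2, ← P.vec_indicator (hs.inter t.2)]
    have h : s.indicator (c • (t : Set ℝ).indicator (1 : ℝ → ℂ)) = c • (s ∩ t).indicator 1 := by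
      ext l
      by_cases h1 : l ∈ s <;> by_cases h2 : l ∈ (t : Set ℝ) <;> simp [h1, h2]
    rw [h]
    exact (P.vec_smul_fun c ((memLp_const (1 : ℂ)).indicator (hs.inter t.2))).symm

theorem proj_vec (P : SpectralMeasure H) {s : Set ℝ} (hs : MeasurableSet s) {f : ℝ → ℂ} {x : H}
    (hf : MemLp f 2 (P.scalarMeasure x)) : P.proj s (P.vec f x) = P.vec (s.indicator f) x := by
  obtain ⟨a, ha⟩ := P.calculus.exists_seq (P.scalarMeasure x) hf
  have h1 := ((P.proj s).continuous.tendsto _).comp (P.calculus.tendsto_vec hf ha)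
  refine tendsto_nhds_unique h1 ?_
  have h2 : ∀ n, P.proj s (P.calculus.op (a n) x) =
      P.vec (s.indicator (P.calculus.ev (a n))) x := fun n => P.proj_sumProj hs (a n) x
  simp only [Function.comp_def, h2]
  refine P.calculus.tendsto_vec_of_eLpNorm
    (fun n => (P.calculus.memLp_ev (a n) _).indicator hs) (hf.indicator hs) ?_
  refine tendsto_of_tendsto_of_tendsto_of_le_of_le tendsto_const_nhds ha (fun _ => zero_le)
    fun n => ?_
  simp only
  rw [← Set.indicator_sub']
  exact eLpNorm_indicator_le _

/-- Applying `P(s)` multiplies the integrand by the indicator of `s`, so the mass of `s` is `∫_s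
‖f‖²`. Domain questions for iterated integrals thereby become integrability of products. -/
theorem scalarMeasure_vec (P : SpectralMeasure H) {f : ℝ → ℂ} {x : H}
    (hf : MemLp f 2 (P.scalarMeasure x)) :
    P.scalarMeasure (P.vec f x) = (P.scalarMeasure x).withDensity fun l => ‖f l‖ₑ ^ 2 := by
  ext s hs
  rw [P.scalarMeasure_apply _ hs, P.proj_vec hs hf, P.norm_sq_vec (hf.indicator hs),
    withDensity_apply _ hs, ofReal_integral_eq_lintegral_ofReal]
  · rw [← lintegral_indicator hs]
    refine lintegral_congr fun l => ?_
    by_cases h : l ∈ s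
    · simp [h, ENNReal.ofReal_pow]
    · simp [h]
  · exact (hf.indicator hs).integrable_norm_pow'
  · exact Eventually.of_forall fun l => by positivity

theorem memLp_vec_iff (P : SpectralMeasure H) {f g : ℝ → ℂ} {x : H} (hfm : Measurable f)
    (hgm : Measurable g) (hf : MemLp f 2 (P.scalarMeasure x)) :
    MemLp g 2 (P.scalarMeasure (P.vec f x)) ↔ MemLp (g * f) 2 (P.scalarMeasure x) := by
  rw [P.scalarMeasure_vec hf, MemLp, MemLp, eLpNorm_two_withDensity hfm hgm]
  simp [hgm.aestronglyMeasurable, (hgm.mul hfm).aestronglyMeasurable]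

theorem sumProj_vec (P : SpectralMeasure H) (a : {s : Set ℝ // MeasurableSet s} →₀ ℂ)
    {f : ℝ → ℂ} {x : H} (hfm : Measurable f) (hf : MemLp f 2 (P.scalarMeasure x)) :
    P.sumProj a (P.vec f x) = P.vec (Finsupp.sumIndicator a * f) x := by
  have hm : ∀ a, MemLp (Finsupp.sumIndicator a * f) 2 (P.scalarMeasure x) := fun a =>
    (P.memLp_vec_iff hfm (Finsupp.measurable_sumIndicator a) hf).1 (Finsupp.memLp_sumIndicator a _)
  induction a using Finsupp.induction_linear with
  | zero =>
    have h := P.vec_smul_fun 0 (hm 0)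
    rw [zero_smul, zero_smul] at h
    rw [map_zero, map_zero, zero_mul, h]
    simp
  | add a b ha hb =>
    rw [map_add, map_add, add_apply, ha, hb, ← P.vec_add_fun (hm a) (hm b), add_mul]
  | single t c =>
    rw [sumProj_single, Finsupp.sumIndicator_single, smul_apply, P.proj_vec t.2 hf,
      ← P.vec_smul_fun c (hf.indicator t.2)]
    congr 1
    ext l
    by_cases h : l ∈ (t : Set ℝ) <;> simp [h]

/-- Approximate `g` by simple functions in `L²` of the scalar measure of `P.vec f x`. By
`scalarMeasure_vec` that norm is the norm of the product with `f` in `L²` of the scalar measure of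
`x`, so both sides converge along the same sequence. -/
theorem vec_vec (P : SpectralMeasure H) {f g : ℝ → ℂ} {x : H} (hfm : Measurable f)
    (hgm : Measurable g) (hf : MemLp f 2 (P.scalarMeasure x))
    (hgf : MemLp (g * f) 2 (P.scalarMeasure x)) : P.vec g (P.vec f x) = P.vec (g * f) x := by
  have hg := (P.memLp_vec_iff hfm hgm hf).2 hgf
  obtain ⟨a, ha⟩ := P.calculus.exists_seq (P.scalarMeasure (P.vec f x)) hg
  have h1 := P.calculus.tendsto_vec hg ha
  refine tendsto_nhds_unique h1 ?_
  have h2 : ∀ n, P.calculus.op (a n) (P.vec f x) =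
      P.vec (P.calculus.ev (a n) * f) x := fun n => P.sumProj_vec (a n) hfm hf
  simp only [h2]
  refine P.calculus.tendsto_vec_of_eLpNorm (fun n => ?_) hgf ?_
  · exact (P.memLp_vec_iff hfm (Finsupp.measurable_sumIndicator (a n)) hf).1
      (Finsupp.memLp_sumIndicator (a n) _)
  · refine ha.congr fun n => ?_
    change eLpNorm (Finsupp.sumIndicator (a n) - g) 2 _ =
      eLpNorm (Finsupp.sumIndicator (a n) * f - g * f) 2 (P.scalarMeasure x)
    rw [P.scalarMeasure_vec hf, eLpNorm_two_withDensity hfm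
      ((Finsupp.measurable_sumIndicator (a n)).sub hgm), sub_mul]

theorem inner_sumProj_left (P : SpectralMeasure H) (a : {s : Set ℝ // MeasurableSet s} →₀ ℂ)
    (x y : H) :
    ⟪P.sumProj a x, y⟫ = ⟪x, P.vec (fun l => conj (Finsupp.sumIndicator a l)) y⟫ := by
  have hm : ∀ a : {s : Set ℝ // MeasurableSet s} →₀ ℂ,
      MemLp (fun l => conj (Finsupp.sumIndicator a l)) 2 (P.scalarMeasure y) := fun a =>
    (Finsupp.memLp_sumIndicator a _).star
  induction a using Finsupp.induction_linear with
  | zero =>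
    have h := P.vec_smul_fun 0 (hm 0)
    rw [zero_smul, zero_smul] at h
    have h0 : (fun l => conj (Finsupp.sumIndicator 0 l)) = (0 : ℝ → ℂ) := by ext; simp
    rw [h0, h]
    simp
  | add a b ha hb =>
    rw [map_add, add_apply, inner_add_left, ha, hb, ← inner_add_right,
      ← P.vec_add_fun (hm a) (hm b)]
    congr 2
    ext l
    simp
  | single t c =>
    have h : (fun l => conj (Finsupp.sumIndicator (Finsupp.single t c) l)) =
        conj c • (t : Set ℝ).indicator (1 : ℝ → ℂ) := by
      ext l
      rw [Finsupp.sumIndicator_single]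
      by_cases h : l ∈ (t : Set ℝ) <;> simp [h]
    have hL : MemLp ((t : Set ℝ).indicator (1 : ℝ → ℂ)) 2 (P.scalarMeasure y) :=
      MemLp.indicator t.2 (memLp_const (1 : ℂ))
    rw [h, P.vec_smul_fun _ hL, sumProj_single, smul_apply,
      inner_smul_left, inner_smul_right]
    congr 1
    change _ = ⟪x, P.calculus.vec _ y⟫
    rw [P.vec_indicator t.2, ← ContinuousLinearMap.adjoint_inner_right]
    exact congrArg (fun T : H →L[ℂ] H => ⟪x, T y⟫) (P.isStarProjection t t.2).isSelfAdjoint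

theorem inner_vec_left (P : SpectralMeasure H) {f : ℝ → ℂ} {x y : H}
    (hx : MemLp f 2 (P.scalarMeasure x)) (hy : MemLp f 2 (P.scalarMeasure y)) :
    ⟪P.vec f x, y⟫ = ⟪x, P.vec (fun l => conj (f l)) y⟫ := by
  obtain ⟨a, ha⟩ := P.calculus.exists_seq (P.scalarMeasure x + P.scalarMeasure y)
    (hx.two_add_measure hy)
  have h1 := P.calculus.tendsto_vec hx
    (L2Calculus.tendsto_eLpNorm_mono (Measure.le_add_right le_rfl) ha)
  have h2 := L2Calculus.tendsto_eLpNorm_mono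
    (ν := P.scalarMeasure y) (Measure.le_add_left le_rfl) ha
  have h3 : Tendsto (fun n => P.vec (fun l => conj (Finsupp.sumIndicator (a n) l)) y) atTop
      (𝓝 (P.vec (fun l => conj (f l)) y)) := by
    refine P.calculus.tendsto_vec_of_eLpNorm
      (fun n => (Finsupp.memLp_sumIndicator (a n) _).star) hy.star (h2.congr fun n => ?_)
    refine eLpNorm_congr_norm_ae (Eventually.of_forall fun l => ?_)
    simp only [Pi.sub_apply]
    rw [← RCLike.norm_conj, map_sub]
    rfl
  refine tendsto_nhds_unique (h1.inner tendsto_const_nhds)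
    ((tendsto_const_nhds.inner h3).congr fun n => ?_)
  exact (P.inner_sumProj_left (a n) x y).symm

end SpectralMeasure

/-- Bounded measurable functions on the line. -/
structure BddMeas (f : ℝ → ℂ) : Prop where
  measurable : Measurable f
  bounded : ∃ M : ℝ, ∀ l, ‖f l‖ ≤ M

namespace BddMeas

theorem memLp {f : ℝ → ℂ} (hf : BddMeas f) (ν : Measure ℝ) [IsFiniteMeasure ν] : MemLp f 2 ν := by
  obtain ⟨M, hM⟩ := hf.bounded
  exact L2Calculus.memLp_of_bounded hf.measurable hM

theorem integrable {f : ℝ → ℂ} (hf : BddMeas f) (ν : Measure ℝ) [IsFiniteMeasure ν] :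
    Integrable f ν := (hf.memLp ν).integrable (by simp)

theorem mul {f g : ℝ → ℂ} (hf : BddMeas f) (hg : BddMeas g) : BddMeas (f * g) := by
  obtain ⟨M, hM⟩ := hf.bounded
  obtain ⟨M', hM'⟩ := hg.bounded
  refine ⟨hf.measurable.mul hg.measurable, M * M', fun l => ?_⟩
  rw [Pi.mul_apply, norm_mul]
  exact mul_le_mul (hM l) (hM' l) (norm_nonneg _) ((norm_nonneg _).trans (hM l))

theorem conjugate {f : ℝ → ℂ} (hf : BddMeas f) : BddMeas fun l => conj (f l) := by
  obtain ⟨M, hM⟩ := hf.bounded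
  exact ⟨Complex.continuous_conj.measurable.comp hf.measurable, M, fun l => by
    rw [RCLike.norm_conj]; exact hM l⟩

theorem const (c : ℂ) : BddMeas fun _ => c := ⟨measurable_const, ‖c‖, fun _ => le_rfl⟩

theorem indicator {f : ℝ → ℂ} (hf : BddMeas f) {s : Set ℝ} (hs : MeasurableSet s) :
    BddMeas (s.indicator f) := by
  obtain ⟨M, hM⟩ := hf.bounded
  exact ⟨hf.measurable.indicator hs, M, fun l => (norm_indicator_le_norm_self f l).trans (hM l)⟩

theorem one : BddMeas (1 : ℝ → ℂ) := const 1

end BddMeas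

/-! ### Density, uniqueness and selfadjointness of integrals -/

namespace SpectralMeasure

variable {H : Type*} [NormedAddCommGroup H] [InnerProductSpace ℂ H] [CompleteSpace H]

/-- The bounded operator `∫ f dP` for a bounded measurable function `f`. -/
noncomputable def bop (P : SpectralMeasure H) (f : ℝ → ℂ) : H →L[ℂ] H := P.calculus.bop f

theorem bop_apply (P : SpectralMeasure H) {f : ℝ → ℂ} (hf : BddMeas f) (x : H) :
    P.bop f x = P.vec f x := by
  obtain ⟨M, hM⟩ := hf.bounded
  exact P.calculus.bop_apply hf.measurable hM x

theorem inner_self_bop (P : SpectralMeasure H) {f : ℝ → ℂ} (hf : BddMeas f) (x : H) :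
    ⟪x, P.bop f x⟫ = ∫ l, f l ∂(P.scalarMeasure x) := by
  rw [P.bop_apply hf, P.inner_self_vec (hf.memLp _)]

theorem eq_bop (P : SpectralMeasure H) {f : ℝ → ℂ} (hf : BddMeas f) {T : H →L[ℂ] H}
    (h : ∀ x, ⟪x, T x⟫ = ∫ l, f l ∂(P.scalarMeasure x)) : T = P.bop f :=
  ContinuousLinearMap.ext_of_inner_self fun x => by rw [h, P.inner_self_bop hf]

theorem bop_mul (P : SpectralMeasure H) {f g : ℝ → ℂ} (hf : BddMeas f) (hg : BddMeas g) :
    P.bop f * P.bop g = P.bop (f * g) := by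
  ext x
  rw [mul_apply_eq_comp, P.bop_apply hf, P.bop_apply hg, P.bop_apply (hf.mul hg),
    P.vec_vec hg.measurable hf.measurable (hg.memLp _) ((hf.mul hg).memLp _)]

theorem inner_bop_left (P : SpectralMeasure H) {f : ℝ → ℂ} (hf : BddMeas f) (x y : H) :
    ⟪P.bop f x, y⟫ = ⟪x, P.bop (fun l => conj (f l)) y⟫ := by
  rw [P.bop_apply hf, P.bop_apply hf.conjugate, P.inner_vec_left (hf.memLp _) (hf.memLp _)]

theorem bop_one (P : SpectralMeasure H) : P.bop 1 = 1 := by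
  ext x; rw [P.bop_apply BddMeas.one, P.vec_one]; rfl

theorem bop_indicator (P : SpectralMeasure H) {s : Set ℝ} (hs : MeasurableSet s) :
    P.bop (s.indicator 1) = P.proj s := by
  ext x; rw [P.bop_apply (BddMeas.one.indicator hs)]; exact P.vec_indicator hs x

theorem ae_notMem (P : SpectralMeasure H) {s : Set ℝ} (hs : MeasurableSet s) (h : P.proj s = 0)
    (x : H) : ∀ᵐ l ∂(P.scalarMeasure x), l ∉ s := by
  rw [ae_iff]
  simp only [not_not, Set.ofPred_mem_eq]
  rw [P.scalarMeasure_apply x hs, h]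
  simp

theorem ae_pos (P : SpectralMeasure H) (h : P.proj (Set.Iic 0) = 0) (x : H) :
    ∀ᵐ l ∂(P.scalarMeasure x), 0 < l := by
  filter_upwards [P.ae_notMem measurableSet_Iic h x] with l hl
  simpa using hl

theorem eq_zero_of_scalarMeasure (P : SpectralMeasure H) {x : H} (h : P.scalarMeasure x = 0) :
    x = 0 := by
  have := P.scalarMeasure_univ x
  rw [h] at this
  simpa using this.symm

theorem vec_eq_zero_iff (P : SpectralMeasure H) {f : ℝ → ℂ} {x : H}
    (hf : MemLp f 2 (P.scalarMeasure x)) :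
    P.vec f x = 0 ↔ ∀ᵐ l ∂(P.scalarMeasure x), f l = 0 := by
  have h := P.norm_sq_vec hf
  have hi : Integrable (fun l => ‖f l‖ ^ 2) (P.scalarMeasure x) := hf.integrable_norm_pow'
  have h2 := integral_eq_zero_iff_of_nonneg (fun l => sq_nonneg ‖f l‖) hi
  rw [← h] at h2
  simp only [ne_eq, OfNat.ofNat_ne_zero, not_false_eq_true, pow_eq_zero_iff, norm_eq_zero] at h2
  rw [h2]
  refine eventually_congr (Eventually.of_forall fun l => ?_)
  simp

theorem tendsto_vec_truncate (P : SpectralMeasure H) (f : ℝ → ℂ) (hf : Measurable f) (x : H) :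
    Tendsto (fun n : ℕ => P.vec ({l | ‖f l‖ ≤ n}.indicator 1) x) atTop (𝓝 x) := by
  have hs : ∀ n : ℕ, MeasurableSet {l | ‖f l‖ ≤ n} := fun n =>
    measurableSet_le hf.norm measurable_const
  conv => enter [3, 1]; rw [← P.vec_one x]
  refine P.calculus.tendsto_vec_of_dominated (fun _ => 1) (fun n => ?_) ?_ (memLp_const 1)
    (fun n => Eventually.of_forall fun l => ?_) (Eventually.of_forall fun l => by simp)
    (Eventually.of_forall fun l => ?_)
  · exact (measurable_one.indicator (hs n)).aestronglyMeasurable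
  · exact aestronglyMeasurable_one
  · exact (norm_indicator_le_norm_self _ _).trans (by simp)
  · refine tendsto_nhds_of_eventually_eq ?_
    obtain ⟨N, hN⟩ := exists_nat_ge ‖f l‖
    filter_upwards [eventually_ge_atTop N] with n hn
    rw [Set.indicator_of_mem]
    exact hN.trans (by exact_mod_cast hn)

/-- Cutting `x` off to the set where `‖f‖ ≤ n` lands in the domain, and the cutoffs converge to `x`.
-/
theorem dense_domain_integral (P : SpectralMeasure H) {f : ℝ → ℂ} (hf : Measurable f) :
    Dense ((P.integral f).domain : Set H) := by
  intro x
  refine mem_closure_of_tendsto (P.tendsto_vec_truncate f hf x)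
    (Eventually.of_forall fun n => ?_)
  have hs : MeasurableSet {l | ‖f l‖ ≤ n} := measurableSet_le hf.norm measurable_const
  have hb := BddMeas.one.indicator hs
  change MemLp f 2 _
  rw [P.memLp_vec_iff hb.measurable hf (hb.memLp _)]
  refine L2Calculus.memLp_of_bounded (hf.mul hb.measurable) (M := n) fun l => ?_
  by_cases h : l ∈ {l | ‖f l‖ ≤ n}
  · rw [Pi.mul_apply, Set.indicator_of_mem h, Pi.one_apply, mul_one]; exact h
  · simp [h]

/-- The operator `∫ f dP` is determined by its domain and quadratic form. -/
theorem IsIntegral.eq_integral {P : SpectralMeasure H} {f : ℝ → ℂ} (hf : Measurable f)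
    {B : H →ₗ.[ℂ] H} (hB : P.IsIntegral f B) : B = P.integral f := by
  have hT := P.isIntegral_integral hf
  have hd : B.domain = (P.integral f).domain := by
    ext x; rw [hB.mem_domain_iff, hT.mem_domain_iff]
  let L : B.domain →ₗ[ℂ] H :=
    B.toFun - (P.integral f).toFun ∘ₗ (LinearEquiv.ofEq _ _ hd).toLinearMap
  have hL : ∀ x, L x = B x - P.integral f ⟨x, hd ▸ x.2⟩ := fun x => rfl
  have h0 : ∀ x : B.domain, ⟪(x : H), L x⟫ = 0 := fun x => by
    rw [hL, inner_sub_right, hB.inner_apply, hT.inner_apply ⟨x, hd ▸ x.2⟩, sub_self]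
  -- Polarization with `x + y` and `x + i y`, valid on a domain that need not be all of `H`.
  have h1 : ∀ x y : B.domain, ⟪(x : H), L y⟫ = 0 := fun x y => by
    have e1 := h0 (x + y)
    have e2 := h0 (x + Complex.I • y)
    simp only [map_add, map_smul, Submodule.coe_add, Submodule.coe_smul, inner_add_left,
      inner_add_right, inner_smul_left, inner_smul_right, h0, Complex.conj_I] at e1 e2
    have e3 : Complex.I * (⟪(x : H), L y⟫ - ⟪(y : H), L x⟫) = 0 := by
      linear_combination e2
    have e4 := (mul_eq_zero.1 e3).resolve_left Complex.I_ne_zero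
    linear_combination (e1 + e4) / 2
  refine LinearPMap.ext hd fun x hx hx' => ?_
  have h2 : L ⟨x, hx⟩ = 0 := by
    have hdense : Dense (B.domain : Set H) := hd ▸ P.dense_domain_integral hf
    exact hdense.eq_zero_of_inner_right ℂ fun z hz => h1 ⟨z, hz⟩ ⟨x, hx⟩
  rw [hL] at h2
  exact sub_eq_zero.1 h2

/-- Symmetry gives `A ⊆ A*`. For the reverse inclusion, `(f + i)⁻¹` and its product with `f` are
bounded for real `f`, so the resolvents are everywhere defined with values in the domain, and every
`y` in the domain of `A*` is such a value. -/
theorem isSelfAdjoint_integral (P : SpectralMeasure H) {f : ℝ → ℂ} (hf : Measurable f)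
    (hr : ∀ l, conj (f l) = f l) : IsSelfAdjoint (P.integral f) := by
  have hd := P.dense_domain_integral hf
  have hc : (fun l => conj (f l)) = f := funext hr
  have hsymm : ∀ x y : (P.integral f).domain,
      ⟪P.integral f x, (y : H)⟫ = ⟪(x : H), P.integral f y⟫ := fun x y => by
    rw [P.integral_apply, P.inner_vec_left x.2 y.2, hc]; rfl
  rw [LinearPMap.isSelfAdjoint_def]
  refine (LinearPMap.eq_of_le_of_domain_eq (LinearPMap.IsFormalAdjoint.le_adjoint hd hsymm)
    (le_antisymm ?_ fun y hy => ?_)).symm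
  · exact (LinearPMap.IsFormalAdjoint.le_adjoint hd hsymm).1
  have hne : ∀ l, f l + Complex.I ≠ 0 := fun l h => by
    have h1 := congrArg Complex.im h
    have h2 := congrArg Complex.im (hr l)
    simp only [Complex.add_im, Complex.I_im, Complex.zero_im, Complex.conj_im] at h1 h2
    linarith
  have hn1 : ∀ l, 1 ≤ ‖f l + Complex.I‖ := fun l => by
    have h2 := congrArg Complex.im (hr l)
    simp only [Complex.conj_im] at h2
    have := Complex.abs_im_le_norm (f l + Complex.I)
    have h3 : (f l + Complex.I).im = 1 := by simp; linarith
    rw [h3] at this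
    simpa using this
  set h : ℝ → ℂ := fun l => (f l + Complex.I)⁻¹
  have hb : BddMeas h := ⟨(hf.add_const _).inv, 1, fun l => by
    rw [norm_inv]; exact inv_le_one_of_one_le₀ (hn1 l)⟩
  have hfh : BddMeas (f * h) := ⟨hf.mul hb.measurable, 1 + 1, fun l => by
    have : (f * h) l = 1 - Complex.I * h l := by
      simp only [h, Pi.mul_apply]; field_simp [hne l]; ring
    rw [this]
    refine (norm_sub_le _ _).trans ?_
    rw [norm_one, norm_mul, Complex.norm_I, one_mul, norm_inv]
    gcongr
    exact inv_le_one_of_one_le₀ (hn1 l)⟩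
  set w := LinearPMap.adjoint (P.integral f) ⟨y, hy⟩
  have hw : ∀ x : (P.integral f).domain, ⟪w, (x : H)⟫ = ⟪y, P.integral f x⟫ := fun x =>
    LinearPMap.adjoint_isFormalAdjoint hd ⟨y, hy⟩ x
  have hdom : ∀ u, P.vec h u ∈ (P.integral f).domain := fun u =>
    (P.memLp_vec_iff hb.measurable hf (hb.memLp _)).2 (hfh.memLp _)
  -- This is `y = (A - i)⁻¹ (A* y - i y)`, obtained by testing against `u = (A + i) (A + i)⁻¹ u`.
  have hy2 : y = P.vec (fun l => conj (h l)) (w + conj Complex.I • y) := by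
    refine ext_inner_right ℂ fun u => ?_
    rw [P.inner_vec_left (hb.conjugate.memLp _) (hb.conjugate.memLp _)]
    simp only [Complex.conj_conj]
    change _ = ⟪_, P.vec h u⟫
    rw [inner_add_left, hw ⟨_, hdom u⟩, P.integral_apply, P.vec_vec hb.measurable hf (hb.memLp _)
      (hfh.memLp _), inner_smul_left, Complex.conj_conj, ← inner_smul_right, ← inner_add_right,
      ← P.vec_smul_fun _ (hb.memLp _), ← P.vec_add_fun (hfh.memLp _) ((hb.memLp _).const_smul _)]
    conv_lhs => rw [← P.vec_one u]
    congr 2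
    ext l
    simp only [h, Pi.add_apply, Pi.mul_apply, Pi.smul_apply, smul_eq_mul, Pi.one_apply]
    field_simp [hne l]
  have hch : BddMeas (f * fun l => conj (h l)) := by
    have := hfh.conjugate
    have h2 : (fun l => conj ((f * h) l)) = f * fun l => conj (h l) := by
      ext l; simp [hr]
    rwa [h2] at this
  rw [hy2]
  exact (P.memLp_vec_iff hb.conjugate.measurable hf (hb.conjugate.memLp _)).2 (hch.memLp _)

theorem isStrictlyPositiveOp_integral (P : SpectralMeasure H) (h : P.proj (Set.Iic 0) = 0) :
    (P.integral fun l => (l : ℂ)).IsStrictlyPositiveOp where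
  isSelfAdjoint := P.isSelfAdjoint_integral Complex.measurable_ofReal fun l => Complex.conj_ofReal l
  nonneg x := by
    rw [P.integral_apply, P.inner_self_vec x.2, integral_complex_ofReal]
    refine (integral_nonneg_of_ae ?_ : 0 ≤ ∫ l, l ∂(P.scalarMeasure (x : H)))
    filter_upwards [P.ae_pos h x] with l hl using hl.le
  injective := by
    change Function.Injective (P.integral fun l => (l : ℂ)).toFun
    rw [injective_iff_map_eq_zero]
    intro x hx
    have h1 := (P.vec_eq_zero_iff x.2).1 hx
    have h2 : ∀ᵐ _ ∂(P.scalarMeasure (x : H)), False := by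
      filter_upwards [h1, P.ae_pos h x] with l hl hl'
      exact hl'.ne' (by exact_mod_cast hl)
    have h3 : P.scalarMeasure (x : H) = 0 := by
      rw [← ae_eq_bot]; exact Filter.eventually_false_iff_eq_bot.1 h2
    exact Subtype.ext (P.eq_zero_of_scalarMeasure h3)

/-- The image of a spectral measure under a measurable map. -/
noncomputable def map (P : SpectralMeasure H) (φ : ℝ → ℝ) (hφ : Measurable φ) :
    SpectralMeasure H where
  proj s := P.proj (φ ⁻¹' s)
  isStarProjection s hs := P.isStarProjection _ (hφ hs)
  proj_univ := P.proj_univ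
  hasSum_iUnion f hf hd x := by
    rw [Set.preimage_iUnion]
    exact P.hasSum_iUnion _ (fun n => hφ (hf n)) (fun i j hij => (hd hij).preimage _) x

theorem scalarMeasure_map (P : SpectralMeasure H) {φ : ℝ → ℝ} (hφ : Measurable φ) (x : H) :
    (P.map φ hφ).scalarMeasure x = (P.scalarMeasure x).map φ := by
  ext s hs
  rw [Measure.map_apply hφ hs, scalarMeasure_apply _ _ hs, scalarMeasure_apply _ _ (hφ hs)]
  rfl

theorem proj_eq_zero_iff (P : SpectralMeasure H) {s : Set ℝ} (hs : MeasurableSet s) :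
    P.proj s = 0 ↔ ∀ x, P.scalarMeasure x s = 0 := by
  constructor
  · intro h x
    rw [P.scalarMeasure_apply x hs, h]; simp
  · intro h
    ext x
    have := h x
    rw [P.scalarMeasure_apply x hs, ENNReal.ofReal_eq_zero] at this
    have h2 : ‖P.proj s x‖ ^ 2 = 0 := le_antisymm this (by positivity)
    simpa using h2

theorem IsIntegral.congr {P Q : SpectralMeasure H} {f : ℝ → ℂ} {B : H →ₗ.[ℂ] H}
    (h : P.IsIntegral f B) (hPQ : ∀ x, P.scalarMeasure x = Q.scalarMeasure x) :
    Q.IsIntegral f B where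
  mem_domain_iff x := by rw [h.mem_domain_iff, hPQ]
  inner_apply x := by rw [h.inner_apply, hPQ]

end SpectralMeasure

/-! ### Uniqueness of scalar measures -/

/-- Finite measures on the positive half-line are determined by their Mellin transform on the
imaginary axis. -/
theorem MeasureTheory.Measure.ext_of_integral_cpow {μ ν : Measure ℝ} [IsFiniteMeasure μ]
    [IsFiniteMeasure ν] (hμ : ∀ᵐ l ∂μ, 0 < l) (hν : ∀ᵐ l ∂ν, 0 < l)
    (h : ∀ t : ℝ, ∫ l, (l : ℂ) ^ (-(Complex.I * t / (2 * Real.pi))) ∂μ =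
      ∫ l, (l : ℂ) ^ (-(Complex.I * t / (2 * Real.pi))) ∂ν) : μ = ν := by
  have hpi : (Real.pi : ℂ) ≠ 0 := by exact_mod_cast Real.pi_ne_zero
  -- The logarithm turns the Mellin transform at `t = -2π s` into the characteristic function at
  -- `s`.
  have key : ∀ (ρ : Measure ℝ), (∀ᵐ l ∂ρ, 0 < l) → ∀ s : ℝ, charFun (ρ.map Real.log) s =
      ∫ l, (l : ℂ) ^ (-(Complex.I * ((-(2 * Real.pi * s) : ℝ) : ℂ) / (2 * Real.pi))) ∂ρ := by
    intro ρ hρ s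
    rw [charFun_apply_real, integral_map Real.measurable_log.aemeasurable]
    · refine integral_congr_ae ?_
      filter_upwards [hρ] with l hl
      rw [Complex.cpow_def_of_ne_zero (by exact_mod_cast hl.ne'), ← Complex.ofReal_log hl.le]
      congr 1
      push_cast
      field_simp
    · exact (by fun_prop : Measurable fun x : ℝ => Complex.exp (s * x * Complex.I))
        |>.aestronglyMeasurable
  have hlog : μ.map Real.log = ν.map Real.log := by
    refine Measure.ext_of_charFun (funext fun s => ?_)
    rw [key μ hμ, key ν hν, h]
  have hexp : ∀ ρ : Measure ℝ, (∀ᵐ l ∂ρ, 0 < l) → (ρ.map Real.log).map Real.exp = ρ := by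
    intro ρ hρ
    rw [Measure.map_map Real.measurable_exp Real.measurable_log]
    conv_rhs => rw [← Measure.map_id (μ := ρ)]
    refine Measure.map_congr ?_
    filter_upwards [hρ] with l hl using Real.exp_log hl
  rw [← hexp μ hμ, ← hexp ν hν, hlog]

namespace SpectralMeasure

variable {H : Type*} [NormedAddCommGroup H] [InnerProductSpace ℂ H] [CompleteSpace H]

theorem _root_.BddMeas.of_boundedContinuous (g : BoundedContinuousFunction ℝ ℂ) : BddMeas g :=
  ⟨g.continuous.measurable, ‖g‖, g.norm_coe_le_norm⟩

/-- The algebra of bounded continuous functions on which two spectral measures agree. -/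
noncomputable def eqAlgebra (P Q : SpectralMeasure H) :
    StarSubalgebra ℂ (BoundedContinuousFunction ℝ ℂ) where
  carrier := {g | ∀ x, P.vec g x = Q.vec g x}
  mul_mem' {g h} hg hh x := by
    have bg := BddMeas.of_boundedContinuous g
    have bh := BddMeas.of_boundedContinuous h
    change P.vec ((g : ℝ → ℂ) * h) x = Q.vec ((g : ℝ → ℂ) * h) x
    rw [← P.vec_vec bh.measurable bg.measurable (bh.memLp _) ((bg.mul bh).memLp _),
      ← Q.vec_vec bh.measurable bg.measurable (bh.memLp _) ((bg.mul bh).memLp _), hh, hg]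
  add_mem' {g h} hg hh x := by
    have bg := BddMeas.of_boundedContinuous g
    have bh := BddMeas.of_boundedContinuous h
    change P.vec ((g : ℝ → ℂ) + h) x = Q.vec ((g : ℝ → ℂ) + h) x
    rw [P.vec_add_fun (bg.memLp _) (bh.memLp _), Q.vec_add_fun (bg.memLp _) (bh.memLp _), hg, hh]
  algebraMap_mem' c x := by
    change P.vec (fun _ => c) x = Q.vec (fun _ => c) x
    have hc : (fun _ : ℝ => c) = c • (1 : ℝ → ℂ) := by ext; simp
    rw [hc, P.vec_smul_fun c (BddMeas.one.memLp _), Q.vec_smul_fun c (BddMeas.one.memLp _),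
      P.vec_one, Q.vec_one]
  star_mem' {g} hg x := by
    have bg := BddMeas.of_boundedContinuous g
    change P.vec (fun l => conj (g l)) x = Q.vec (fun l => conj (g l)) x
    refine ext_inner_right ℂ fun y => ?_
    rw [P.inner_vec_left (bg.conjugate.memLp _) (bg.conjugate.memLp _),
      Q.inner_vec_left (bg.conjugate.memLp _) (bg.conjugate.memLp _)]
    simp only [Complex.conj_conj]
    exact congrArg _ (hg y)

/-- The resolvent function `l ↦ (l + i)⁻¹`. -/
noncomputable def resolventFun : BoundedContinuousFunction ℝ ℂ :=
  have hne : ∀ l : ℝ, (l : ℂ) + Complex.I ≠ 0 := fun l h => by simpa using congrArg Complex.im h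
  BoundedContinuousFunction.ofNormedAddCommGroup (fun l : ℝ => ((l : ℂ) + Complex.I)⁻¹)
    (Continuous.inv₀ (by fun_prop) hne) 1 fun l => by
      rw [norm_inv]
      refine inv_le_one_of_one_le₀ ?_
      simpa using Complex.abs_im_le_norm ((l : ℂ) + Complex.I)

theorem resolventFun_apply (l : ℝ) : resolventFun l = ((l : ℂ) + Complex.I)⁻¹ := rfl

theorem ofReal_mul_resolventFun :
    (fun l : ℝ => (l : ℂ)) * resolventFun = 1 + (-Complex.I) • (resolventFun : ℝ → ℂ) := by
  ext l
  have hne : (l : ℂ) + Complex.I ≠ 0 := fun h => by simpa using congrArg Complex.im h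
  simp only [Pi.mul_apply, resolventFun_apply, Pi.add_apply, Pi.one_apply, Pi.smul_apply,
    smul_eq_mul]
  field_simp
  ring

theorem bddMeas_ofReal_mul_resolventFun :
    BddMeas ((fun l : ℝ => (l : ℂ)) * resolventFun) := by
  rw [ofReal_mul_resolventFun]
  exact BddMeas.of_boundedContinuous (1 + (-Complex.I) • resolventFun)

theorem vec_resolventFun_mem (P : SpectralMeasure H) (x : H) :
    P.vec resolventFun x ∈ (P.integral fun l => (l : ℂ)).domain := by
  have hb := BddMeas.of_boundedContinuous resolventFun
  exact (P.memLp_vec_iff hb.measurable Complex.measurable_ofReal (hb.memLp _)).2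
    (bddMeas_ofReal_mul_resolventFun.memLp _)

theorem integral_vec_resolventFun (P : SpectralMeasure H) (x : H) :
    P.integral (fun l => (l : ℂ)) ⟨_, P.vec_resolventFun_mem x⟩ =
      x - Complex.I • P.vec resolventFun x := by
  have hb := BddMeas.of_boundedContinuous resolventFun
  rw [P.integral_apply, P.vec_vec hb.measurable Complex.measurable_ofReal (hb.memLp _)
    (bddMeas_ofReal_mul_resolventFun.memLp _), ofReal_mul_resolventFun,
    P.vec_add_fun (BddMeas.one.memLp _) ((hb.memLp _).const_smul _), P.vec_smul_fun _ (hb.memLp _),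
    P.vec_one, neg_smul, sub_eq_add_neg]

/-- The spectral measure of an operator is unique. -/
theorem scalarMeasure_eq_of_isIntegral {P Q : SpectralMeasure H} {A : H →ₗ.[ℂ] H}
    (hP : P.IsIntegral (fun l => (l : ℂ)) A) (hQ : Q.IsIntegral (fun l => (l : ℂ)) A) (x : H) :
    P.scalarMeasure x = Q.scalarMeasure x := by
  have eP := hP.eq_integral Complex.measurable_ofReal
  have eQ := hQ.eq_integral Complex.measurable_ofReal
  -- Both vectors solve `(A + i) u = x`, so their difference `w` satisfies `A w = -i w`. The form
  -- `⟪w, A w⟫` is real, being an integral of `l`, which forces `w = 0`.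
  have hres : ∀ x, P.vec resolventFun x = Q.vec resolventFun x := fun x => by
    let u : A.domain := ⟨P.vec resolventFun x, by rw [eP]; exact P.vec_resolventFun_mem x⟩
    let v : A.domain := ⟨Q.vec resolventFun x, by rw [eQ]; exact Q.vec_resolventFun_mem x⟩
    have hu : A u = x - Complex.I • (u : H) := by
      subst eP
      exact P.integral_vec_resolventFun x
    have hv : A v = x - Complex.I • (v : H) := by
      subst eQ
      exact Q.integral_vec_resolventFun x
    have hw : A (u - v) = -Complex.I • ((u - v : A.domain) : H) := by
      rw [LinearPMap.map_sub, hu, hv, Submodule.coe_sub]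
      module
    have h1 := hP.inner_apply (u - v)
    rw [hw, inner_smul_right, inner_self_eq_norm_sq_to_K, integral_complex_ofReal] at h1
    have h2 := congrArg Complex.im h1
    have h3 : ‖((u - v : A.domain) : H)‖ ^ 2 = 0 := by
      rw [Complex.ofReal_im, ← RCLike.ofReal_pow] at h2
      simpa [Complex.mul_im, ← Complex.ofReal_pow] using h2
    have h4 : ((u - v : A.domain) : H) = 0 := by simpa using h3
    rw [Submodule.coe_sub] at h4
    exact sub_eq_zero.1 h4
  -- Agreement on one injective function suffices: the functions on which `P` and `Q` agree form a
  -- star subalgebra, and the resolvent function already separates points.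
  refine ext_of_forall_mem_subalgebra_integral_eq_of_pseudoEMetric_complete_countable
    (A := eqAlgebra P Q) ?_ fun g hg => ?_
  · intro a b hab
    refine ⟨_, ⟨_, ⟨resolventFun, hres, rfl⟩, rfl⟩, fun h => hab ?_⟩
    have h' : ((a : ℂ) + Complex.I)⁻¹ = ((b : ℂ) + Complex.I)⁻¹ := h
    simpa using h'
  · have bg := BddMeas.of_boundedContinuous g
    rw [← P.inner_self_vec (bg.memLp _), ← Q.inner_self_vec (bg.memLp _)]
    exact congrArg _ (hg x)

end SpectralMeasure

/-! ### Unitary flows and their resolvents -/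

/-- A strongly continuous one-parameter unitary group. -/
structure UnitaryFlow (H : Type*) [NormedAddCommGroup H] [InnerProductSpace ℂ H] where
  /-- The operator at time `t`. -/
  toFun : ℝ → H →L[ℂ] H
  map_zero : toFun 0 = 1
  map_add : ∀ s t, toFun (s + t) = toFun s * toFun t
  norm_map : ∀ t x, ‖toFun t x‖ = ‖x‖
  continuous_apply : ∀ x, Continuous fun t => toFun t x

namespace UnitaryFlow

variable {H : Type*} [NormedAddCommGroup H] [InnerProductSpace ℂ H] [CompleteSpace H]

theorem inner_map (U : UnitaryFlow H) (t : ℝ) (x y : H) : ⟪U.toFun t x, U.toFun t y⟫ = ⟪x, y⟫ :=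
  LinearIsometry.inner_map_map ⟨(U.toFun t).toLinearMap, U.norm_map t⟩ x y

theorem map_add_apply (U : UnitaryFlow H) (s t : ℝ) (x : H) :
    U.toFun (s + t) x = U.toFun s (U.toFun t x) := by rw [U.map_add]; rfl

/-- The time-reversed flow. -/
noncomputable def reverse (U : UnitaryFlow H) : UnitaryFlow H where
  toFun t := U.toFun (-t)
  map_zero := by rw [neg_zero, U.map_zero]
  map_add s t := by rw [neg_add, U.map_add]
  norm_map t := U.norm_map (-t)
  continuous_apply x := (U.continuous_apply x).comp continuous_neg

theorem integrableOn_laplace (U : UnitaryFlow H) (x : H) (s : ℝ) :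
    IntegrableOn (fun t : ℝ => (Real.exp (-t) : ℂ) • U.toFun t x) (Set.Ioi s) := by
  refine Integrable.mono' ((integrableOn_exp_neg_Ioi s).mul_const ‖x‖) ?_ ?_
  · exact (Continuous.smul (by fun_prop) (U.continuous_apply x)).aestronglyMeasurable
  · refine Eventually.of_forall fun t => ?_
    rw [norm_smul, U.norm_map, Complex.norm_real, Real.norm_of_nonneg (Real.exp_pos _).le]

/-- The resolvent `∫₀^∞ e^{-t} U(t) dt`. -/
noncomputable def resolvent (U : UnitaryFlow H) : H →L[ℂ] H :=
  LinearMap.mkContinuous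
    { toFun := fun x => ∫ t in Set.Ioi (0 : ℝ), (Real.exp (-t) : ℂ) • U.toFun t x
      map_add' := fun x y => by
        simp only [_root_.map_add, smul_add]
        exact integral_add (U.integrableOn_laplace x 0) (U.integrableOn_laplace y 0)
      map_smul' := fun c x => by
        simp only [map_smul, RingHom.id_apply]
        rw [← integral_smul]
        simp only [smul_comm c] } 1 fun x => by
    rw [one_mul]
    change ‖∫ t in Set.Ioi (0 : ℝ), (Real.exp (-t) : ℂ) • U.toFun t x‖ ≤ ‖x‖
    refine (norm_integral_le_integral_norm _).trans ?_
    simp only [norm_smul, U.norm_map, Complex.norm_real, Real.norm_of_nonneg (Real.exp_pos _).le]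
    rw [integral_mul_const, integral_exp_neg_Ioi_zero, one_mul]

theorem resolvent_apply (U : UnitaryFlow H) (x : H) :
    U.resolvent x = ∫ t in Set.Ioi (0 : ℝ), (Real.exp (-t) : ℂ) • U.toFun t x := rfl

theorem commute_resolvent (U : UnitaryFlow H) (s : ℝ) (x : H) :
    U.toFun s (U.resolvent x) = U.resolvent (U.toFun s x) := by
  rw [resolvent_apply, resolvent_apply,
    ← ContinuousLinearMap.integral_comp_comm _ (U.integrableOn_laplace x 0)]
  simp only [map_smul, ← U.map_add_apply, add_comm s]

/-- Shifting the Laplace integral by `s` leaves `s` only in a scalar factor and in a limit of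
integration, so the orbit of a resolvent vector can be differentiated by the fundamental theorem of
calculus. -/
theorem map_resolvent_eq (U : UnitaryFlow H) (s : ℝ) (x : H) :
    U.toFun s (U.resolvent x) = (Real.exp s : ℂ) • (U.resolvent x -
      ∫ t in (0 : ℝ)..s, (Real.exp (-t) : ℂ) • U.toFun t x) := by
  have h1 := intervalIntegral.integral_interval_add_Ioi (U.integrableOn_laplace x 0)
    (U.integrableOn_laplace x s)
  have h2 := (measurePreserving_add_right volume s).setIntegral_preimage_emb
    (measurableEmbedding_addRight s) (fun t : ℝ => (Real.exp (-t) : ℂ) • U.toFun t x) (Set.Ioi s)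
  rw [commute_resolvent, resolvent_apply, resolvent_apply, ← h1, add_sub_cancel_left, ← h2,
    Set.preimage_add_const_Ioi, sub_self, ← integral_smul]
  refine integral_congr_ae (Eventually.of_forall fun t => ?_)
  simp only [smul_smul, ← U.map_add_apply, ← Complex.ofReal_mul, ← Real.exp_add]
  congr 3
  ring

/-- For the generator `G` and the resolvent `R = (1 - G)⁻¹` this is the identity `G R = R - 1`,
stated without the unbounded `G`. -/
theorem hasDerivAt_map_resolvent (U : UnitaryFlow H) (x : H) (s : ℝ) :
    HasDerivAt (fun s => U.toFun s (U.resolvent x)) (U.toFun s (U.resolvent x - x)) s := by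
  have hc : Continuous fun t : ℝ => (Real.exp (-t) : ℂ) • U.toFun t x :=
    Continuous.smul (by fun_prop) (U.continuous_apply x)
  have h1 : HasDerivAt (fun s => ∫ t in (0 : ℝ)..s, (Real.exp (-t) : ℂ) • U.toFun t x)
      ((Real.exp (-s) : ℂ) • U.toFun s x) s :=
    intervalIntegral.integral_hasDerivAt_right (hc.intervalIntegrable _ _)
      hc.aestronglyMeasurable.stronglyMeasurableAtFilter hc.continuousAt
  have h2 : HasDerivAt (fun s : ℝ => (Real.exp s : ℂ)) (Real.exp s : ℂ) s :=
    (Real.hasDerivAt_exp s).ofReal_comp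
  have h3 := h2.smul (h1.const_sub (U.resolvent x))
  have h4 : (fun s => U.toFun s (U.resolvent x)) = fun s => (Real.exp s : ℂ) • (U.resolvent x -
      ∫ t in (0 : ℝ)..s, (Real.exp (-t) : ℂ) • U.toFun t x) := funext fun s =>
    U.map_resolvent_eq s x
  rw [h4]
  refine h3.congr_deriv ?_
  rw [map_sub, U.map_resolvent_eq, smul_neg, smul_smul, ← Complex.ofReal_mul, ← Real.exp_add,
    add_neg_cancel, Real.exp_zero, Complex.ofReal_one, one_smul]
  abel

/-- Differentiate at `0` the inner product of two orbits, which is constant by unitarity: the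
generator is skew-symmetric. -/
theorem inner_resolvent (U : UnitaryFlow H) (x y : H) :
    ⟪U.resolvent x - x, U.resolvent y⟫ + ⟪U.resolvent x, U.resolvent y - y⟫ = 0 := by
  have h := (U.hasDerivAt_map_resolvent x 0).inner ℂ (U.hasDerivAt_map_resolvent y 0)
  have h0 : HasDerivAt (fun s => (⟪U.toFun s (U.resolvent x), U.toFun s (U.resolvent y)⟫ : ℂ))
      0 0 := by
    simp only [U.inner_map]
    exact hasDerivAt_const _ _
  have := h0.unique h
  rw [U.inner_map, U.inner_map] at this
  rw [this, add_comm]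

/-- The same differentiation as in `inner_resolvent`, with the second orbit starting at a resolvent
vector of the reversed flow, whose generator has the opposite sign. -/
theorem inner_resolvent_reverse (U : UnitaryFlow H) (x y : H) :
    ⟪U.resolvent x, y⟫ = ⟪x, U.reverse.resolvent y⟫ := by
  have h1 : HasDerivAt (fun s => U.toFun s (U.reverse.resolvent y))
      (y - U.reverse.resolvent y) 0 := by
    have h := (U.reverse.hasDerivAt_map_resolvent y (-0)).scomp (0 : ℝ) (hasDerivAt_neg (0 : ℝ))
    have h2 : (fun s => U.reverse.toFun s (U.reverse.resolvent y)) ∘ Neg.neg =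
        fun s => U.toFun s (U.reverse.resolvent y) := by
      ext s; simp [reverse]
    have h3 : (fun s => U.reverse.toFun s (U.reverse.resolvent y)) ∘ (fun x : ℝ => -x) =
        fun s => U.toFun s (U.reverse.resolvent y) := h2
    rw [← h3]
    refine h.congr_deriv ?_
    rw [neg_zero, U.reverse.map_zero, neg_one_smul]
    exact neg_sub _ _
  have h := (U.hasDerivAt_map_resolvent x 0).inner ℂ h1
  have h0 : HasDerivAt (fun s => (⟪U.toFun s (U.resolvent x),
      U.toFun s (U.reverse.resolvent y)⟫ : ℂ)) 0 0 := by
    simp only [U.inner_map]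
    exact hasDerivAt_const _ _
  have := h0.unique h
  rw [U.map_zero] at this
  simp only [one_apply_eq_self, inner_sub_right, inner_sub_left] at this
  linear_combination -this

theorem eq_zero_of_resolvent (U : UnitaryFlow H) {x : H} (h : U.resolvent x = 0) : x = 0 := by
  have h1 := U.hasDerivAt_map_resolvent x 0
  rw [h, U.map_zero] at h1
  simp only [_root_.map_zero, zero_sub, one_apply_eq_self] at h1
  simpa using h1.unique (hasDerivAt_const (0 : ℝ) (0 : H))

theorem adjoint_resolvent (U : UnitaryFlow H) :
    ContinuousLinearMap.adjoint U.resolvent = U.reverse.resolvent := by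
  ext x
  refine ext_inner_left ℂ fun y => ?_
  rw [ContinuousLinearMap.adjoint_inner_right, U.inner_resolvent_reverse]

/-- Skew-symmetry gives `2 ‖R x‖² = ⟪R x, x⟫ + ⟪x, R x⟫`. The right side is unchanged when `R` is
replaced by `R*`, the resolvent of the reversed flow, so `‖R x‖ = ‖R* x‖`. -/
theorem isStarNormal_resolvent (U : UnitaryFlow H) : IsStarNormal U.resolvent := by
  have h1 : ∀ (U : UnitaryFlow H) (x : H),
      2 * ⟪U.resolvent x, U.resolvent x⟫ = ⟪U.resolvent x, x⟫ + ⟪x, U.resolvent x⟫ := by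
    intro U x
    have := U.inner_resolvent x x
    rw [inner_sub_left, inner_sub_right] at this
    linear_combination this
  refine ⟨ContinuousLinearMap.ext_of_inner_self fun x => ?_⟩
  rw [ContinuousLinearMap.star_eq_adjoint, mul_apply_eq_comp, mul_apply_eq_comp,
    ContinuousLinearMap.adjoint_inner_right]
  rw [U.adjoint_resolvent]
  have h2 := h1 U x
  have h3 := h1 U.reverse x
  rw [← U.inner_resolvent_reverse x x] at h3
  have h4 : (⟪U.reverse.resolvent x, x⟫ : ℂ) = ⟪x, U.resolvent x⟫ := by
    rw [← inner_conj_symm, ← U.inner_resolvent_reverse, inner_conj_symm]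
  have h5 : (⟪x, U.resolvent (U.reverse.resolvent x)⟫ : ℂ) =
      ⟪U.reverse.resolvent x, U.reverse.resolvent x⟫ := by
    rw [← inner_conj_symm, U.inner_resolvent_reverse, inner_conj_symm]
  rw [h5]
  rw [h4] at h3
  linear_combination (h2 - h3) / 2

theorem denseRange_resolvent (U : UnitaryFlow H) : DenseRange U.resolvent := by
  have h : (LinearMap.range U.resolvent.toLinearMap)ᗮ = ⊥ := by
    rw [eq_bot_iff]
    intro x hx
    rw [Submodule.mem_orthogonal] at hx
    refine U.reverse.eq_zero_of_resolvent (ext_inner_left ℂ fun y => ?_)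
    rw [← U.inner_resolvent_reverse, inner_zero_right]
    exact hx _ ⟨y, rfl⟩
  have h2 := (Submodule.topologicalClosure_eq_top_iff).2 h
  rw [Submodule.eq_top_iff'] at h2
  exact fun x => h2 x

/-- A flow is determined by its resolvent. -/
theorem eq_of_resolvent_eq {U V : UnitaryFlow H} (h : ∀ x, U.resolvent x = V.resolvent x) (s : ℝ)
    (x : H) : U.toFun s x = V.toFun s x := by
  -- On the common resolvent vectors the inner product of the two orbits has zero derivative; being
  -- constant, it forces the distance between the orbits to vanish. Density of the range does the
  -- rest.
  have hd : ∀ x s, HasDerivAt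
      (fun s => (⟪V.toFun s (V.resolvent x), U.toFun s (U.resolvent x)⟫ : ℂ)) 0 s := by
    intro x s
    refine ((V.hasDerivAt_map_resolvent x s).inner ℂ
      (U.hasDerivAt_map_resolvent x s)).congr_deriv ?_
    rw [map_sub, map_sub, U.commute_resolvent, V.commute_resolvent, h, add_comm]
    exact V.inner_resolvent _ _
  have hc : ∀ x s, ⟪V.toFun s (V.resolvent x), U.toFun s (U.resolvent x)⟫ =
      (⟪V.resolvent x, V.resolvent x⟫ : ℂ) := by
    intro x s
    have := is_const_of_deriv_eq_zero (fun s => (hd x s).differentiableAt)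
      (fun s => (hd x s).deriv) s 0
    rw [this, U.map_zero, V.map_zero, h]
    rfl
  refine U.denseRange_resolvent.induction_on x (isClosed_eq (U.toFun s).continuous
    (V.toFun s).continuous) fun x => ?_
  have h1 : ‖U.toFun s (U.resolvent x) - V.toFun s (V.resolvent x)‖ ^ 2 = 0 := by
    rw [@norm_sub_sq ℂ, U.norm_map, V.norm_map, ← inner_conj_symm, RCLike.conj_re, hc, h,
      inner_self_eq_norm_sq]
    ring
  rw [h x] at h1 ⊢
  exact sub_eq_zero.1 (by simpa using h1)

end UnitaryFlow

/-! ### Flows with given phases and Stone's theorem -/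

/-- The phase `l ↦ exp (i t a(l))`. -/
noncomputable def phase (a : ℝ → ℝ) (t : ℝ) : ℝ → ℂ := fun l => Complex.exp (Complex.I * (t * a l))

theorem norm_phase (a : ℝ → ℝ) (t l : ℝ) : ‖phase a t l‖ = 1 := by
  rw [phase, mul_comm, ← Complex.ofReal_mul, Complex.norm_exp_ofReal_mul_I]

theorem bddMeas_phase {a : ℝ → ℝ} (ha : Measurable a) (t : ℝ) : BddMeas (phase a t) :=
  ⟨by unfold phase; fun_prop, 1, fun l => (norm_phase a t l).le⟩

theorem phase_zero (a : ℝ → ℝ) : phase a 0 = 1 := by ext; simp [phase]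

theorem phase_add (a : ℝ → ℝ) (s t : ℝ) : phase a (s + t) = phase a s * phase a t := by
  ext l
  rw [Pi.mul_apply, phase, phase, phase, ← Complex.exp_add]
  push_cast
  ring_nf

theorem conj_phase (a : ℝ → ℝ) (t : ℝ) (l : ℝ) : conj (phase a t l) = phase a (-t) l := by
  rw [phase, phase, ← Complex.exp_conj]
  simp [Complex.conj_ofReal]

namespace SpectralMeasure

variable {H : Type*} [NormedAddCommGroup H] [InnerProductSpace ℂ H] [CompleteSpace H]

/-- The unitary flow `exp (i t ∫ a dP)`. -/
noncomputable def flow (P : SpectralMeasure H) (a : ℝ → ℝ) (ha : Measurable a) :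
    UnitaryFlow H where
  toFun t := P.bop (phase a t)
  map_zero := by rw [phase_zero, P.bop_one]
  map_add s t := by rw [phase_add, P.bop_mul (bddMeas_phase ha s) (bddMeas_phase ha t)]
  norm_map t x := by
    have hb := bddMeas_phase ha t
    rw [P.bop_apply hb]
    have h := P.norm_sq_vec (hb.memLp (P.scalarMeasure x))
    simp only [norm_phase, one_pow, integral_const, smul_eq_mul, mul_one,
      P.scalarMeasure_univ] at h
    exact (sq_eq_sq₀ (norm_nonneg _) (norm_nonneg _)).1 h
  continuous_apply x := by
    refine continuous_iff_continuousAt.2 fun t => ?_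
    simp only [ContinuousAt, P.bop_apply (bddMeas_phase ha _)]
    refine P.calculus.tendsto_vec_of_dominated (fun _ => 1)
      (fun t => (bddMeas_phase ha t).measurable.aestronglyMeasurable)
      (bddMeas_phase ha t).measurable.aestronglyMeasurable (memLp_const 1)
      (fun t => Eventually.of_forall fun l => (norm_phase a t l).le)
      (Eventually.of_forall fun l => (norm_phase a t l).le)
      (Eventually.of_forall fun l => ?_)
    have : Continuous fun t => phase a t l := by unfold phase; fun_prop
    exact this.tendsto t

theorem inner_flow (P : SpectralMeasure H) (a : ℝ → ℝ) (ha : Measurable a) (t : ℝ) (x : H) :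
    ⟪x, (P.flow a ha).toFun t x⟫ = ∫ l, phase a t l ∂(P.scalarMeasure x) :=
  P.inner_self_bop (bddMeas_phase ha t) x

/-- By Fubini, integrate `exp((i a - 1) t)` over `t > 0` first. -/
theorem inner_resolvent_flow (P : SpectralMeasure H) (a : ℝ → ℝ) (ha : Measurable a) (x : H) :
    ⟪x, (P.flow a ha).resolvent x⟫ = ∫ l, (1 - Complex.I * a l)⁻¹ ∂(P.scalarMeasure x) := by
  rw [UnitaryFlow.resolvent_apply, ← integral_inner ((P.flow a ha).integrableOn_laplace x 0)]
  simp only [inner_smul_right, P.inner_flow]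
  simp_rw [← integral_const_mul]
  rw [integral_integral_swap]
  · refine integral_congr_ae (Eventually.of_forall fun l => ?_)
    have h : ∀ t : ℝ, (Real.exp (-t) : ℂ) * phase a t l =
        Complex.exp ((Complex.I * a l - 1) * t) := fun t => by
      rw [phase, Complex.ofReal_exp, ← Complex.exp_add]
      push_cast
      ring_nf
    simp only [h]
    rw [integral_exp_mul_complex_Ioi (by simp)]
    simp only [Complex.ofReal_zero, mul_zero, Complex.exp_zero]
    rw [neg_div, ← div_neg, neg_sub, one_div]
  · have h1 : Integrable (fun p : ℝ × ℝ => Real.exp (-p.1) * 1)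
        ((volume.restrict (Set.Ioi 0)).prod (P.scalarMeasure x)) :=
      Integrable.mul_prod (integrableOn_exp_neg_Ioi 0) (integrable_const (1 : ℝ))
    refine h1.mono' ?_ (Eventually.of_forall fun p => ?_)
    · have : Measurable fun p : ℝ × ℝ => (Real.exp (-p.1) : ℂ) * phase a p.1 p.2 := by
        unfold phase; fun_prop
      exact this.aestronglyMeasurable
    · simp only [Function.uncurry, norm_mul, norm_phase, Complex.norm_real,
        Real.norm_of_nonneg (Real.exp_pos _).le, le_refl]

end SpectralMeasure

/-- **Stone's theorem** in spectral form. -/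
theorem UnitaryFlow.exists_spectralMeasure {H : Type*} [NormedAddCommGroup H]
    [InnerProductSpace ℂ H] [CompleteSpace H] (U : UnitaryFlow H) :
    ∃ P : SpectralMeasure H, ∃ (a : ℝ → ℝ) (ha : Measurable a),
      ∀ t x, U.toFun t x = (P.flow a ha).toFun t x := by
  obtain ⟨P, g, hgm, hgb, hg⟩ :=
    U.resolvent.exists_spectralMeasure U.isStarNormal_resolvent
  have bg : BddMeas g := ⟨hgm, hgb⟩
  have hR : U.resolvent = P.bop g := P.eq_bop bg hg
  -- The generator should be `∫ i a dP` with `g = (1 - i a)⁻¹`. Solving `1 - i a = conj g / ‖g‖²`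
  -- for the imaginary part gives this `a`; the real part requires `‖g‖² = Re g`.
  have ha : Measurable fun l => (g l).im / ‖g l‖ ^ 2 := by fun_prop
  refine ⟨P, _, ha, fun t x => UnitaryFlow.eq_of_resolvent_eq (fun x => ?_) t x⟩
  suffices h : U.resolvent = (P.flow _ ha).resolvent by rw [h]
  refine ContinuousLinearMap.ext_of_inner_self fun x => ?_
  rw [hg, P.inner_resolvent_flow]
  -- Injectivity of the resolvent kills the spectral projection of the zero set of `g`.
  have h0 : ∀ᵐ l ∂(P.scalarMeasure x), g l ≠ 0 := by
    have hs : MeasurableSet (g ⁻¹' {0}) := hgm (measurableSet_singleton 0)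
    refine P.ae_notMem hs ?_ x
    ext y
    refine U.eq_zero_of_resolvent ?_
    rw [hR, ← P.bop_indicator hs, ← mul_apply_eq_comp, P.bop_mul bg (BddMeas.one.indicator hs)]
    have : g * (g ⁻¹' {0}).indicator 1 = 0 := by
      ext l
      by_cases h : g l = 0 <;> simp [h]
    have b0 : BddMeas (0 : ℝ → ℂ) := BddMeas.const 0
    rw [this, P.bop_apply b0, P.vec_eq_zero_iff (b0.memLp _)]
    exact Eventually.of_forall fun _ => rfl
  -- This is the skew-symmetry relation `R* R = Re R` read off on the spectrum.
  have h1 : ∀ᵐ l ∂(P.scalarMeasure x), ‖g l‖ ^ 2 = (g l).re := by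
    set k : ℝ → ℂ := fun l => ((‖g l‖ ^ 2 - (g l).re : ℝ) : ℂ) with hk
    obtain ⟨M, hM⟩ := hgb
    have bk : BddMeas k := ⟨by fun_prop, M ^ 2 + M, fun l => by
      rw [hk, Complex.norm_real]
      refine (norm_sub_le _ _).trans ?_
      rw [Real.norm_of_nonneg (by positivity)]
      exact add_le_add (pow_le_pow_left₀ (norm_nonneg _) (hM l) 2)
        ((Complex.abs_re_le_norm _).trans (hM l))⟩
    have hk0 : P.bop k = 0 := by
      refine ContinuousLinearMap.ext_of_inner_self fun y => ?_
      have hi : Integrable (fun l => (g l).re) (P.scalarMeasure y) := (bg.integrable _).re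
      have hi2 : Integrable (fun l => ‖g l‖ ^ 2) (P.scalarMeasure y) :=
        (bg.memLp _).integrable_norm_pow'
      rw [P.inner_self_bop bk, integral_complex_ofReal, integral_sub hi2 hi,
        ← P.norm_sq_vec (bg.memLp _), ← P.bop_apply bg, ← hR]
      have h2 := U.inner_resolvent y y
      rw [inner_sub_left, inner_sub_right] at h2
      have h3 := congrArg Complex.re h2
      have h4 : (⟪U.resolvent y, y⟫ : ℂ).re = (⟪y, U.resolvent y⟫ : ℂ).re := by
        rw [← inner_conj_symm, Complex.conj_re]
      have h5 : (⟪U.resolvent y, U.resolvent y⟫ : ℂ).re = ‖U.resolvent y‖ ^ 2 :=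
        inner_self_eq_norm_sq (𝕜 := ℂ) _
      have h6 : (⟪y, U.resolvent y⟫ : ℂ).re = ∫ l, (g l).re ∂(P.scalarMeasure y) := by
        rw [hg]
        exact (integral_re (bg.integrable _)).symm
      simp only [Complex.add_re, Complex.sub_re, Complex.zero_re] at h3
      have h7 : ‖U.resolvent y‖ ^ 2 - ∫ l, (g l).re ∂(P.scalarMeasure y) = 0 := by
        rw [← h6, ← h5]; linarith
      simp [h7]
    have h2 := (P.vec_eq_zero_iff (bk.memLp (P.scalarMeasure x))).1 (by
      rw [← P.bop_apply bk, hk0]; rfl)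
    filter_upwards [h2] with l hl
    have : ‖g l‖ ^ 2 - (g l).re = 0 := Complex.ofReal_injective hl
    linarith
  refine integral_congr_ae ?_
  filter_upwards [h0, h1] with l h0 h1
  have hn : (‖g l‖ ^ 2 : ℝ) ≠ 0 := by positivity
  refine eq_inv_of_mul_eq_one_left ?_
  have hn' : ((‖g l‖ ^ 2 : ℝ) : ℂ) ≠ 0 := by exact_mod_cast hn
  have h2 : (‖g l‖ ^ 2 : ℝ) = (g l).re * (g l).re + (g l).im * (g l).im := by
    rw [← Complex.normSq_eq_norm_sq, Complex.normSq_apply]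
  have h3 : (1 : ℂ) - Complex.I * (((g l).im / ‖g l‖ ^ 2 : ℝ) : ℂ) =
      conj (g l) / ((‖g l‖ ^ 2 : ℝ) : ℂ) := by
    rw [eq_div_iff hn', sub_mul, one_mul, mul_assoc, ← Complex.ofReal_mul, div_mul_cancel₀ _ hn]
    conv_lhs => rw [h1]
    apply Complex.ext <;> simp
  rw [h3, ← mul_div_assoc, Complex.mul_conj, Complex.normSq_eq_norm_sq, div_self hn']

/-! ### Modular pairs and the involution `J Δ^{1/2}` -/

/-- The square root as a complex-valued function. -/
noncomputable def sqrtFun (l : ℝ) : ℂ := (Real.sqrt l : ℂ)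

theorem measurable_sqrtFun : Measurable sqrtFun := by unfold sqrtFun; fun_prop

theorem conj_sqrtFun (l : ℝ) : conj (sqrtFun l) = sqrtFun l := Complex.conj_ofReal _

theorem sqrtFun_mul_self {l : ℝ} (hl : 0 ≤ l) : sqrtFun l * sqrtFun l = l := by
  rw [sqrtFun, ← Complex.ofReal_mul, Real.mul_self_sqrt hl]

theorem sqrtFun_eq_cpow {l : ℝ} (hl : 0 ≤ l) : sqrtFun l = (l : ℂ) ^ (1 / 2 : ℂ) := by
  rw [sqrtFun, Real.sqrt_eq_rpow, Complex.ofReal_cpow hl]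
  norm_num

theorem sqrtFun_inv_mul {l : ℝ} (hl : 0 < l) : sqrtFun l⁻¹ * sqrtFun l = 1 := by
  rw [sqrtFun, sqrtFun, ← Complex.ofReal_mul, Real.sqrt_inv,
    inv_mul_cancel₀ (Real.sqrt_pos.2 hl).ne', Complex.ofReal_one]

theorem SpectralMeasure.IsIntegral.congr_ae {H : Type*} [NormedAddCommGroup H]
    [InnerProductSpace ℂ H] [CompleteSpace H] {P : SpectralMeasure H} {f g : ℝ → ℂ}
    {B : H →ₗ.[ℂ] H} (h : P.IsIntegral f B) (hfg : ∀ x, f =ᵐ[P.scalarMeasure x] g) :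
    P.IsIntegral g B where
  mem_domain_iff x := by
    rw [h.mem_domain_iff]
    refine iff_of_eq (congrArg (· < ∞) (lintegral_congr_ae ?_))
    filter_upwards [hfg x] with l hl
    rw [hl]
  inner_apply x := by rw [h.inner_apply]; exact integral_congr_ae (hfg _)

/-- A spectral measure on the positive half-line with a compatible antiunitary involution. -/
structure ModularPair (H : Type*) [NormedAddCommGroup H] [InnerProductSpace ℂ H]
    [CompleteSpace H] where
  /-- The spectral measure of the modular operator. -/
  P : SpectralMeasure H
  null : P.proj (Set.Iic 0) = 0
  /-- The modular conjugation. -/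
  J : H ≃ₗᵢ[ℝ] H
  antilinear : ∀ (c : ℂ) (x : H), J (c • x) = conj c • J x
  involutive : ∀ x, J (J x) = x
  scalarMeasure_J : ∀ x, P.scalarMeasure (J x) = (P.scalarMeasure x).map (·⁻¹)

/-- An antilinear isometry reverses inner products. -/
theorem LinearIsometryEquiv.inner_map_antilinear {H : Type*} [NormedAddCommGroup H]
    [InnerProductSpace ℂ H] {J : H ≃ₗᵢ[ℝ] H} (hJ : ∀ (c : ℂ) (x : H), J (c • x) = conj c • J x)
    (x y : H) : ⟪J x, J y⟫ = ⟪y, x⟫ := by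
  have hI : ∀ z, J (Complex.I • z) = -(Complex.I • J z) := fun z => by
    rw [hJ, Complex.conj_I, neg_smul]
  rw [inner_eq_sum_norm_sq_div_four (𝕜 := ℂ) (J x), inner_eq_sum_norm_sq_div_four (𝕜 := ℂ) y]
  have h1 : ‖J x + J y‖ = ‖y + x‖ := by rw [← map_add, J.norm_map, add_comm]
  have h2 : ‖J x - J y‖ = ‖y - x‖ := by rw [← map_sub, J.norm_map, norm_sub_rev]
  have h3 : ‖J x - Complex.I • J y‖ = ‖y - Complex.I • x‖ := by
    rw [sub_eq_add_neg, ← hI, ← map_add, J.norm_map]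
    have : x + Complex.I • y = Complex.I • (y - Complex.I • x) := by
      rw [smul_sub, smul_smul, Complex.I_mul_I]; module
    rw [this, norm_smul, Complex.norm_I, one_mul]
  have h4 : ‖J x + Complex.I • J y‖ = ‖y + Complex.I • x‖ := by
    rw [← sub_neg_eq_add, ← hI, ← map_sub, J.norm_map]
    have : x - Complex.I • y = -Complex.I • (y + Complex.I • x) := by
      rw [smul_add, smul_smul, neg_mul, Complex.I_mul_I]; module
    rw [this, norm_smul, norm_neg, Complex.norm_I, one_mul]
  simp only [RCLike.I_to_complex, h1, h2, h3, h4]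

namespace ModularPair

variable {H : Type*} [NormedAddCommGroup H] [InnerProductSpace ℂ H] [CompleteSpace H]

theorem inner_J (M : ModularPair H) (x y : H) : ⟪M.J x, M.J y⟫ = ⟪y, x⟫ :=
  LinearIsometryEquiv.inner_map_antilinear M.antilinear x y

/-- The symmetry is only assumed for scalar measures. Conjugating a projection by `J` twice gives a
complex linear operator, and its quadratic form at `x` is a value of the scalar measure of `J x`, so
polarization upgrades the symmetry to projections. -/
theorem J_proj (M : ModularPair H) {s : Set ℝ} (hs : MeasurableSet s) (x : H) :
    M.J (M.P.proj s x) = M.P.proj ((·⁻¹) ⁻¹' s) (M.J x) := by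
  have hs' : MeasurableSet ((·⁻¹) ⁻¹' s : Set ℝ) := measurable_inv hs
  have hT : ∃ T : H →L[ℂ] H, ∀ x, T x = M.J (M.P.proj ((·⁻¹) ⁻¹' s) (M.J x)) := by
    refine ⟨LinearMap.mkContinuous ⟨⟨fun x => M.J (M.P.proj ((·⁻¹) ⁻¹' s) (M.J x)), ?_⟩, ?_⟩
      ‖M.P.proj ((·⁻¹) ⁻¹' s)‖ ?_, fun x => rfl⟩
    · intro x y; simp
    · intro c x; simp [M.antilinear]
    · intro x
      change ‖M.J (M.P.proj ((·⁻¹) ⁻¹' s) (M.J x))‖ ≤ _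
      rw [M.J.norm_map]
      refine (ContinuousLinearMap.le_opNorm _ _).trans ?_
      rw [M.J.norm_map]
  obtain ⟨T, hT⟩ := hT
  have hTP : T = M.P.proj s := by
    refine ContinuousLinearMap.ext_of_inner_self fun x => ?_
    rw [hT]
    conv_lhs => rw [← M.involutive x, M.involutive x]
    have h1 := M.inner_J (M.J x) (M.P.proj ((·⁻¹) ⁻¹' s) (M.J x))
    rw [M.involutive] at h1
    have h2 : ∀ {t : Set ℝ}, MeasurableSet t → ∀ y : H, (⟪y, M.P.proj t y⟫ : ℂ) =
        (((M.P.scalarMeasure y).real t : ℝ) : ℂ) := fun {t} ht y => by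
      have := M.P.inner_proj_proj MeasurableSet.univ ht y
      rwa [M.P.proj_univ, Set.univ_inter] at this
    rw [h1, ← inner_conj_symm, h2 hs', h2 hs, Complex.conj_ofReal, M.scalarMeasure_J,
      map_measureReal_apply measurable_inv hs']
    congr 2
    ext l
    simp
  rw [← hTP, hT, M.involutive]

theorem J_sumProj (M : ModularPair H) (a : {s : Set ℝ // MeasurableSet s} →₀ ℂ) (x : H) :
    M.J (M.P.sumProj a x) = M.P.vec (fun l => conj (Finsupp.sumIndicator a l⁻¹)) (M.J x) := by
  have hb : ∀ a : {s : Set ℝ // MeasurableSet s} →₀ ℂ,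
      MemLp (fun l => conj (Finsupp.sumIndicator a l⁻¹)) 2 (M.P.scalarMeasure (M.J x)) := by
    intro a
    have h := Finsupp.memLp_sumIndicator a ((M.P.scalarMeasure (M.J x)).map (·⁻¹))
    exact (h.comp_of_map measurable_inv.aemeasurable).star
  induction a using Finsupp.induction_linear with
  | zero =>
    have h := M.P.vec_smul_fun 0 (hb 0)
    rw [zero_smul, zero_smul] at h
    have h0 : (fun l => conj (Finsupp.sumIndicator 0 l⁻¹)) = (0 : ℝ → ℂ) := by ext; simp
    rw [h0, h]
    simp
  | add a b ha hb' =>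
    rw [map_add, add_apply, map_add, ha, hb', ← M.P.vec_add_fun (hb a) (hb b)]
    congr 1
    ext l
    simp
  | single t c =>
    have hs' : MeasurableSet ((·⁻¹) ⁻¹' (t : Set ℝ) : Set ℝ) := measurable_inv t.2
    have h : (fun l => conj (Finsupp.sumIndicator (Finsupp.single t c) l⁻¹)) =
        conj c • ((·⁻¹) ⁻¹' (t : Set ℝ)).indicator (1 : ℝ → ℂ) := by
      ext l
      rw [Finsupp.sumIndicator_single]
      by_cases h : l⁻¹ ∈ (t : Set ℝ) <;> simp [h]
    have hL : MemLp (((·⁻¹) ⁻¹' (t : Set ℝ)).indicator (1 : ℝ → ℂ)) 2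
      (M.P.scalarMeasure (M.J x)) := MemLp.indicator hs' (memLp_const (1 : ℂ))
    rw [h, M.P.vec_smul_fun _ hL, M.P.sumProj_single, smul_apply, M.antilinear, M.J_proj t.2]
    congr 1
    exact (M.P.vec_indicator hs' _).symm

theorem memLp_comp_inv (M : ModularPair H) {f : ℝ → ℂ} {x : H}
    (hf : MemLp f 2 (M.P.scalarMeasure x)) :
    MemLp (fun l => conj (f l⁻¹)) 2 (M.P.scalarMeasure (M.J x)) := by
  have h : M.P.scalarMeasure x = (M.P.scalarMeasure (M.J x)).map (·⁻¹) := by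
    rw [← M.scalarMeasure_J, M.involutive]
  rw [h] at hf
  exact (hf.comp_of_map measurable_inv.aemeasurable).star

/-- `J` intertwines `∫ f dP` with `∫ conj f(1/l) dP`. -/
theorem J_vec (M : ModularPair H) {f : ℝ → ℂ} {x : H} (hf : MemLp f 2 (M.P.scalarMeasure x)) :
    M.J (M.P.vec f x) = M.P.vec (fun l => conj (f l⁻¹)) (M.J x) := by
  obtain ⟨a, ha⟩ := M.P.calculus.exists_seq (M.P.scalarMeasure x) hf
  have h1 := (M.J.continuous.tendsto _).comp (M.P.calculus.tendsto_vec hf ha)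
  refine tendsto_nhds_unique h1 ?_
  have h2 : ∀ n, M.J (M.P.calculus.op (a n) x) =
      M.P.vec (fun l => conj (Finsupp.sumIndicator (a n) l⁻¹)) (M.J x) :=
    fun n => M.J_sumProj (a n) x
  simp only [Function.comp_def, h2]
  refine M.P.calculus.tendsto_vec_of_eLpNorm
    (fun n => M.memLp_comp_inv (Finsupp.memLp_sumIndicator (a n) _)) (M.memLp_comp_inv hf) ?_
  refine ha.congr fun n => ?_
  have h : M.P.scalarMeasure x = (M.P.scalarMeasure (M.J x)).map (·⁻¹) := by
    rw [← M.scalarMeasure_J, M.involutive]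
  have hm : MemLp (Finsupp.sumIndicator (a n) - f) 2 (M.P.scalarMeasure x) :=
    (Finsupp.memLp_sumIndicator (a n) _).sub hf
  rw [h] at hm
  change eLpNorm (Finsupp.sumIndicator (a n) - f) 2 (M.P.scalarMeasure x) = _
  rw [h, eLpNorm_map_measure hm.1 measurable_inv.aemeasurable]
  refine eLpNorm_congr_norm_ae (Eventually.of_forall fun l => ?_)
  simp only [Pi.sub_apply, Function.comp_apply]
  rw [← map_sub, RCLike.norm_conj]

/-- The modular operator. -/
noncomputable def D (M : ModularPair H) : H →ₗ.[ℂ] H := M.P.integral fun l => (l : ℂ)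

/-- The square root of the modular operator. -/
noncomputable def B (M : ModularPair H) : H →ₗ.[ℂ] H := M.P.integral sqrtFun

theorem isIntegral_D (M : ModularPair H) : M.P.IsIntegral (fun l => (l : ℂ)) M.D :=
  M.P.isIntegral_integral Complex.measurable_ofReal

theorem isStrictlyPositiveOp_D (M : ModularPair H) : M.D.IsStrictlyPositiveOp :=
  M.P.isStrictlyPositiveOp_integral M.null

theorem isCPow_B (M : ModularPair H) : M.D.IsCPow (1 / 2) M.B := by
  refine ⟨M.P, M.isIntegral_D, M.null,
    (M.P.isIntegral_integral measurable_sqrtFun).congr_ae fun x => ?_⟩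
  filter_upwards [M.P.ae_pos M.null x] with l hl using sqrtFun_eq_cpow hl.le

theorem isSelfAdjoint_B (M : ModularPair H) : IsSelfAdjoint M.B :=
  M.P.isSelfAdjoint_integral measurable_sqrtFun conj_sqrtFun

/-- `J B` preserves the domain of `B`. -/
theorem J_B_mem (M : ModularPair H) (x : M.B.domain) : M.J (M.B x) ∈ M.B.domain := by
  have hm : Measurable fun l : ℝ => sqrtFun l⁻¹ := measurable_sqrtFun.comp measurable_inv
  -- The vector `B x` lies in the domain of `B⁻¹`, because the product of the two integrands is `1`
  -- almost everywhere; then `J` exchanges the domains of `B⁻¹` and `B`.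
  have h1 : MemLp (fun l : ℝ => sqrtFun l⁻¹) 2 (M.P.scalarMeasure (M.B x)) := by
    refine (M.P.memLp_vec_iff measurable_sqrtFun hm x.2).2 ?_
    refine (memLp_const (1 : ℂ)).congr_norm (hm.mul measurable_sqrtFun).aestronglyMeasurable ?_
    filter_upwards [M.P.ae_pos M.null x] with l hl
    rw [Pi.mul_apply, sqrtFun_inv_mul hl]
  have h2 := M.memLp_comp_inv h1
  simp only [inv_inv, conj_sqrtFun] at h2
  exact h2

/-- `J B` is an involution. -/
theorem J_B_J_B (M : ModularPair H) (x : M.B.domain) : M.J (M.B ⟨_, M.J_B_mem x⟩) = x := by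
  have hm : Measurable fun l : ℝ => sqrtFun l⁻¹ := measurable_sqrtFun.comp measurable_inv
  have h0 : MemLp sqrtFun 2 (M.P.scalarMeasure (M.J (M.P.vec sqrtFun x))) := M.J_B_mem x
  change M.J (M.P.vec sqrtFun (M.J (M.P.vec sqrtFun x))) = x
  have h1 := M.memLp_comp_inv h0
  rw [M.J_vec h0, M.involutive]
  rw [M.involutive] at h1
  simp only [conj_sqrtFun] at h1 ⊢
  have h2 := (M.P.memLp_vec_iff measurable_sqrtFun hm x.2).1 h1
  rw [M.P.vec_vec measurable_sqrtFun hm x.2 h2]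
  conv_rhs => rw [← M.P.vec_one (x : H)]
  refine M.P.vec_congr ?_
  filter_upwards [M.P.ae_pos M.null x] with l hl
  rw [Pi.mul_apply, sqrtFun_inv_mul hl, Pi.one_apply]

end ModularPair

/-! ### The resolvent at `-1` and conjugation by an antiunitary -/

/-- The function `(1 + |l|)⁻¹`. -/
noncomputable def oneAddInv (l : ℝ) : ℂ := (((1 + |l|)⁻¹ : ℝ) : ℂ)

theorem bddMeas_oneAddInv : BddMeas oneAddInv := by
  refine ⟨by unfold oneAddInv; fun_prop, 1, fun l => ?_⟩
  rw [oneAddInv, Complex.norm_real, Real.norm_of_nonneg (by positivity)]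
  exact inv_le_one_of_one_le₀ (by linarith [abs_nonneg l])

theorem bddMeas_ofReal_mul_oneAddInv : BddMeas ((fun l : ℝ => (l : ℂ)) * oneAddInv) := by
  refine ⟨Complex.measurable_ofReal.mul bddMeas_oneAddInv.measurable, 1, fun l => ?_⟩
  rw [Pi.mul_apply, oneAddInv, ← Complex.ofReal_mul, Complex.norm_real, norm_mul, norm_inv,
    Real.norm_eq_abs, Real.norm_of_nonneg (by positivity : 0 ≤ 1 + |l|),
    ← div_eq_mul_inv, div_le_one (by positivity)]
  linarith

theorem bddMeas_sqrtFun_mul_oneAddInv : BddMeas (sqrtFun * oneAddInv) := by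
  refine ⟨measurable_sqrtFun.mul bddMeas_oneAddInv.measurable, 1, fun l => ?_⟩
  rw [Pi.mul_apply, oneAddInv, sqrtFun, ← Complex.ofReal_mul, Complex.norm_real, norm_mul, norm_inv,
    Real.norm_of_nonneg (Real.sqrt_nonneg l), Real.norm_of_nonneg (by positivity : 0 ≤ 1 + |l|),
    ← div_eq_mul_inv, div_le_one (by positivity), Real.sqrt_le_left (by positivity)]
  nlinarith [abs_nonneg l, le_abs_self l]

theorem oneAddInv_add {l : ℝ} (hl : 0 < l) : oneAddInv l + l * oneAddInv l = 1 := by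
  rw [oneAddInv, ← Complex.ofReal_mul, ← Complex.ofReal_add, abs_of_pos hl, ← Complex.ofReal_one]
  congr 1
  field_simp

theorem oneAddInv_inv {l : ℝ} (hl : 0 < l) : oneAddInv l⁻¹ = 1 - oneAddInv l := by
  rw [oneAddInv, oneAddInv, ← Complex.ofReal_one, ← Complex.ofReal_sub,
    abs_of_pos hl, abs_of_pos (inv_pos.2 hl)]
  congr 1
  field_simp
  ring

theorem sqrtFun_mul_oneAddInv_inv {l : ℝ} (hl : 0 < l) :
    sqrtFun l⁻¹ * oneAddInv l⁻¹ = sqrtFun l * oneAddInv l := by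
  rw [oneAddInv_inv hl, ← oneAddInv_add hl, add_sub_cancel_left, ← mul_assoc]
  congr 1
  rw [← sqrtFun_mul_self hl.le, ← mul_assoc, sqrtFun_inv_mul hl, one_mul]

/-- The scalar form of `C² = T - T²` for `T = (1 + Δ)⁻¹` and `C = Δ^{1/2} (1 + Δ)⁻¹`. -/
theorem sqrtFun_mul_oneAddInv_sq {l : ℝ} (hl : 0 < l) :
    (sqrtFun l * oneAddInv l) * (sqrtFun l * oneAddInv l) =
      oneAddInv l - oneAddInv l * oneAddInv l := by
  have h := sqrtFun_mul_self hl.le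
  linear_combination oneAddInv l * oneAddInv l * h + oneAddInv l * oneAddInv_add hl

namespace SpectralMeasure

variable {H : Type*} [NormedAddCommGroup H] [InnerProductSpace ℂ H] [CompleteSpace H]

/-- The graph of a positive operator in terms of its resolvent at `-1`. -/
theorem mem_graph_integral_iff (P : SpectralMeasure H) (hP : P.proj (Set.Iic 0) = 0) (x y : H) :
    (x, y) ∈ (P.integral fun l => (l : ℂ)).graph ↔ x = P.bop oneAddInv (x + y) := by
  have br := bddMeas_oneAddInv
  have bl := bddMeas_ofReal_mul_oneAddInv
  rw [LinearPMap.mem_graph_iff]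
  constructor
  · rintro ⟨x, rfl, rfl⟩
    have hx : MemLp (fun l : ℝ => (l : ℂ)) 2 (P.scalarMeasure (x : H)) := x.2
    have h1 : (x : H) + P.integral (fun l => (l : ℂ)) x =
        P.vec (1 + fun l : ℝ => (l : ℂ)) x := by
      rw [P.vec_add_fun (BddMeas.one.memLp _) hx, P.vec_one]; rfl
    have hm : Measurable (1 + fun l : ℝ => (l : ℂ)) :=
      measurable_const.add Complex.measurable_ofReal
    have hL : MemLp (1 + fun l : ℝ => (l : ℂ)) 2 (P.scalarMeasure (x : H)) :=
      (BddMeas.one.memLp _).add hx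
    have hae : (1 : ℝ → ℂ) =ᵐ[P.scalarMeasure (x : H)]
        oneAddInv * (1 + fun l : ℝ => (l : ℂ)) := by
      filter_upwards [P.ae_pos hP x] with l hl
      rw [Pi.one_apply, ← oneAddInv_add hl, Pi.mul_apply, Pi.add_apply, Pi.one_apply]
      ring
    rw [h1, P.bop_apply br, P.vec_vec hm br.measurable hL
      ((memLp_congr_ae hae).1 (BddMeas.one.memLp _)), ← P.vec_congr hae, P.vec_one]
  · intro hx
    set u := x + y with hu
    rw [P.bop_apply br] at hx
    have hd : x ∈ (P.integral fun l => (l : ℂ)).domain := by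
      rw [hx]
      exact (P.memLp_vec_iff br.measurable Complex.measurable_ofReal (br.memLp _)).2 (bl.memLp _)
    refine ⟨⟨x, hd⟩, rfl, ?_⟩
    rw [P.integral_apply]
    have h1 : x + P.vec (fun l => (l : ℂ)) x = u := by
      conv_lhs => rw [hx]
      rw [P.vec_vec br.measurable Complex.measurable_ofReal (br.memLp _) (bl.memLp _),
        ← P.vec_add_fun (br.memLp _) (bl.memLp _)]
      conv_rhs => rw [← P.vec_one u]
      refine P.vec_congr ?_
      filter_upwards [P.ae_pos hP u] with l hl using oneAddInv_add hl
    exact add_left_cancel (h1.trans hu)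

/-- Two strictly positive operators with the same resolvent at `-1` have the same spectral
measure. -/
theorem scalarMeasure_eq_of_bop_oneAddInv {P Q : SpectralMeasure H} (hP : P.proj (Set.Iic 0) = 0)
    (hQ : Q.proj (Set.Iic 0) = 0) (h : P.bop oneAddInv = Q.bop oneAddInv) (x : H) :
    P.scalarMeasure x = Q.scalarMeasure x := by
  have h1 : (P.integral fun l => (l : ℂ)) = Q.integral fun l => (l : ℂ) := by
    refine LinearPMap.eq_of_eq_graph ?_
    ext ⟨x, y⟩
    rw [P.mem_graph_integral_iff hP, Q.mem_graph_integral_iff hQ, h]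
  have h2 := Q.isIntegral_integral Complex.measurable_ofReal
  rw [← h1] at h2
  exact scalarMeasure_eq_of_isIntegral (P.isIntegral_integral Complex.measurable_ofReal) h2 x

theorem bop_sqrtFun_mul_oneAddInv_sq (P : SpectralMeasure H) (hP : P.proj (Set.Iic 0) = 0) (x : H) :
    P.bop (sqrtFun * oneAddInv) (P.bop (sqrtFun * oneAddInv) x) =
      P.bop oneAddInv x - P.bop oneAddInv (P.bop oneAddInv x) := by
  have br := bddMeas_oneAddInv
  have bc := bddMeas_sqrtFun_mul_oneAddInv
  rw [← mul_apply_eq_comp, ← mul_apply_eq_comp, P.bop_mul bc bc, P.bop_mul br br, eq_sub_iff_add_eq,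
    P.bop_apply (bc.mul bc), P.bop_apply (br.mul br), P.bop_apply br,
    ← P.vec_add_fun ((bc.mul bc).memLp _) ((br.mul br).memLp _)]
  refine P.vec_congr ?_
  filter_upwards [P.ae_pos hP x] with l hl
  simp only [Pi.add_apply, Pi.mul_apply]
  rw [sqrtFun_mul_oneAddInv_sq hl, sub_add_cancel]

/-- The bounded linear operator `J⁻¹ A J` for an antiunitary `J`. -/
noncomputable def _root_.LinearIsometryEquiv.conjBy (J : H ≃ₗᵢ[ℝ] H)
    (hJ : ∀ (c : ℂ) (x : H), J (c • x) = conj c • J x) (A : H →L[ℂ] H) : H →L[ℂ] H :=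
  LinearMap.mkContinuous ⟨⟨fun x => J.symm (A (J x)), fun x y => by simp only [map_add]⟩,
    fun c x => by
      change J.symm (A (J (c • x))) = c • J.symm (A (J x))
      rw [LinearIsometryEquiv.symm_apply_eq, hJ, hJ, map_smul, J.apply_symm_apply]⟩
    ‖A‖ fun x => by
      change ‖J.symm (A (J x))‖ ≤ _
      rw [J.symm.norm_map]
      exact (A.le_opNorm _).trans_eq (by rw [J.norm_map])

theorem _root_.LinearIsometryEquiv.conjBy_apply (J : H ≃ₗᵢ[ℝ] H)
    (hJ : ∀ (c : ℂ) (x : H), J (c • x) = conj c • J x) (A : H →L[ℂ] H) (x : H) :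
    J.conjBy hJ A x = J.symm (A (J x)) := rfl

theorem _root_.LinearIsometryEquiv.inner_conjBy (J : H ≃ₗᵢ[ℝ] H)
    (hJ : ∀ (c : ℂ) (x : H), J (c • x) = conj c • J x) (A : H →L[ℂ] H) (x y : H) :
    ⟪x, J.conjBy hJ A y⟫ = ⟪A (J y), J x⟫ := by
  rw [J.conjBy_apply, ← LinearIsometryEquiv.inner_map_antilinear hJ, J.apply_symm_apply]

/-- The spectral measure `J⁻¹ P J` for an antiunitary `J`. -/
noncomputable def conjBy (P : SpectralMeasure H) (J : H ≃ₗᵢ[ℝ] H)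
    (hJ : ∀ (c : ℂ) (x : H), J (c • x) = conj c • J x) : SpectralMeasure H where
  proj s := J.conjBy hJ (P.proj s)
  isStarProjection s hs := by
    have hp := P.isStarProjection s hs
    constructor
    · ext x
      rw [mul_apply_eq_comp, J.conjBy_apply, J.conjBy_apply, J.apply_symm_apply,
        ← mul_apply_eq_comp (P.proj s), hp.isIdempotentElem.eq]
    · refine ContinuousLinearMap.ext fun x => ext_inner_left ℂ fun y => ?_
      have h2 : ContinuousLinearMap.adjoint (P.proj s) = P.proj s := hp.isSelfAdjoint
      rw [ContinuousLinearMap.star_eq_adjoint, ContinuousLinearMap.adjoint_inner_right,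
        J.inner_conjBy, ← inner_conj_symm, J.inner_conjBy, inner_conj_symm]
      conv_rhs => rw [← h2, ContinuousLinearMap.adjoint_inner_left]
  proj_univ := by
    ext x
    rw [P.proj_univ, J.conjBy_apply, one_apply_eq_self, J.symm_apply_apply, one_apply_eq_self]
  hasSum_iUnion f hf hd x :=
    (P.hasSum_iUnion f hf hd (J x)).map J.symm.toLinearEquiv J.symm.continuous

theorem scalarMeasure_conjBy (P : SpectralMeasure H) (J : H ≃ₗᵢ[ℝ] H)
    (hJ : ∀ (c : ℂ) (x : H), J (c • x) = conj c • J x) (x : H) :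
    (P.conjBy J hJ).scalarMeasure x = P.scalarMeasure (J x) := by
  ext s hs
  rw [P.scalarMeasure_apply _ hs, scalarMeasure_apply _ _ hs]
  change ENNReal.ofReal (‖J.symm (P.proj s (J x))‖ ^ 2) = _
  rw [J.symm.norm_map]

end SpectralMeasure

theorem StandardSubspace.mem_mulI_iff {H : Type*} [NormedAddCommGroup H] [InnerProductSpace ℂ H]
    {V : ClosedSubmodule ℝ H} {x : H} : x ∈ V.mulI ↔ ∃ y ∈ V, x = Complex.I • y := by
  constructor
  · intro h
    rw [ClosedSubmodule.mem_mapEquiv_iff] at h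
    refine ⟨_, h, ?_⟩
    change x = scalarSMulCLE H Complex.UnitI _
    rw [ContinuousLinearEquiv.apply_symm_apply]
  · rintro ⟨y, hy, rfl⟩
    exact (ClosedSubmodule.mem_mapEquiv_iff' (scalarSMulCLE H Complex.UnitI) V y).2 hy

/-! ### The standard subspace of a modular pair -/

namespace ModularPair

variable {H : Type*} [NormedAddCommGroup H] [InnerProductSpace ℂ H] [CompleteSpace H]

/-- The closed real subspace `Fix (J B)`. -/
noncomputable def fixSpace (M : ModularPair H) : ClosedSubmodule ℝ H where
  -- As `J` is an involution, `J B x = x` is the same as `B x = J x`. In this form closedness is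
  -- inherited from the graph of the selfadjoint `B`.
  carrier := {x | (x, M.J x) ∈ M.B.graph}
  add_mem' {x y} hx hy := by
    have := M.B.graph.add_mem hx hy
    simpa using this
  zero_mem' := by
    change (0, M.J 0) ∈ M.B.graph
    rw [map_zero]
    exact M.B.graph.zero_mem
  smul_mem' c x hx := by
    have := M.B.graph.smul_mem (c : ℂ) hx
    simpa using this
  isClosed' := M.isSelfAdjoint_B.isClosed.preimage
    (continuous_id.prodMk M.J.continuous)

theorem mem_fixSpace (M : ModularPair H) {x : H} :
    x ∈ M.fixSpace ↔ ∃ y : M.B.domain, (y : H) = x ∧ M.J (M.B y) = x := by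
  change (x, M.J x) ∈ M.B.graph ↔ _
  rw [LinearPMap.mem_graph_iff]
  refine exists_congr fun y => and_congr_right fun _ => ?_
  simp only
  constructor
  · intro h; rw [h, M.involutive]
  · intro h; rw [← h, M.involutive]

/-- For `S = J B` with `S² = 1`, the vector `x + S x` is fixed. The vector `x - S x` changes sign,
and multiplying it by `-i` makes it fixed because `S` is antilinear. Together they split `x` into
its `V` and `iV` parts. -/
theorem half_add_mem (M : ModularPair H) (x : M.B.domain) :
    (2⁻¹ : ℂ) • ((x : H) + M.J (M.B x)) ∈ M.fixSpace := by
  refine M.mem_fixSpace.2 ⟨(2⁻¹ : ℂ) • (x + ⟨_, M.J_B_mem x⟩), rfl, ?_⟩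
  rw [LinearPMap.map_smul, LinearPMap.map_add, M.antilinear, map_add, M.J_B_J_B]
  rw [map_inv₀, Complex.conj_ofNat, add_comm]

theorem half_sub_mem (M : ModularPair H) (x : M.B.domain) :
    (-Complex.I * 2⁻¹ : ℂ) • ((x : H) - M.J (M.B x)) ∈ M.fixSpace := by
  refine M.mem_fixSpace.2 ⟨(-Complex.I * 2⁻¹ : ℂ) • (x - ⟨_, M.J_B_mem x⟩), rfl, ?_⟩
  rw [LinearPMap.map_smul, LinearPMap.map_sub, M.antilinear, map_sub, M.J_B_J_B,
    ← neg_sub, smul_neg, ← neg_smul]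
  congr 1
  simp [Complex.conj_ofNat]

theorem eq_half_add_half (M : ModularPair H) (x : M.B.domain) :
    (x : H) = (2⁻¹ : ℂ) • ((x : H) + M.J (M.B x)) +
      Complex.I • (-Complex.I * 2⁻¹ : ℂ) • ((x : H) - M.J (M.B x)) := by
  rw [smul_smul, ← mul_assoc, mul_neg, Complex.I_mul_I]
  module

/-- The standard subspace of a modular pair. -/
noncomputable def standard (M : ModularPair H) : StandardSubspace H where
  toClosedSubmodule := M.fixSpace
  IsSeparating := by
    rw [eq_bot_iff]
    rintro x ⟨hx, hx'⟩
    obtain ⟨y, hy, rfl⟩ := StandardSubspace.mem_mulI_iff.1 hx'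
    change (Complex.I • y, M.J (Complex.I • y)) ∈ M.B.graph at hx
    have h1 := M.B.graph.smul_mem Complex.I (show (y, M.J y) ∈ M.B.graph from hy)
    -- Linearity of `B` gives `B (i y) = i J y`, while `i y` being fixed gives `B (i y) = J (i y) =
    -- -i J y`.
    have h2 := LinearPMap.graph_fst_eq_zero_snd M.B (M.B.graph.sub_mem h1 hx) (by simp)
    simp only [M.antilinear, Complex.conj_I, Prod.smul_snd] at h2
    have h3 : (2 * Complex.I) • M.J y = 0 := by rw [← h2]; module
    have h4 : M.J y = 0 := (smul_eq_zero.1 h3).resolve_left (by simp)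
    have h5 : y = 0 := by simpa using h4
    rw [h5, smul_zero]
    rfl
  IsCyclic := by
    rw [eq_top_iff]
    intro x _
    rw [ClosedSubmodule.mem_sup]
    refine closure_mono ?_ (M.isSelfAdjoint_B.dense_domain x)
    intro z hz
    refine Submodule.mem_sup.2 ⟨_, M.half_add_mem ⟨z, hz⟩, _,
      StandardSubspace.mem_mulI_iff.2 ⟨_, M.half_sub_mem ⟨z, hz⟩, rfl⟩, ?_⟩
    exact (M.eq_half_add_half ⟨z, hz⟩).symm

theorem domain_tomita_standard (M : ModularPair H) : M.standard.tomita.domain = M.B.domain := by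
  ext x
  constructor
  · rintro ⟨v, hv, w, hw, rfl⟩
    obtain ⟨v', rfl, -⟩ := M.mem_fixSpace.1 hv
    obtain ⟨w', rfl, -⟩ := M.mem_fixSpace.1 hw
    exact M.B.domain.add_mem v'.2 (M.B.domain.smul_mem _ w'.2)
  · intro hx
    exact ⟨_, M.half_add_mem ⟨x, hx⟩, _, M.half_sub_mem ⟨x, hx⟩, M.eq_half_add_half ⟨x, hx⟩⟩

theorem tomita_standard_apply (M : ModularPair H) (x : M.standard.tomita.domain)
    (y : M.B.domain) (h : (x : H) = y) : M.standard.tomita x = M.J (M.B y) := by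
  rw [M.standard.tomita_apply x (M.half_add_mem y) (M.half_sub_mem y)
    (h.trans (M.eq_half_add_half y)), smul_smul, ← mul_assoc, mul_neg, Complex.I_mul_I]
  module

theorem memLp_sqrtFun {ν : Measure ℝ} [IsFiniteMeasure ν] (hν : ∀ᵐ l ∂ν, 0 < l)
    (h : MemLp (fun l : ℝ => (l : ℂ)) 2 ν) : MemLp sqrtFun 2 ν := by
  refine ((memLp_const (1 : ℝ)).add h.norm).mono' measurable_sqrtFun.aestronglyMeasurable ?_
  filter_upwards [hν] with l hl
  simp only [sqrtFun, Complex.norm_real, Real.norm_of_nonneg (Real.sqrt_nonneg l), Pi.add_apply,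
    Real.norm_of_nonneg hl.le]
  rw [Real.sqrt_le_left (by positivity)]
  nlinarith

theorem mem_B_of_mem_D (M : ModularPair H) {x : H} (hx : x ∈ M.D.domain) : x ∈ M.B.domain :=
  memLp_sqrtFun (M.P.ae_pos M.null x) hx

theorem inner_B_B (M : ModularPair H) (x : M.D.domain) (z : M.B.domain) :
    ⟪M.B ⟨x, M.mem_B_of_mem_D x.2⟩, M.B z⟫ = ⟪M.D x, (z : H)⟫ := by
  have hx : MemLp sqrtFun 2 (M.P.scalarMeasure (x : H)) := M.mem_B_of_mem_D x.2
  have hae : (sqrtFun * sqrtFun) =ᵐ[M.P.scalarMeasure (x : H)] fun l => (l : ℂ) := by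
    filter_upwards [M.P.ae_pos M.null x] with l hl using sqrtFun_mul_self hl.le
  have hxx : MemLp (sqrtFun * sqrtFun) 2 (M.P.scalarMeasure (x : H)) :=
    (memLp_congr_ae hae).2 x.2
  have h2 := (M.P.memLp_vec_iff measurable_sqrtFun measurable_sqrtFun hx).2 hxx
  change ⟪M.P.vec sqrtFun x, M.P.vec sqrtFun z⟫ = ⟪M.P.vec (fun l => (l : ℂ)) x, (z : H)⟫
  rw [← M.P.vec_congr hae, ← M.P.vec_vec measurable_sqrtFun measurable_sqrtFun hx hxx,
    M.P.inner_vec_left h2 z.2]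
  simp only [conj_sqrtFun]

/-- `1 + D` is surjective. -/
theorem exists_add_D (M : ModularPair H) (y : H) : ∃ x : M.D.domain, (x : H) + M.D x = y := by
  have h := (M.P.mem_graph_integral_iff M.null (M.P.bop oneAddInv y)
    (y - M.P.bop oneAddInv y)).2 (by rw [add_sub_cancel])
  obtain ⟨x, hx, hDx⟩ := (LinearPMap.mem_graph_iff _).1 h
  refine ⟨x, ?_⟩
  change (x : H) + M.P.integral (fun l => (l : ℂ)) x = y
  rw [hDx, hx, add_sub_cancel]

/-- Since `J` reverses inner products, the form of `S* S` is `⟪B x, B z⟫`, which is `⟪D x, z⟫` on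
the domain of `D`. So `S* S` extends `D`; equality follows because `1 + D` is already surjective
while `1 + S* S` is injective by positivity. -/
theorem modularOperator_standard (M : ModularPair H) : M.standard.modularOperator = M.D := by
  refine LinearPMap.eq_of_eq_graph ?_
  rw [StandardSubspace.graph_modularOperator]
  have hS : ∀ x z : M.B.domain, ⟪M.J (M.B z), M.J (M.B x)⟫ = ⟪M.B x, M.B z⟫ := fun x z =>
    M.inner_J _ _
  have hT : ∀ x : M.standard.tomita.domain, ∃ hx : (x : H) ∈ M.B.domain,
      M.standard.tomita x = M.J (M.B ⟨x, hx⟩) := fun x =>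
    ⟨by rw [← M.domain_tomita_standard]; exact x.2, M.tomita_standard_apply x _ rfl⟩
  have hB : ∀ x : M.B.domain, (x : H) ∈ M.standard.tomita.domain := fun x => by
    rw [M.domain_tomita_standard]; exact x.2
  ext ⟨x, y⟩
  rw [LinearPMap.mem_graph_iff]
  constructor
  · rintro ⟨x, rfl, h⟩
    obtain ⟨hx, hxS⟩ := hT x
    have h1 : ∀ z : M.B.domain, ⟪M.B ⟨x, hx⟩, M.B z⟫ = ⟪y, (z : H)⟫ := fun z => by
      have h2 := h ⟨z, hB z⟩
      rw [hxS, M.tomita_standard_apply _ z rfl, hS] at h2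
      exact h2
    -- Testing the equation for `x - x'` against itself gives `‖B (x - x')‖² = -‖x - x'‖²`, so `x =
    -- x'`.
    obtain ⟨x', hx'⟩ := M.exists_add_D ((x : H) + y)
    have h3 : ∀ z : M.B.domain,
        ⟪M.B (⟨x, hx⟩ - ⟨x', M.mem_B_of_mem_D x'.2⟩), M.B z⟫ =
          -⟪(x : H) - (x' : H), (z : H)⟫ := fun z => by
      rw [LinearPMap.map_sub, inner_sub_left, h1, M.inner_B_B, eq_sub_of_add_eq' hx',
        inner_sub_left, inner_sub_left, inner_add_left]
      ring
    have h4 := congrArg Complex.re (h3 (⟨x, hx⟩ - ⟨x', M.mem_B_of_mem_D x'.2⟩))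
    have h5 : ∀ w : H, (⟪w, w⟫ : ℂ).re = ‖w‖ ^ 2 := fun w => inner_self_eq_norm_sq (𝕜 := ℂ) w
    rw [Complex.neg_re, h5] at h4
    have h6 : (⟪(x : H) - (x' : H), (x : H) - (x' : H)⟫ : ℂ).re = 0 := by
      have h7 := h5 ((x : H) - (x' : H))
      have h8 : 0 ≤ ‖M.B (⟨x, hx⟩ - ⟨x', M.mem_B_of_mem_D x'.2⟩)‖ ^ 2 := by positivity
      have h9 : 0 ≤ ‖(x : H) - (x' : H)‖ ^ 2 := by positivity
      rw [h4] at h8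
      rw [← h7] at h9
      exact le_antisymm (by simpa using h8) h9
    rw [h5] at h6
    have h7 : (x : H) = x' := sub_eq_zero.1 (by simpa using h6)
    refine ⟨x', h7.symm, ?_⟩
    rw [← h7] at hx'
    exact add_left_cancel hx'
  · rintro ⟨x', hx', hy⟩
    simp only at hx' hy
    refine ⟨⟨x', hB ⟨x', M.mem_B_of_mem_D x'.2⟩⟩, hx', fun z => ?_⟩
    obtain ⟨hz, hzS⟩ := hT z
    rw [hzS, M.tomita_standard_apply _ ⟨x', M.mem_B_of_mem_D x'.2⟩ rfl, hS, M.inner_B_B, hy]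

theorem isModularConjugation_standard (M : ModularPair H) :
    M.standard.IsModularConjugation M.J where
  antilinear := M.antilinear
  polar := ⟨M.B, by rw [M.modularOperator_standard]; exact M.isCPow_B, M.domain_tomita_standard,
    fun x y h => M.tomita_standard_apply x y h⟩

end ModularPair

/-! ### Real projections onto `V` and `iV` -/

theorem re_inner_comm {H : Type*} [NormedAddCommGroup H] [InnerProductSpace ℂ H] (x y : H) :
    (⟪x, y⟫ : ℂ).re = (⟪y, x⟫ : ℂ).re := by rw [← inner_conj_symm, Complex.conj_re]

theorem re_inner_I_smul_left {H : Type*} [NormedAddCommGroup H] [InnerProductSpace ℂ H] (x y : H) :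
    (⟪Complex.I • x, y⟫ : ℂ).re = (⟪x, -Complex.I • y⟫ : ℂ).re := by
  rw [inner_smul_left, inner_smul_right, Complex.conj_I]

section RealProjection

open ClosedSubmodule

theorem ClosedSubmodule.exists_realProj {H : Type*} [NormedAddCommGroup H] [InnerProductSpace ℂ H]
    [CompleteSpace H] (V : ClosedSubmodule ℝ H) :
    ∃ p : H →ₗ[ℝ] H, (∀ y, p y ∈ V) ∧ (∀ y, ‖p y‖ ≤ ‖y‖) ∧
      ∀ a ∈ V, ∀ y, (⟪a, p y⟫ : ℂ).re = (⟪a, y⟫ : ℂ).re := by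
  have : CompleteSpace V.toSubmodule := V.isClosed'.completeSpace_coe
  refine ⟨V.toSubmodule.starProjection.toLinearMap,
    fun y => V.toSubmodule.starProjection_apply_mem y,
    fun y => V.toSubmodule.norm_starProjection_apply_le y, fun a ha y => ?_⟩
  have h := V.toSubmodule.starProjection_inner_eq_zero y a ha
  rw [real_inner_comm] at h
  change (⟪a, y - V.toSubmodule.starProjection y⟫ : ℂ).re = 0 at h
  rw [inner_sub_right, Complex.sub_re] at h
  change (⟪a, V.toSubmodule.starProjection y⟫ : ℂ).re = _
  linarith

end RealProjection

namespace StandardSubspace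

variable {H : Type*} [NormedAddCommGroup H] [InnerProductSpace ℂ H] [CompleteSpace H]

/-- The real orthogonal projection onto `V`. -/
noncomputable def realProj (V : StandardSubspace H) : H →ₗ[ℝ] H :=
  V.toClosedSubmodule.exists_realProj.choose

theorem realProj_mem (V : StandardSubspace H) (y : H) : V.realProj y ∈ V.toClosedSubmodule :=
  V.toClosedSubmodule.exists_realProj.choose_spec.1 y

theorem norm_realProj_le (V : StandardSubspace H) (y : H) : ‖V.realProj y‖ ≤ ‖y‖ :=
  V.toClosedSubmodule.exists_realProj.choose_spec.2.1 y

theorem re_inner_realProj (V : StandardSubspace H) {a : H} (ha : a ∈ V.toClosedSubmodule) (y : H) :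
    (⟪a, V.realProj y⟫ : ℂ).re = (⟪a, y⟫ : ℂ).re :=
  V.toClosedSubmodule.exists_realProj.choose_spec.2.2 a ha y

theorem realProj_eq (V : StandardSubspace H) {v y : H} (hv : v ∈ V.toClosedSubmodule)
    (h : ∀ a ∈ V.toClosedSubmodule, (⟪a, v⟫ : ℂ).re = (⟪a, y⟫ : ℂ).re) : V.realProj y = v := by
  have hm : V.realProj y - v ∈ V.toClosedSubmodule :=
    V.toClosedSubmodule.toSubmodule.sub_mem (V.realProj_mem y) hv
  have h2 : (⟪V.realProj y - v, V.realProj y - v⟫ : ℂ).re = 0 := by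
    conv_lhs => rw [inner_sub_right, Complex.sub_re]
    rw [V.re_inner_realProj hm, h _ hm, sub_self]
  have h3 : ‖V.realProj y - v‖ ^ 2 = 0 := by
    rw [← h2]; exact (inner_self_eq_norm_sq (𝕜 := ℂ) _).symm
  exact sub_eq_zero.1 (by simpa using h3)

theorem realProj_of_mem (V : StandardSubspace H) {v : H} (hv : v ∈ V.toClosedSubmodule) :
    V.realProj v = v := V.realProj_eq hv fun _ _ => rfl

theorem mem_iff_realProj (V : StandardSubspace H) {v : H} :
    v ∈ V.toClosedSubmodule ↔ V.realProj v = v :=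
  ⟨V.realProj_of_mem, fun h => h ▸ V.realProj_mem v⟩

theorem re_inner_realProj_left (V : StandardSubspace H) (x y : H) :
    (⟪V.realProj x, y⟫ : ℂ).re = (⟪x, V.realProj y⟫ : ℂ).re := by
  rw [← V.re_inner_realProj (V.realProj_mem x), re_inner_comm,
    V.re_inner_realProj (V.realProj_mem y), re_inner_comm]

/-- The real orthogonal projection onto `iV`. -/
noncomputable def realProjI (V : StandardSubspace H) (y : H) : H :=
  Complex.I • V.realProj (-Complex.I • y)

theorem realProjI_add (V : StandardSubspace H) (x y : H) :
    V.realProjI (x + y) = V.realProjI x + V.realProjI y := by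
  simp only [realProjI, smul_add, map_add]

theorem realProjI_sub (V : StandardSubspace H) (x y : H) :
    V.realProjI (x - y) = V.realProjI x - V.realProjI y := by
  simp only [realProjI, smul_sub, map_sub]

theorem realProjI_real_smul (V : StandardSubspace H) (c : ℝ) (x : H) :
    V.realProjI (c • x) = c • V.realProjI x := by
  simp only [realProjI]
  rw [smul_comm _ c, map_smul, smul_comm]

theorem realProjI_realProjI (V : StandardSubspace H) (x : H) :
    V.realProjI (V.realProjI x) = V.realProjI x := by
  simp only [realProjI, smul_smul, neg_mul, Complex.I_mul_I, neg_neg, one_smul]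
  rw [V.realProj_of_mem (V.realProj_mem _)]

theorem re_inner_realProjI_left (V : StandardSubspace H) (x y : H) :
    (⟪V.realProjI x, y⟫ : ℂ).re = (⟪x, V.realProjI y⟫ : ℂ).re := by
  rw [realProjI, re_inner_I_smul_left, re_inner_realProj_left, realProjI, re_inner_comm x,
    re_inner_I_smul_left, re_inner_comm]

/-- Multiplication by `i` exchanges `V` and `iV`. Hence the sum of the two projections is complex
linear and their difference antilinear. -/
theorem realProj_I_smul (V : StandardSubspace H) (y : H) :
    V.realProj (Complex.I • y) = Complex.I • V.realProjI y := by
  rw [realProjI, smul_smul, Complex.I_mul_I, neg_smul Complex.I y, map_neg, neg_smul, one_smul, neg_neg]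

theorem realProjI_I_smul (V : StandardSubspace H) (y : H) :
    V.realProjI (Complex.I • y) = Complex.I • V.realProj y := by
  rw [realProjI, smul_smul, neg_mul, Complex.I_mul_I, neg_neg, one_smul]

/-- Such an `x` is real-orthogonal to `V + iV`, which is dense. -/
theorem eq_zero_of_realProj (V : StandardSubspace H) {x : H} (h : V.realProj x = 0)
    (h' : V.realProjI x = 0) : x = 0 := by
  have h1 : ∀ z ∈ (V.tomita.domain : Set H), (⟪z, x⟫ : ℂ).re = 0 := by
    rintro _ ⟨v, hv, w, hw, rfl⟩
    rw [inner_add_left, Complex.add_re, ← V.re_inner_realProj hv, h, re_inner_I_smul_left,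
      ← V.re_inner_realProj hw]
    have h2 : V.realProj (-Complex.I • x) = 0 :=
      (smul_eq_zero.1 h').resolve_left Complex.I_ne_zero
    rw [h2, inner_zero_right, inner_zero_right, Complex.zero_re, add_zero]
  have h2 : (⟪x, x⟫ : ℂ).re = 0 := by
    have hc : IsClosed {z : H | (⟪z, x⟫ : ℂ).re = 0} :=
      isClosed_eq (by fun_prop) continuous_const
    exact hc.closure_subset_iff.2 h1 (V.dense_tomita_domain x)
  have h3 : ‖x‖ ^ 2 = 0 := by
    rw [← h2]; exact (inner_self_eq_norm_sq (𝕜 := ℂ) _).symm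
  simpa using h3

/-- The common vector lies in `V ∩ iV = 0`, so both projections of `x` vanish. -/
theorem realProj_eq_zero_of_eq (V : StandardSubspace H) {x : H} {c : ℝ} (hc : c ≠ 0)
    (h : V.realProj x = c • V.realProjI x) : x = 0 := by
  have h1 := V.add_I_smul_injective (V.realProj_mem x) V.toClosedSubmodule.toSubmodule.zero_mem
    V.toClosedSubmodule.toSubmodule.zero_mem
    (V.toClosedSubmodule.toSubmodule.smul_mem c (V.realProj_mem (-Complex.I • x)))
    (by rw [smul_zero, add_zero, zero_add, h, realProjI, smul_comm])
  refine V.eq_zero_of_realProj h1.1 ?_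
  rw [h1.1] at h
  exact (smul_eq_zero.1 h.symm).resolve_left hc

/-- Half the sum of the real projections onto `V` and `iV`; it turns out to be `(1 + Δ)⁻¹`. -/
noncomputable def halfSum (V : StandardSubspace H) : H →L[ℂ] H :=
  LinearMap.mkContinuous
    { toFun := fun y => (2⁻¹ : ℂ) • (V.realProj y + V.realProjI y)
      map_add' := fun x y => by rw [map_add, realProjI_add]; module
      map_smul' := fun c x => by
        have h1 : c • x = c.re • x + c.im • (Complex.I • x) := by
          conv_lhs => rw [← Complex.re_add_im c]
          simp only [← Complex.coe_smul]
          module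
        rw [h1, map_add, realProjI_add, map_smul, map_smul, realProjI_real_smul,
          realProjI_real_smul, realProj_I_smul, realProjI_I_smul, RingHom.id_apply]
        conv_rhs => rw [← Complex.re_add_im c]
        simp only [← Complex.coe_smul]
        module } 1 fun y => by
    change ‖(2⁻¹ : ℂ) • (V.realProj y + V.realProjI y)‖ ≤ 1 * ‖y‖
    have h1 := V.norm_realProj_le y
    have h2 : ‖V.realProjI y‖ ≤ ‖y‖ := by
      rw [realProjI, norm_smul, Complex.norm_I, one_mul]
      refine (V.norm_realProj_le _).trans ?_
      rw [norm_smul, norm_neg, Complex.norm_I, one_mul]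
    rw [norm_smul, norm_inv, RCLike.norm_ofNat, one_mul]
    have := norm_add_le (V.realProj y) (V.realProjI y)
    linarith

theorem halfSum_apply (V : StandardSubspace H) (y : H) :
    V.halfSum y = (2⁻¹ : ℂ) • (V.realProj y + V.realProjI y) := rfl

/-- Half the difference of the real projections onto `V` and `iV`. -/
noncomputable def halfDiff (V : StandardSubspace H) : H →ₛₗ[starRingEnd ℂ] H where
  toFun y := (2⁻¹ : ℂ) • (V.realProj y - V.realProjI y)
  map_add' x y := by rw [map_add, realProjI_add]; module
  map_smul' c x := by
    have h1 : c • x = c.re • x + c.im • (Complex.I • x) := by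
      conv_lhs => rw [← Complex.re_add_im c]
      simp only [← Complex.coe_smul]
      module
    have hc : conj c = (c.re : ℂ) - c.im * Complex.I := by
      apply Complex.ext <;> simp
    rw [h1, map_add, realProjI_add, map_smul, map_smul, realProjI_real_smul,
      realProjI_real_smul, realProj_I_smul, realProjI_I_smul, hc]
    simp only [← Complex.coe_smul]
    module

theorem halfDiff_apply (V : StandardSubspace H) (y : H) :
    V.halfDiff y = (2⁻¹ : ℂ) • (V.realProj y - V.realProjI y) := rfl

theorem halfSum_add_halfDiff (V : StandardSubspace H) (y : H) :
    V.halfSum y + V.halfDiff y = V.realProj y := by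
  rw [halfSum_apply, halfDiff_apply]; module

theorem re_inner_two_inv_smul (x y : H) :
    (⟪(2⁻¹ : ℂ) • x, y⟫ : ℂ).re = 2⁻¹ * (⟪x, y⟫ : ℂ).re := by
  have h : conj (2⁻¹ : ℂ) = ((2⁻¹ : ℝ) : ℂ) := by
    rw [map_inv₀, Complex.conj_ofNat]; push_cast; rfl
  rw [inner_smul_left, h, Complex.re_ofReal_mul]

theorem re_inner_halfSum (V : StandardSubspace H) (x y : H) :
    (⟪V.halfSum x, y⟫ : ℂ).re = (⟪x, V.halfSum y⟫ : ℂ).re := by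
  rw [re_inner_comm x, halfSum_apply, halfSum_apply, re_inner_two_inv_smul, re_inner_two_inv_smul,
    inner_add_left, inner_add_left, Complex.add_re, Complex.add_re, re_inner_realProj_left,
    re_inner_realProjI_left, re_inner_comm x, re_inner_comm x]

theorem re_inner_halfDiff (V : StandardSubspace H) (x y : H) :
    (⟪V.halfDiff x, y⟫ : ℂ).re = (⟪x, V.halfDiff y⟫ : ℂ).re := by
  rw [re_inner_comm x, halfDiff_apply, halfDiff_apply, re_inner_two_inv_smul,
    re_inner_two_inv_smul, inner_sub_left, inner_sub_left, Complex.sub_re, Complex.sub_re,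
    re_inner_realProj_left, re_inner_realProjI_left, re_inner_comm x, re_inner_comm x]

theorem inner_halfSum (V : StandardSubspace H) (x y : H) :
    ⟪V.halfSum x, y⟫ = ⟪x, V.halfSum y⟫ := by
  refine Complex.ext (V.re_inner_halfSum x y) ?_
  have h := V.re_inner_halfSum x (Complex.I • y)
  rw [map_smul, inner_smul_right, inner_smul_right] at h
  simpa using h

theorem realProj_two_inv_smul (V : StandardSubspace H) (x : H) :
    V.realProj ((2⁻¹ : ℂ) • x) = (2⁻¹ : ℂ) • V.realProj x := by
  have h : ∀ z : H, (2⁻¹ : ℂ) • z = (2⁻¹ : ℝ) • z := fun z => by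
    rw [← Complex.coe_smul]; push_cast; rfl
  rw [h, h, map_smul]

theorem realProjI_two_inv_smul (V : StandardSubspace H) (x : H) :
    V.realProjI ((2⁻¹ : ℂ) • x) = (2⁻¹ : ℂ) • V.realProjI x := by
  rw [realProjI, realProjI, smul_comm, realProj_two_inv_smul, smul_comm]

/-- With `p² = p` and `q² = q`, both sides are `(p + q - p q - q p)/4`. -/
theorem halfDiff_halfDiff (V : StandardSubspace H) (x : H) :
    V.halfDiff (V.halfDiff x) = V.halfSum x - V.halfSum (V.halfSum x) := by
  simp only [halfDiff_apply, halfSum_apply, realProj_two_inv_smul, realProjI_two_inv_smul,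
    map_add, map_sub, realProjI_add, realProjI_sub, realProjI_realProjI,
    V.realProj_of_mem (V.realProj_mem _)]
  module

/-- With `p² = p` and `q² = q`, both sides are `(p - q + p q - q p)/4`. For `T = (1 + Δ)⁻¹` the
passage to `1 - T` is inversion of `Δ`, so this is the source of `J Δ J = Δ⁻¹`. -/
theorem halfDiff_halfSum (V : StandardSubspace H) (x : H) :
    V.halfDiff (V.halfSum x) = V.halfDiff x - V.halfSum (V.halfDiff x) := by
  simp only [halfDiff_apply, halfSum_apply, realProj_two_inv_smul, realProjI_two_inv_smul,
    map_add, map_sub, realProjI_add, realProjI_sub, realProjI_realProjI,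
    V.realProj_of_mem (V.realProj_mem _)]
  module

theorem eq_zero_of_halfDiff (V : StandardSubspace H) {x : H} (h : V.halfDiff x = 0) : x = 0 := by
  rw [halfDiff_apply, smul_eq_zero] at h
  refine V.realProj_eq_zero_of_eq (c := 1) (by norm_num) ?_
  rw [one_smul]
  exact sub_eq_zero.1 (h.resolve_left (by norm_num))

theorem norm_sq_halfDiff (V : StandardSubspace H) (x : H) :
    ‖V.halfDiff x‖ ^ 2 = (⟪x, V.halfSum x - V.halfSum (V.halfSum x)⟫ : ℂ).re := by
  rw [← halfDiff_halfDiff, ← re_inner_halfDiff]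
  exact (inner_self_eq_norm_sq (𝕜 := ℂ) _).symm

theorem halfSum_eq (V : StandardSubspace H) (u : H) :
    V.halfSum u = (2⁻¹ : ℝ) • V.realProj u +
      Complex.I • (2⁻¹ : ℝ) • V.realProj (-Complex.I • u) := by
  rw [halfSum_apply, realProjI]
  simp only [← Complex.coe_smul]
  push_cast
  module

theorem halfDiff_eq (V : StandardSubspace H) (u : H) :
    V.halfDiff u = (2⁻¹ : ℝ) • V.realProj u -
      Complex.I • (2⁻¹ : ℝ) • V.realProj (-Complex.I • u) := by
  rw [halfDiff_apply, realProjI]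
  simp only [← Complex.coe_smul]
  push_cast
  module

theorem halfSum_mem (V : StandardSubspace H) (u : H) : V.halfSum u ∈ V.tomita.domain :=
  ⟨_, V.toClosedSubmodule.toSubmodule.smul_mem _ (V.realProj_mem u), _,
    V.toClosedSubmodule.toSubmodule.smul_mem _ (V.realProj_mem _), V.halfSum_eq u⟩

theorem tomita_halfSum (V : StandardSubspace H) (u : H) :
    V.tomita ⟨_, V.halfSum_mem u⟩ = V.halfDiff u := by
  rw [V.tomita_apply _ (V.toClosedSubmodule.toSubmodule.smul_mem _ (V.realProj_mem u))
    (V.toClosedSubmodule.toSubmodule.smul_mem _ (V.realProj_mem _)) (V.halfSum_eq u), halfDiff_eq]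

/-- For `x = v + i w` and `z = a + i b` the left side is `Re ⟪S z, S x⟫ + Re ⟪x, z⟫`. The cross
terms cancel, so the form of `1 + S* S` decouples into two conditions inside `V`. -/
theorem re_inner_conj_add (a b v w : H) :
    (⟪a - Complex.I • b, v - Complex.I • w⟫ : ℂ).re +
      (⟪v + Complex.I • w, a + Complex.I • b⟫ : ℂ).re =
      2 * (⟪a, v⟫ : ℂ).re + 2 * (⟪b, w⟫ : ℂ).re := by
  rw [re_inner_comm (v + Complex.I • w)]
  simp only [inner_add_left, inner_add_right, inner_sub_left, inner_sub_right, inner_smul_left,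
    inner_smul_right, Complex.conj_I, Complex.add_re, Complex.sub_re, Complex.mul_re,
    Complex.mul_im, Complex.I_re, Complex.I_im, Complex.neg_re, Complex.neg_im, Complex.add_im,
    Complex.sub_im]
  ring

/-- `(x, y)` belongs to the graph of `Δ` iff `x = T (x + y)`, i.e. `T = (1 + Δ)⁻¹`. -/
theorem mem_modularGraph_iff (V : StandardSubspace H) (x y : H) :
    (x, y) ∈ V.modularGraph ↔ x = V.halfSum (x + y) := by
  have h2 : ∀ z : H, (2 : ℝ) • (2⁻¹ : ℝ) • z = z := fun z => by
    rw [smul_smul]; norm_num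
  constructor
  · rintro ⟨x', hx', h⟩
    simp only at hx' h
    subst hx'
    obtain ⟨v, hv, w, hw, hx⟩ := x'.2
    -- Taking `b = 0` shows that the projection of `x + y` to `V` is `2 v`; taking `a = 0` shows
    -- that the projection of `-i (x + y)` is `2 w`. Hence `T (x + y) = v + i w = x`.
    have hr : ∀ a ∈ V.toClosedSubmodule, ∀ b ∈ V.toClosedSubmodule,
        2 * (⟪a, v⟫ : ℂ).re + 2 * (⟪b, w⟫ : ℂ).re =
          (⟪a + Complex.I • b, (x' : H) + y⟫ : ℂ).re := by
      intro a ha b hb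
      have h1 := congrArg Complex.re (h ⟨_, ⟨a, ha, b, hb, rfl⟩⟩)
      rw [V.tomita_apply x' hv hw hx, V.tomita_apply _ ha hb rfl] at h1
      change _ = (⟪y, a + Complex.I • b⟫ : ℂ).re at h1
      rw [← re_inner_conj_add, h1, re_inner_comm (a + _), inner_add_left ((x' : H)), Complex.add_re, hx,
        add_comm]
    have h0 := V.toClosedSubmodule.toSubmodule.zero_mem
    have hp : V.realProj ((x' : H) + y) = (2 : ℝ) • v := by
      refine V.realProj_eq (V.toClosedSubmodule.toSubmodule.smul_mem _ hv) fun a ha => ?_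
      have := hr a ha 0 h0
      rw [smul_zero, add_zero, inner_zero_left, Complex.zero_re, mul_zero, add_zero] at this
      rw [← this, ← Complex.coe_smul, inner_smul_right, Complex.re_ofReal_mul]
    have hq : V.realProj (-Complex.I • ((x' : H) + y)) = (2 : ℝ) • w := by
      refine V.realProj_eq (V.toClosedSubmodule.toSubmodule.smul_mem _ hw) fun b hb => ?_
      have := hr 0 h0 b hb
      rw [zero_add, inner_zero_left, Complex.zero_re, mul_zero, zero_add,
        re_inner_I_smul_left] at this
      rw [← this, ← Complex.coe_smul, inner_smul_right, Complex.re_ofReal_mul]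
    rw [halfSum_eq, hp, hq, hx, smul_smul, smul_smul]
    norm_num
  · intro hx
    refine ⟨⟨x, by rw [hx]; exact V.halfSum_mem _⟩, rfl, ?_⟩
    have hS : V.tomita ⟨x, by rw [hx]; exact V.halfSum_mem _⟩ = V.halfDiff (x + y) := by
      rw [← V.tomita_halfSum]
      congr 1
      exact Subtype.ext hx
    have hre : ∀ z : V.tomita.domain, (⟪V.tomita z, V.tomita ⟨x, by
        rw [hx]; exact V.halfSum_mem _⟩⟫ : ℂ).re = (⟪y, (z : H)⟫ : ℂ).re := by
      intro z
      obtain ⟨a, ha, b, hb, hz⟩ := z.2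
      have h1 := re_inner_conj_add a b ((2⁻¹ : ℝ) • V.realProj (x + y))
        ((2⁻¹ : ℝ) • V.realProj (-Complex.I • (x + y)))
      rw [← halfDiff_eq, ← halfSum_eq, ← hx] at h1
      have h3 : ∀ c z : H, 2 * (⟪c, (2⁻¹ : ℝ) • z⟫ : ℂ).re = (⟪c, z⟫ : ℂ).re := fun c z => by
        rw [← Complex.coe_smul, inner_smul_right, Complex.re_ofReal_mul]; ring
      rw [h3, h3, V.re_inner_realProj ha, V.re_inner_realProj hb, ← re_inner_I_smul_left] at h1
      have h4 : (⟪a, x + y⟫ : ℂ).re + (⟪Complex.I • b, x + y⟫ : ℂ).re =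
          (⟪x, a + Complex.I • b⟫ : ℂ).re + (⟪y, a + Complex.I • b⟫ : ℂ).re := by
        rw [← Complex.add_re, ← inner_add_left, re_inner_comm, inner_add_left, Complex.add_re]
      rw [hS, V.tomita_apply z ha hb hz, hz]
      linarith
    intro z
    refine Complex.ext (hre z) ?_
    have h1 := hre (Complex.I • z)
    rw [LinearPMap.map_smulₛₗ, Submodule.coe_smul, inner_smul_left, inner_smul_right,
      Complex.conj_conj] at h1
    simpa using h1

end StandardSubspace

/-! ### Every standard subspace comes from a modular pair -/

namespace StandardSubspace

variable {H : Type*} [NormedAddCommGroup H] [InnerProductSpace ℂ H] [CompleteSpace H]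

theorem exists_bop_ofReal_eq_halfSum (V : StandardSubspace H) :
    ∃ (P : SpectralMeasure H) (γ : ℝ → ℝ), Measurable γ ∧ BddMeas (fun l => (γ l : ℂ)) ∧
      V.halfSum = P.bop fun l => (γ l : ℂ) := by
  have hN : IsStarNormal V.halfSum := by
    have : IsSelfAdjoint V.halfSum := by
      rw [ContinuousLinearMap.isSelfAdjoint_iff_isSymmetric]
      exact fun x y => V.inner_halfSum x y
    exact this.isStarNormal
  obtain ⟨P, g, hg, ⟨M, hM⟩, h⟩ := V.halfSum.exists_spectralMeasure hN
  have hm : Measurable fun l => (g l).re := Complex.measurable_re.comp hg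
  have hb : BddMeas (fun l => ((g l).re : ℂ)) := by
    refine ⟨Complex.measurable_ofReal.comp hm, M, fun l => ?_⟩
    rw [Complex.norm_real]
    exact (Complex.abs_re_le_norm _).trans (hM l)
  refine ⟨P, fun l => (g l).re, hm, hb, P.eq_bop hb fun x => ?_⟩
  have hi : Integrable g (P.scalarMeasure x) := BddMeas.integrable ⟨hg, M, hM⟩ _
  have hre : (∫ l, (g l).re ∂(P.scalarMeasure x)) = (∫ l, g l ∂(P.scalarMeasure x)).re :=
    integral_re hi
  rw [integral_complex_ofReal, hre, ← h]
  refine (Complex.conj_eq_iff_re.1 ?_).symm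
  rw [inner_conj_symm, V.inner_halfSum]

/-- The resolvent `(1 + Δ)⁻¹` determines a spectral measure on the positive half-line. -/
theorem exists_bop_oneAddInv_eq_halfSum (V : StandardSubspace H) :
    ∃ P : SpectralMeasure H, P.proj (Set.Iic 0) = 0 ∧ V.halfSum = P.bop oneAddInv := by
  obtain ⟨P, γ, hm, hb, h⟩ := V.exists_bop_ofReal_eq_halfSum
  -- The solution of `(1 + φ)⁻¹ = γ`: pushing forward along it turns the spectral measure of `T`
  -- into that of `Δ`.
  set φ : ℝ → ℝ := fun l => (γ l)⁻¹ - 1 with hφd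
  have hφ : Measurable φ := hm.inv.sub_const 1
  have hs : MeasurableSet (φ ⁻¹' Set.Iic 0) := hφ measurableSet_Iic
  -- This set is where `γ ≤ 0` or `γ ≥ 1`; it includes `γ = 0`, where `0⁻¹ = 0` makes `φ = -1`.
  have hγ : ∀ l ∈ φ ⁻¹' Set.Iic 0, γ l - γ l * γ l ≤ 0 := by
    intro l hl
    simp only [Set.mem_preimage, Set.mem_Iic, hφd, sub_nonpos] at hl
    rcases le_or_gt (γ l) 0 with h0 | h0
    · nlinarith [mul_self_nonneg (γ l)]
    · have := (inv_le_one₀ h0).1 hl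
      nlinarith
  have h1 : ∀ x, (⟪x, V.halfSum x - V.halfSum (V.halfSum x)⟫ : ℂ).re =
      ∫ l, (γ l - γ l * γ l) ∂(P.scalarMeasure x) := by
    intro x
    rw [h, ← mul_apply_eq_comp, P.bop_mul hb hb, inner_sub_right, P.inner_self_bop hb,
      P.inner_self_bop (hb.mul hb), ← integral_sub (hb.integrable _) ((hb.mul hb).integrable _)]
    rw [← Complex.ofReal_re (∫ l, (γ l - γ l * γ l) ∂(P.scalarMeasure x)),
      ← integral_complex_ofReal]
    congr 1
    refine integral_congr_ae (Eventually.of_forall fun l => ?_)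
    simp
  -- On the range of this projection `‖K x‖² = ⟪x, (T - T²) x⟫ ≤ 0`, and `K` is injective.
  have h0 : P.proj (φ ⁻¹' Set.Iic 0) = 0 := by
    ext y
    set x := P.proj (φ ⁻¹' Set.Iic 0) y with hx
    have hae : ∀ᵐ l ∂(P.scalarMeasure x), l ∈ φ ⁻¹' Set.Iic 0 := by
      rw [ae_iff]
      change P.scalarMeasure x (φ ⁻¹' Set.Iic 0)ᶜ = 0
      rw [P.scalarMeasure_apply x hs.compl, hx, ← mul_apply_eq_comp,
        P.proj_mul_of_disjoint hs.compl hs disjoint_compl_left]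
      simp
    have h2 : ‖V.halfDiff x‖ ^ 2 ≤ 0 := by
      rw [V.norm_sq_halfDiff, h1]
      exact integral_nonpos_of_ae (hae.mono fun l hl => hγ l hl)
    have h3 : V.halfDiff x = 0 := by
      have := le_antisymm h2 (by positivity)
      simpa using this
    exact V.eq_zero_of_halfDiff h3
  refine ⟨P.map φ hφ, h0, (P.map φ hφ).eq_bop bddMeas_oneAddInv fun x => ?_⟩
  rw [P.scalarMeasure_map, integral_map hφ.aemeasurable
    bddMeas_oneAddInv.measurable.aestronglyMeasurable, h, P.inner_self_bop hb]
  refine integral_congr_ae ?_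
  filter_upwards [P.ae_notMem hs h0 x] with l hl
  simp only [Set.mem_preimage, Set.mem_Iic, not_le] at hl
  rw [oneAddInv, abs_of_pos hl, hφd]
  simp

/-- The square of `K` equals `T - T²`, a symmetric bounded operator that is injective because `K`
is; so its range has trivial orthogonal complement. -/
theorem dense_halfDiff_halfDiff (V : StandardSubspace H) :
    DenseRange fun x => V.halfDiff (V.halfDiff x) := by
  set S : H →L[ℂ] H := V.halfSum - V.halfSum * V.halfSum with hS
  have hK : ∀ x, V.halfDiff (V.halfDiff x) = S x := fun x => V.halfDiff_halfDiff x
  have hsymm : ∀ x y, ⟪S x, y⟫ = ⟪x, S y⟫ := fun x y => by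
    simp only [hS, sub_apply, mul_apply_eq_comp, inner_sub_left, inner_sub_right, V.inner_halfSum]
  have h : (LinearMap.range S.toLinearMap)ᗮ = ⊥ := by
    rw [eq_bot_iff]
    intro x hx
    rw [Submodule.mem_orthogonal] at hx
    have h1 : S x = 0 := by
      refine ext_inner_left ℂ fun y => ?_
      rw [← hsymm, inner_zero_right]
      exact hx _ ⟨y, rfl⟩
    rw [← hK] at h1
    exact V.eq_zero_of_halfDiff (V.eq_zero_of_halfDiff h1)
  have h2 := (Submodule.topologicalClosure_eq_top_iff).2 h
  rw [Submodule.eq_top_iff'] at h2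
  simp only [hK]
  exact fun x => h2 x

/-- A standard subspace is determined by the two operators `halfSum` and `halfDiff`. -/
theorem eq_of_halfSum_halfDiff {V W : StandardSubspace H} (h : ∀ x, V.halfSum x = W.halfSum x)
    (h' : ∀ x, V.halfDiff x = W.halfDiff x) : V = W := by
  have h1 : ∀ v, v ∈ V.toClosedSubmodule ↔ v ∈ W.toClosedSubmodule := fun v => by
    rw [V.mem_iff_realProj, W.mem_iff_realProj, ← V.halfSum_add_halfDiff,
      ← W.halfSum_add_halfDiff, h, h']
  have h2 : V.toClosedSubmodule = W.toClosedSubmodule := SetLike.ext h1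
  cases V
  cases W
  congr

/-- Every standard subspace comes from a modular pair. -/
theorem exists_standard_eq (V : StandardSubspace H) : ∃ M : ModularPair H, M.standard = V := by
  obtain ⟨P, hP, hT⟩ := V.exists_bop_oneAddInv_eq_halfSum
  have bc := bddMeas_sqrtFun_mul_oneAddInv
  have br := bddMeas_oneAddInv
  set C := P.bop (sqrtFun * oneAddInv) with hC
  have hCC : ∀ x, C (C x) = V.halfDiff (V.halfDiff x) := fun x => by
    rw [hC, P.bop_sqrtFun_mul_oneAddInv_sq hP, ← hT, V.halfDiff_halfDiff]
  have hTC : ∀ x, V.halfSum (C x) = C (V.halfSum x) := fun x => by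
    rw [hC, hT, ← mul_apply_eq_comp, ← mul_apply_eq_comp, P.bop_mul br bc, P.bop_mul bc br,
      mul_comm oneAddInv]
  have hconj : (fun l => conj ((sqrtFun * oneAddInv) l)) = sqrtFun * oneAddInv := by
    ext l
    simp only [Pi.mul_apply, map_mul, conj_sqrtFun, oneAddInv, Complex.conj_ofReal]
  have hCsymm : ∀ x y, ⟪C x, y⟫ = ⟪x, C y⟫ := fun x y => by
    rw [hC, P.inner_bop_left bc, hconj]
  have hnorm : ∀ x, ‖V.halfDiff x‖ = ‖C x‖ := fun x => by
    have h1 : ‖V.halfDiff x‖ ^ 2 = ‖C x‖ ^ 2 := by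
      rw [V.norm_sq_halfDiff, ← V.halfDiff_halfDiff, ← hCC, ← hCsymm]
      exact inner_self_eq_norm_sq (𝕜 := ℂ) _
    exact (pow_left_inj₀ (norm_nonneg _) (norm_nonneg _) two_ne_zero).1 h1
  let e₁ : H →ₗ[ℝ] H := C.toLinearMap.restrictScalars ℝ
  let e₂ : H →ₗ[ℝ] H :=
    { toFun := V.halfDiff
      map_add' := map_add _
      map_smul' := fun c x => by
        rw [← Complex.coe_smul, LinearMap.map_smulₛₗ, Complex.conj_ofReal, Complex.coe_smul]
        rfl }
  have hd₁ : DenseRange e₁ := V.dense_halfDiff_halfDiff.mono (by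
    rintro _ ⟨x, rfl⟩
    exact ⟨C x, hCC x⟩)
  have hd₂ : DenseRange e₂ := V.dense_halfDiff_halfDiff.mono (by
    rintro _ ⟨x, rfl⟩
    exact ⟨V.halfDiff x, rfl⟩)
  -- Polar decomposition `K = J C`: the map `C x ↦ K x` is isometric between dense ranges, both
  -- containing the range of `K² = C²`.
  let J : H ≃ₗᵢ[ℝ] H := (LinearEquiv.refl ℝ H).extendOfIsometry e₁ e₂ hd₁ hd₂ hnorm
  have hJC : ∀ x, J (C x) = V.halfDiff x := fun x =>
    LinearEquiv.extendOfIsometry_eq (LinearEquiv.refl ℝ H) e₁ e₂ hd₁ hd₂ hnorm x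
  have hJ : ∀ (c : ℂ) (x : H), J (c • x) = conj c • J x := by
    intro c x
    refine hd₁.induction_on (p := fun x => J (c • x) = conj c • J x) x
      (isClosed_eq (J.continuous.comp (by fun_prop)) (J.continuous.const_smul _)) fun y => ?_
    change J (c • C y) = conj c • J (C y)
    rw [← map_smul, hJC, hJC, LinearMap.map_smulₛₗ]
  have hJT : ∀ x, J (V.halfSum x) = J x - V.halfSum (J x) := by
    intro x
    refine hd₁.induction_on (p := fun x => J (V.halfSum x) = J x - V.halfSum (J x)) x
      (isClosed_eq (J.continuous.comp V.halfSum.continuous)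
        (J.continuous.sub (V.halfSum.continuous.comp J.continuous))) fun y => ?_
    change J (V.halfSum (C y)) = J (C y) - V.halfSum (J (C y))
    rw [hTC, hJC, hJC, V.halfDiff_halfSum]
  have hinner := LinearIsometryEquiv.inner_map_antilinear hJ
  -- The spectral measure of `(J⁻¹ Δ J)⁻¹`. The relation `J T = (1 - T) J` shows that it has the
  -- same resolvent at `-1` as `P`, hence the same scalar measures.
  set Q := (P.conjBy J hJ).map (·⁻¹) measurable_inv with hQ
  have hQm : ∀ x, Q.scalarMeasure x = (P.scalarMeasure (J x)).map (·⁻¹) := fun x => by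
    rw [hQ, SpectralMeasure.scalarMeasure_map, P.scalarMeasure_conjBy]
  have hQ0 : Q.proj (Set.Iic 0) = 0 := by
    rw [Q.proj_eq_zero_iff measurableSet_Iic]
    intro x
    rw [hQm, Measure.map_apply measurable_inv measurableSet_Iic]
    have : (·⁻¹) ⁻¹' Set.Iic 0 = (Set.Iic 0 : Set ℝ) := by
      ext l; simp
    rw [this]
    exact (P.proj_eq_zero_iff measurableSet_Iic).1 hP _
  have hQT : Q.bop oneAddInv = P.bop oneAddInv := by
    rw [← hT]
    refine (Q.eq_bop br fun x => ?_).symm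
    rw [hQm, integral_map measurable_inv.aemeasurable br.measurable.aestronglyMeasurable]
    have h1 : (⟪J x, J x - P.bop oneAddInv (J x)⟫ : ℂ) =
        ∫ l, (1 - oneAddInv l) ∂(P.scalarMeasure (J x)) := by
      have h2 := P.inner_self_bop BddMeas.one (J x)
      rw [P.bop_one, one_apply_eq_self] at h2
      rw [inner_sub_right, h2, P.inner_self_bop br,
        ← integral_sub (BddMeas.one.integrable _) (br.integrable _)]
      rfl
    rw [← hT, ← hJT, hinner, V.inner_halfSum] at h1
    rw [h1]
    refine integral_congr_ae ?_
    filter_upwards [P.ae_pos hP (J x)] with l hl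
    rw [oneAddInv_inv hl]
  have hm : ∀ x, P.scalarMeasure x = (P.scalarMeasure (J x)).map (·⁻¹) := fun x => by
    rw [← hQm]
    exact SpectralMeasure.scalarMeasure_eq_of_bop_oneAddInv hP hQ0 hQT.symm x
  have hm' : ∀ x, P.scalarMeasure (J x) = (P.scalarMeasure x).map (·⁻¹) := fun x => by
    rw [hm x, Measure.map_map measurable_inv measurable_inv]
    have : ((·⁻¹) ∘ (·⁻¹) : ℝ → ℝ) = id := by ext; simp
    rw [this, Measure.map_id]
  -- The function `√l / (1 + l)` is real and invariant under `l ↦ 1/l`.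
  have hCJ : ∀ x, C (J x) = J (C x) := fun x => by
    have h1 : J.conjBy hJ C = C := by
      refine P.eq_bop bc fun x => ?_
      rw [J.inner_conjBy, hCsymm, hC, P.inner_self_bop bc, hm',
        integral_map measurable_inv.aemeasurable bc.measurable.aestronglyMeasurable]
      refine integral_congr_ae ?_
      filter_upwards [P.ae_pos hP x] with l hl using sqrtFun_mul_oneAddInv_inv hl
    conv_rhs => rw [← h1, J.conjBy_apply, J.apply_symm_apply]
  -- On the dense range of `K²` one has `K² y = J C J C y = J J C² y = J J K² y`.
  have hJJ : ∀ x, J (J x) = x := by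
    intro x
    refine V.dense_halfDiff_halfDiff.induction_on (p := fun x => J (J x) = x) x
      (isClosed_eq (J.continuous.comp J.continuous) continuous_id) fun y => ?_
    conv_rhs => rw [← hJC, ← hJC, hCJ]
    rw [← hCC]
  let M : ModularPair H := ⟨P, hP, J, hJ, hJJ, hm'⟩
  have hsum : ∀ u, M.standard.halfSum u = V.halfSum u := fun u => by
    have h1 : (V.halfSum u, u - V.halfSum u) ∈ M.standard.modularOperator.graph := by
      rw [M.modularOperator_standard]
      refine (P.mem_graph_integral_iff hP _ _).2 ?_
      rw [add_sub_cancel, hT]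
    rw [graph_modularOperator, mem_modularGraph_iff, add_sub_cancel] at h1
    exact h1.symm
  -- The difference operators agree because each Tomita operator maps `T u` to its `K u`, and for
  -- the modular pair `J Δ^{1/2} T u = J C u = K u`.
  refine ⟨M, eq_of_halfSum_halfDiff hsum fun u => ?_⟩
  have hd : V.halfSum u ∈ M.B.domain := by
    rw [← M.domain_tomita_standard, ← hsum]
    exact M.standard.halfSum_mem u
  rw [← M.standard.tomita_halfSum, M.tomita_standard_apply _ ⟨_, hd⟩ (hsum u), ← hJC]
  change J (P.vec sqrtFun (V.halfSum u)) = _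
  rw [hT, P.bop_apply br, P.vec_vec br.measurable measurable_sqrtFun (br.memLp _) (bc.memLp _), hC,
    P.bop_apply bc]

end StandardSubspace

/-! ### The representation of a modular pair -/

/-- The angle `-log l / 2π`, so that `l ^ (-it/2π) = exp (i t · modAngle l)`. -/
noncomputable def modAngle (l : ℝ) : ℝ := -Real.log l / (2 * Real.pi)

theorem measurable_modAngle : Measurable modAngle := by unfold modAngle; fun_prop

theorem modAngle_inv (l : ℝ) : modAngle l⁻¹ = -modAngle l := by
  rw [modAngle, modAngle, Real.log_inv, neg_div, neg_div]

theorem conj_phase_modAngle_inv (t l : ℝ) : conj (phase modAngle t l⁻¹) = phase modAngle t l := by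
  rw [conj_phase, phase, phase, modAngle_inv]
  push_cast
  ring_nf

theorem phase_modAngle {l : ℝ} (hl : 0 < l) (t : ℝ) :
    phase modAngle t l = (l : ℂ) ^ (-(Complex.I * t / (2 * Real.pi))) := by
  rw [phase, modAngle, Complex.cpow_def_of_ne_zero (by exact_mod_cast hl.ne'),
    ← Complex.ofReal_log hl.le]
  push_cast
  ring_nf

/-- The operators of a unitary flow as surjective isometries. -/
noncomputable def UnitaryFlow.equiv {H : Type*} [NormedAddCommGroup H] [InnerProductSpace ℂ H]
    [CompleteSpace H] (U : UnitaryFlow H) (t : ℝ) : H ≃ₗᵢ[ℝ] H where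
  toFun := U.toFun t
  invFun := U.toFun (-t)
  left_inv x := by rw [← U.map_add_apply, neg_add_cancel, U.map_zero, one_apply_eq_self]
  right_inv x := by rw [← U.map_add_apply, add_neg_cancel, U.map_zero, one_apply_eq_self]
  map_add' := _root_.map_add _
  map_smul' c x := by
    rw [← Complex.coe_smul, map_smul, Complex.coe_smul]
    rfl
  norm_map' := U.norm_map t

namespace ModularPair

variable {H : Type*} [NormedAddCommGroup H] [InnerProductSpace ℂ H] [CompleteSpace H]

/-- The unitary flow `t ↦ Δ ^ (-it/2π)`. -/
noncomputable def flow (M : ModularPair H) : UnitaryFlow H :=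
  M.P.flow modAngle measurable_modAngle

theorem inner_flow (M : ModularPair H) (t : ℝ) (x : H) : ⟪x, M.flow.toFun t x⟫ =
    ∫ l, (l : ℂ) ^ (-(Complex.I * t / (2 * Real.pi))) ∂(M.P.scalarMeasure x) := by
  rw [flow, M.P.inner_flow]
  refine integral_congr_ae ?_
  filter_upwards [M.P.ae_pos M.null x] with l hl using phase_modAngle hl t

/-- Antilinearity conjugates the phase and the inversion symmetry replaces `l` by `1/l`. Each
changes the sign of the exponent, so the phase is unchanged. -/
theorem J_flow (M : ModularPair H) (t : ℝ) (x : H) :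
    M.J (M.flow.toFun t x) = M.flow.toFun t (M.J x) := by
  have hb := bddMeas_phase measurable_modAngle t
  change M.J (M.P.bop (phase modAngle t) x) = M.P.bop (phase modAngle t) (M.J x)
  rw [M.P.bop_apply hb, M.P.bop_apply hb, M.J_vec (hb.memLp _)]
  simp only [conj_phase_modAngle_inv]

open scoped Classical in
/-- The antiunitary representation `e^t ↦ Δ ^ (-it/2π)`, `-1 ↦ J`. -/
noncomputable def rep (M : ModularPair H) : AntiunitaryRep H where
  -- Here `Real.log g` is `log |g|`, also for negative `g`, so the same flow time serves both
  -- components.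
  toFun g := if 0 < (g : ℝ) then M.flow.equiv (Real.log g) else M.J * M.flow.equiv (Real.log g)
  map_one' := by
    rw [if_pos (by simp)]
    ext x
    change M.flow.toFun _ x = x
    rw [Units.val_one, Real.log_one, M.flow.map_zero, one_apply_eq_self]
  map_mul' g h := by
    have hlog : Real.log ((g * h : ℝˣ) : ℝ) = Real.log g + Real.log h := by
      rw [Units.val_mul, Real.log_mul g.ne_zero h.ne_zero]
    rw [hlog]
    rcases lt_or_gt_of_ne g.ne_zero with hg | hg <;> rcases lt_or_gt_of_ne h.ne_zero with hh | hh
    · rw [if_neg hg.not_gt, if_neg hh.not_gt, if_pos (by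
        rw [Units.val_mul]; exact mul_pos_of_neg_of_neg hg hh)]
      ext x
      change M.flow.toFun _ x = M.J (M.flow.toFun _ (M.J (M.flow.toFun _ x)))
      rw [M.J_flow, M.involutive, M.flow.map_add_apply]
    · rw [if_neg hg.not_gt, if_pos hh, if_neg (by
        rw [Units.val_mul]; exact (mul_neg_of_neg_of_pos hg hh).not_gt)]
      ext x
      change M.J (M.flow.toFun _ x) = M.J (M.flow.toFun _ (M.flow.toFun _ x))
      rw [M.flow.map_add_apply]
    · rw [if_pos hg, if_neg hh.not_gt, if_neg (by
        rw [Units.val_mul]; exact (mul_neg_of_pos_of_neg hg hh).not_gt)]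
      ext x
      change M.J (M.flow.toFun _ x) = M.flow.toFun _ (M.J (M.flow.toFun _ x))
      rw [← M.J_flow, M.flow.map_add_apply]
    · rw [if_pos hg, if_pos hh, if_pos (by rw [Units.val_mul]; exact mul_pos hg hh)]
      ext x
      exact M.flow.map_add_apply _ _ x
  map_smul_of_pos g hg c x := by
    simp only [if_pos hg]
    exact map_smul (M.flow.toFun _) c x
  map_smul_of_neg g hg c x := by
    simp only [if_neg hg.not_gt]
    change M.J (M.flow.toFun _ (c • x)) = conj c • M.J (M.flow.toFun _ x)
    rw [map_smul, M.antilinear]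
  continuous_apply x := by
    have hc : Continuous fun g : ℝˣ => M.flow.toFun (Real.log g) x :=
      (M.flow.continuous_apply x).comp (Units.continuous_val.log fun g => g.ne_zero)
    have h : (fun g : ℝˣ => (if 0 < (g : ℝ) then M.flow.equiv (Real.log g)
        else M.J * M.flow.equiv (Real.log g)) x) = fun g : ℝˣ => if 0 < (g : ℝ) then
          M.flow.toFun (Real.log g) x else M.J (M.flow.toFun (Real.log g) x) := by
      ext g
      split_ifs <;> rfl
    change Continuous fun g : ℝˣ => (if 0 < (g : ℝ) then M.flow.equiv (Real.log g)
        else M.J * M.flow.equiv (Real.log g)) x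
    rw [h]
    refine hc.if (fun g hg => ?_) (M.J.continuous.comp hc)
    -- The two components are open and closed, so their common boundary, where the branches would
    -- have to match, is empty.
    have hcl : IsClopen {g : ℝˣ | 0 < (g : ℝ)} := by
      refine ⟨?_, isOpen_lt continuous_const Units.continuous_val⟩
      have : {g : ℝˣ | 0 < (g : ℝ)} = {g : ℝˣ | 0 ≤ (g : ℝ)} := by
        ext g
        exact ⟨fun h : 0 < (g : ℝ) => h.le, fun h : 0 ≤ (g : ℝ) => lt_of_le_of_ne h g.ne_zero.symm⟩
      rw [this]
      exact isClosed_le continuous_const Units.continuous_val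
    rw [hcl.frontier_eq] at hg
    exact hg.elim

theorem rep_neg_one (M : ModularPair H) : M.rep (-1) = M.J := by
  classical
  ext x
  change (if 0 < ((-1 : ℝˣ) : ℝ) then M.flow.equiv (Real.log ((-1 : ℝˣ) : ℝ))
    else M.J * M.flow.equiv (Real.log ((-1 : ℝˣ) : ℝ))) x = M.J x
  rw [if_neg (by norm_num)]
  change M.J (M.flow.toFun _ x) = M.J x
  rw [Units.val_neg, Units.val_one, Real.log_neg_eq_log, Real.log_one, M.flow.map_zero,
    one_apply_eq_self]

theorem unitaryGroup_rep (M : ModularPair H) (t : ℝ) (x : H) :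
    M.rep.unitaryGroup t x = M.flow.toFun t x := by
  classical
  change (if 0 < Real.exp t then M.flow.equiv (Real.log (Real.exp t))
    else M.J * M.flow.equiv (Real.log (Real.exp t))) x = _
  rw [if_pos (Real.exp_pos t), Real.log_exp]
  rfl

end ModularPair

/-! ### The modular pair of an antiunitary representation -/

namespace AntiunitaryRep

variable {H : Type*} [NormedAddCommGroup H] [InnerProductSpace ℂ H] [CompleteSpace H]

theorem unitaryGroup_apply (U : AntiunitaryRep H) (t : ℝ) (x : H) :
    U.unitaryGroup t x = U (Units.mk0 (Real.exp t) (Real.exp_ne_zero t)) x := rfl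

theorem map_mul_apply (U : AntiunitaryRep H) (g h : ℝˣ) (x : H) : U (g * h) x = U g (U h x) := by
  rw [map_mul]; rfl

theorem map_one_apply (U : AntiunitaryRep H) (x : H) : U 1 x = x := by
  rw [map_one]; rfl

/-- The restriction of an antiunitary representation to the identity component. -/
noncomputable def flow (U : AntiunitaryRep H) : UnitaryFlow H where
  toFun t := ⟨U.unitaryGroup t, (U (Units.mk0 (Real.exp t) (Real.exp_ne_zero t))).continuous⟩
  map_zero := by
    ext x
    change U _ x = x
    have : Units.mk0 (Real.exp 0) (Real.exp_ne_zero 0) = 1 := by ext; simp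
    rw [this, U.map_one_apply]
  map_add s t := by
    ext x
    change U _ x = U _ (U _ x)
    rw [← U.map_mul_apply]
    congr 2
    ext
    simp [Real.exp_add]
  norm_map t := (U (Units.mk0 (Real.exp t) (Real.exp_ne_zero t))).norm_map
  continuous_apply x := by
    refine (U.continuous_apply x).comp (f := fun t : ℝ =>
      Units.mk0 (Real.exp t) (Real.exp_ne_zero t)) ?_
    rw [Units.continuous_iff]
    refine ⟨Real.continuous_exp, ?_⟩
    have : (fun t : ℝ => (((Units.mk0 (Real.exp t) (Real.exp_ne_zero t))⁻¹ : ℝˣ) : ℝ)) =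
        fun t => Real.exp (-t) := by
      ext t; simp [Real.exp_neg]
    rw [this]
    fun_prop

theorem neg_one_neg_one (U : AntiunitaryRep H) (x : H) : U (-1) (U (-1) x) = x := by
  rw [← U.map_mul_apply, neg_one_mul, neg_neg, U.map_one_apply]

theorem neg_one_smul (U : AntiunitaryRep H) (c : ℂ) (x : H) :
    U (-1) (c • x) = conj c • U (-1) x := U.map_smul_of_neg (-1) (by norm_num) c x

theorem neg_one_unitaryGroup (U : AntiunitaryRep H) (t : ℝ) (x : H) :
    U (-1) (U.unitaryGroup t x) = U.unitaryGroup t (U (-1) x) := by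
  rw [unitaryGroup_apply, unitaryGroup_apply, ← U.map_mul_apply, ← U.map_mul_apply, mul_comm]

/-- Stone's theorem for the identity component, combined with the reflection `U (-1)`. -/
theorem exists_modularPair (U : AntiunitaryRep H) : ∃ M : ModularPair H,
    M.J = U (-1) ∧ ∀ t x, U.unitaryGroup t x = M.flow.toFun t x := by
  obtain ⟨P, a, ha, h⟩ := U.flow.exists_spectralMeasure
  -- Chosen so that `modAngle (φ l) = a l`; it is positive everywhere, so the image measure lives on
  -- the positive half-line.
  set φ : ℝ → ℝ := fun l => Real.exp (-(2 * Real.pi * a l)) with hφd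
  have hφ : Measurable φ := by fun_prop
  have hang : ∀ l, modAngle (φ l) = a l := fun l => by
    rw [hφd, modAngle, Real.log_exp]
    have := Real.pi_ne_zero
    field_simp
  set Q := P.map φ hφ with hQ
  have hQ0 : Q.proj (Set.Iic 0) = 0 := by
    change P.proj (φ ⁻¹' Set.Iic 0) = 0
    have : φ ⁻¹' Set.Iic 0 = ∅ := by
      ext l; simp [hφd, Real.exp_pos]
    rw [this, P.proj_empty]
  have hUQ : ∀ t x, U.unitaryGroup t x = (Q.flow modAngle measurable_modAngle).toFun t x := by
    intro t x
    have hb := bddMeas_phase measurable_modAngle t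
    have : U.flow.toFun t = Q.bop (phase modAngle t) := by
      refine Q.eq_bop hb fun y => ?_
      rw [h, P.inner_flow, hQ, P.scalarMeasure_map, integral_map hφ.aemeasurable
        hb.measurable.aestronglyMeasurable]
      simp only [phase, hang]
    exact congrArg (fun T : H →L[ℂ] H => T x) this
  have hcpow : ∀ t x, (⟪x, U.unitaryGroup t x⟫ : ℂ) =
      ∫ l, (l : ℂ) ^ (-(Complex.I * t / (2 * Real.pi))) ∂(Q.scalarMeasure x) := by
    intro t x
    rw [hUQ, Q.inner_flow]
    refine integral_congr_ae ?_
    filter_upwards [Q.ae_pos hQ0 x] with l hl using phase_modAngle hl t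
  refine ⟨⟨Q, hQ0, U (-1), U.neg_one_smul, U.neg_one_neg_one, fun x => ?_⟩, rfl, hUQ⟩
  -- With `J = U (-1)` commuting with `U_t`, one gets `⟪J x, U_t J x⟫ = ⟪U_t x, x⟫`, the conjugate
  -- of `⟪x, U_t x⟫`. Conjugating `l^{-it/2π}` amounts to inverting `l`.
  refine Measure.ext_of_integral_cpow (Q.ae_pos hQ0 _) ?_ fun t => ?_
  · rw [ae_map_iff measurable_inv.aemeasurable measurableSet_Ioi]
    filter_upwards [Q.ae_pos hQ0 x] with l hl using inv_pos.2 hl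
  · rw [← hcpow, ← neg_one_unitaryGroup,
      LinearIsometryEquiv.inner_map_antilinear U.neg_one_smul, ← inner_conj_symm, hUQ,
      Q.inner_flow, ← integral_conj]
    have hae : ∀ᵐ l ∂((Q.scalarMeasure x).map (·⁻¹)), 0 < l := by
      rw [ae_map_iff measurable_inv.aemeasurable measurableSet_Ioi]
      filter_upwards [Q.ae_pos hQ0 x] with l hl using inv_pos.2 hl
    have h1 : ∫ l, (l : ℂ) ^ (-(Complex.I * t / (2 * Real.pi)))
        ∂((Q.scalarMeasure x).map (·⁻¹)) =
        ∫ l, phase modAngle t l ∂((Q.scalarMeasure x).map (·⁻¹)) := by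
      refine integral_congr_ae ?_
      filter_upwards [hae] with l hl using (phase_modAngle hl t).symm
    rw [h1, integral_map measurable_inv.aemeasurable
      (bddMeas_phase measurable_modAngle t).measurable.aestronglyMeasurable]
    refine integral_congr_ae (Eventually.of_forall fun l => ?_)
    simp only
    rw [← conj_phase_modAngle_inv, Complex.conj_conj]

theorem hasModularOperator_of_flow {U : AntiunitaryRep H} {M : ModularPair H}
    (h : ∀ t x, U.unitaryGroup t x = M.flow.toFun t x) : U.HasModularOperator M.D := by
  refine ⟨M.isStrictlyPositiveOp_D, fun t => ⟨M.P, M.isIntegral_D, M.null, ?_⟩⟩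
  have hb := bddMeas_phase measurable_modAngle t
  have h1 : M.P.IsIntegral (phase modAngle t) ((U.unitaryGroup t).toPMap ⊤) := by
    refine ⟨fun x => ⟨fun _ => ?_, fun _ => trivial⟩, fun x => ?_⟩
    · exact (memLp_two_iff_lintegral hb.measurable.aestronglyMeasurable).1 (hb.memLp _)
    · rw [← M.P.inner_flow modAngle measurable_modAngle]
      change ⟪(x : H), U.unitaryGroup t x⟫ = _
      rw [h]
      rfl
  refine h1.congr_ae fun x => ?_
  filter_upwards [M.P.ae_pos M.null x] with l hl using phase_modAngle hl t

theorem HasModularOperator.eq_D {U : AntiunitaryRep H} {M : ModularPair H}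
    (h : ∀ t x, U.unitaryGroup t x = M.flow.toFun t x) {D : H →ₗ.[ℂ] H}
    (hD : U.HasModularOperator D) : D = M.D := by
  -- The definition of the power allows a different spectral measure for each `t`. All of them
  -- represent `D`, so they share their scalar measures, and the one at `t = 0` can stand for all.
  choose P hPD hP0 hPU using hD.2
  have hm : ∀ x, (P 0).scalarMeasure x = M.P.scalarMeasure x := fun x => by
    refine Measure.ext_of_integral_cpow ((P 0).ae_pos (hP0 0) x) (M.P.ae_pos M.null x) fun t => ?_
    rw [← M.inner_flow, ← h,
      SpectralMeasure.scalarMeasure_eq_of_isIntegral (hPD 0) (hPD t) x]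
    exact ((hPU t).inner_apply ⟨x, trivial⟩).symm
  exact ((hPD 0).congr hm).eq_integral Complex.measurable_ofReal

theorem ext_of_unitaryGroup {U W : AntiunitaryRep H}
    (h : ∀ t x, U.unitaryGroup t x = W.unitaryGroup t x) (h' : U (-1) = W (-1)) : U = W := by
  have hpos : ∀ g : ℝˣ, 0 < (g : ℝ) → ∀ x, U g x = W g x := fun g hg x => by
    have : g = Units.mk0 (Real.exp (Real.log g)) (Real.exp_ne_zero _) := by
      ext; simp [Real.exp_log hg]
    rw [this]
    exact h _ x
  have hall : U.toMonoidHom = W.toMonoidHom := by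
    ext g x
    rcases lt_or_gt_of_ne g.ne_zero with hg | hg
    · have hg' : g = -1 * -g := by simp
      have h1 : U (-1 * -g) x = W (-1 * -g) x := by
        rw [U.map_mul_apply, W.map_mul_apply, h', hpos (-g) (by simpa using hg)]
      rw [← hg'] at h1
      exact h1
    · exact hpos g hg x
  cases U
  cases W
  congr

end AntiunitaryRep

/-! ### Uniqueness of the polar decomposition and closedness of the Tomita operator -/

namespace ModularPair

variable {H : Type*} [NormedAddCommGroup H] [InnerProductSpace ℂ H] [CompleteSpace H]

/-- The square root of the modular operator is unique. -/
theorem eq_B (M : ModularPair H) {B : H →ₗ.[ℂ] H} (hB : M.D.IsCPow (1 / 2) B) : B = M.B := by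
  obtain ⟨P, hPD, -, hPB⟩ := hB
  have h1 := hPB.congr fun x => SpectralMeasure.scalarMeasure_eq_of_isIntegral hPD M.isIntegral_D x
  refine (h1.congr_ae fun x => ?_).eq_integral measurable_sqrtFun
  filter_upwards [M.P.ae_pos M.null x] with l hl using (sqrtFun_eq_cpow hl.le).symm

theorem standard_eq {M N : ModularPair H} (hD : M.D = N.D) (hJ : M.J = N.J) :
    M.standard = N.standard := by
  have hB : M.B = N.B := N.eq_B (hD ▸ M.isCPow_B)
  have h1 : M.fixSpace = N.fixSpace := by
    refine SetLike.ext fun x => ?_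
    change (x, M.J x) ∈ M.B.graph ↔ (x, N.J x) ∈ N.B.graph
    rw [hB, hJ]
  have h2 : M.standard.toClosedSubmodule = N.standard.toClosedSubmodule := h1
  revert h2
  generalize M.standard = V
  generalize N.standard = W
  intro h2
  cases V
  cases W
  congr

/-- Both conjugations agree on the range of `B`. That range contains the image under `M.J` of the
domain of `B`, which is dense. -/
theorem eq_J (M : ModularPair H) {J : H ≃ₗᵢ[ℝ] H} (hJ : M.standard.IsModularConjugation J) :
    J = M.J := by
  obtain ⟨B, hB, hdom, hS⟩ := hJ.polar
  rw [M.modularOperator_standard] at hB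
  obtain rfl := M.eq_B hB
  have h1 : ∀ y : M.B.domain, J (M.B y) = M.J (M.B y) := fun y => by
    have hy : (y : H) ∈ M.standard.tomita.domain := by rw [hdom]; exact y.2
    rw [← hS ⟨y, hy⟩ y rfl, M.tomita_standard_apply ⟨y, hy⟩ y rfl]
  have h2 : ∀ w ∈ (M.B.domain : Set H), J (M.J w) = M.J (M.J w) := fun w hw => by
    have h3 := M.J_B_J_B ⟨w, hw⟩
    have h4 : M.J w = M.B ⟨_, M.J_B_mem ⟨w, hw⟩⟩ := by
      conv_lhs => rw [show w = ((⟨w, hw⟩ : M.B.domain) : H) from rfl, ← h3]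
      rw [M.involutive]
    rw [h4, h1]
  have h3 : ∀ w, J (M.J w) = M.J (M.J w) := fun w => by
    have hc : IsClosed {w : H | J (M.J w) = M.J (M.J w)} :=
      isClosed_eq (J.continuous.comp M.J.continuous) (M.J.continuous.comp M.J.continuous)
    exact hc.closure_subset_iff.2 h2 (M.isSelfAdjoint_B.dense_domain w)
  ext x
  rw [← M.involutive x]
  exact h3 _

theorem existsUnique_isModularConjugation (M : ModularPair H) :
    ∃! J : H ≃ₗᵢ[ℝ] H, M.standard.IsModularConjugation J :=
  ⟨M.J, M.isModularConjugation_standard, fun _ hJ => M.eq_J hJ⟩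

/-- The graph of `J B` is the preimage of the closed graph of `B` under `(x, y) ↦ (x, J y)`. -/
theorem isClosed_graph_tomita (M : ModularPair H) :
    IsClosed {p : H × H | ∃ x : M.standard.tomita.domain, p = ((x : H), M.standard.tomita x)} := by
  have h : {p : H × H | ∃ x : M.standard.tomita.domain, p = ((x : H), M.standard.tomita x)} =
      (fun p : H × H => (p.1, M.J p.2)) ⁻¹' (M.B.graph : Set (H × H)) := by
    ext ⟨x, y⟩
    simp only [Set.mem_ofPred_eq, Set.mem_preimage, SetLike.mem_coe, LinearPMap.mem_graph_iff,
      Prod.mk.injEq]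
    constructor
    · rintro ⟨x, rfl, rfl⟩
      have hx : (x : H) ∈ M.B.domain := by rw [← M.domain_tomita_standard]; exact x.2
      refine ⟨⟨x, hx⟩, rfl, ?_⟩
      rw [M.tomita_standard_apply x ⟨x, hx⟩ rfl, M.involutive]
    · rintro ⟨x, rfl, h⟩
      refine ⟨⟨x, by rw [M.domain_tomita_standard]; exact x.2⟩, rfl, ?_⟩
      rw [M.tomita_standard_apply _ x rfl, h, M.involutive]
  rw [h]
  exact M.isSelfAdjoint_B.isClosed.preimage
    (continuous_fst.prodMk (M.J.continuous.comp continuous_snd))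

theorem tomita_tomita (M : ModularPair H) (x : M.standard.tomita.domain) :
    ∃ y : M.standard.tomita.domain, (y : H) = M.standard.tomita x ∧ M.standard.tomita y = x := by
  have hx : (x : H) ∈ M.B.domain := by rw [← M.domain_tomita_standard]; exact x.2
  have h1 := M.tomita_standard_apply x ⟨x, hx⟩ rfl
  have h2 := M.J_B_mem ⟨x, hx⟩
  refine ⟨⟨_, M.domain_tomita_standard.ge h2⟩, h1.symm, ?_⟩
  rw [M.tomita_standard_apply _ ⟨_, h2⟩ rfl, M.J_B_J_B]

end ModularPair

/-! ### The bijection -/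

namespace AntiunitaryRep

variable {H : Type*} [NormedAddCommGroup H] [InnerProductSpace ℂ H] [CompleteSpace H]

/-- The modular pair of an antiunitary representation. -/
noncomputable def modularPair (U : AntiunitaryRep H) : ModularPair H :=
  U.exists_modularPair.choose

theorem modularPair_J (U : AntiunitaryRep H) : U.modularPair.J = U (-1) :=
  U.exists_modularPair.choose_spec.1

theorem unitaryGroup_eq (U : AntiunitaryRep H) (t : ℝ) (x : H) :
    U.unitaryGroup t x = U.modularPair.flow.toFun t x :=
  U.exists_modularPair.choose_spec.2 t x

theorem hasModularOperator (U : AntiunitaryRep H) : U.HasModularOperator U.modularPair.D :=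
  hasModularOperator_of_flow U.unitaryGroup_eq

/-- The subspace determines `Δ` as its modular operator and `J` by uniqueness of the polar
decomposition. These give back the flow and `U (-1)`, which generate the representation. -/
theorem injective_standard :
    Function.Injective fun U : AntiunitaryRep H => U.modularPair.standard := by
  intro U W h
  simp only at h
  have hD : U.modularPair.D = W.modularPair.D := by
    rw [← ModularPair.modularOperator_standard, h, ModularPair.modularOperator_standard]
  have hJ : U.modularPair.J = W.modularPair.J :=
    W.modularPair.eq_J (h ▸ U.modularPair.isModularConjugation_standard)
  refine ext_of_unitaryGroup (fun t x => ?_) (by rw [← modularPair_J, hJ, modularPair_J])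
  rw [U.unitaryGroup_eq, W.unitaryGroup_eq]
  have hT : U.modularPair.flow.toFun t = W.modularPair.flow.toFun t := by
    refine ContinuousLinearMap.ext_of_inner_self fun y => ?_
    rw [ModularPair.inner_flow, ModularPair.inner_flow,
      SpectralMeasure.scalarMeasure_eq_of_isIntegral U.modularPair.isIntegral_D
        (hD ▸ W.modularPair.isIntegral_D) y]
  rw [hT]

/-- The pair chosen for `M.rep` need not be `M` itself, but it has the same modular operator and the
same conjugation, and the standard subspace depends only on these. -/
theorem surjective_standard :
    Function.Surjective fun U : AntiunitaryRep H => U.modularPair.standard := by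
  intro V
  obtain ⟨M, rfl⟩ := V.exists_standard_eq
  refine ⟨M.rep, ModularPair.standard_eq ?_ ?_⟩
  · exact M.rep.hasModularOperator.eq_D M.unitaryGroup_rep
  · rw [modularPair_J, M.rep_neg_one]

/-- The bijection between antiunitary representations of `ℝˣ` and standard subspaces. -/
noncomputable def equivStandard : AntiunitaryRep H ≃ StandardSubspace H :=
  Equiv.ofBijective (fun U => U.modularPair.standard)
    (And.intro injective_standard surjective_standard)

theorem equivStandard_symm_apply (U : AntiunitaryRep H) :
    equivStandard.symm U.modularPair.standard = U :=
  equivStandard.symm_apply_apply U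

end AntiunitaryRep

theorem proposition3p2 {H : Type*} [NormedAddCommGroup H] [InnerProductSpace ℂ H]
    [CompleteSpace H] :
    -- every antiunitary representation has a unique modular operator
    (∀ U : AntiunitaryRep H, ∃! D : H →ₗ.[ℂ] H, U.HasModularOperator D) ∧
    -- `S_V` is closed and an involution, and it has a unique polar decomposition
    (∀ V : StandardSubspace H,
      IsClosed {p : H × H | ∃ x : V.tomita.domain, p = ((x : H), V.tomita x)} ∧
      (∀ x : V.tomita.domain, ∃ y : V.tomita.domain, (y : H) = V.tomita x ∧ V.tomita y = x) ∧
      V.modularOperator.IsStrictlyPositiveOp ∧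
      ∃! J : H ≃ₗᵢ[ℝ] H, V.IsModularConjugation J) ∧
    -- the bijection
    ∃ Φ : AntiunitaryRep H ≃ StandardSubspace H,
      (∀ (U : AntiunitaryRep H) (D : H →ₗ.[ℂ] H), U.HasModularOperator D →
        ∃ B : H →ₗ.[ℂ] H, D.IsCPow (1 / 2) B ∧
          ((Φ U).toClosedSubmodule : Set H) = {x | ∃ y : B.domain, (y : H) = x ∧ U (-1) (B y) = x}) ∧
      (∀ V : StandardSubspace H, (Φ.symm V).HasModularOperator V.modularOperator ∧
        V.IsModularConjugation (Φ.symm V (-1))) := by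
  refine ⟨fun U => ⟨_, U.hasModularOperator, fun D hD => hD.eq_D U.unitaryGroup_eq⟩,
    fun V => ?_, AntiunitaryRep.equivStandard, fun U D hD => ?_, fun V => ?_⟩
  · obtain ⟨M, rfl⟩ := V.exists_standard_eq
    exact ⟨M.isClosed_graph_tomita, M.tomita_tomita,
      by rw [M.modularOperator_standard]; exact M.isStrictlyPositiveOp_D,
      M.existsUnique_isModularConjugation⟩
  · obtain rfl := hD.eq_D U.unitaryGroup_eq
    refine ⟨U.modularPair.B, U.modularPair.isCPow_B, ?_⟩
    ext x
    change x ∈ U.modularPair.fixSpace ↔ _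
    rw [ModularPair.mem_fixSpace, U.modularPair_J]
    rfl
  · obtain ⟨U, rfl⟩ := AntiunitaryRep.surjective_standard V
    simp only [AntiunitaryRep.equivStandard_symm_apply]
    refine ⟨?_, ?_⟩
    · rw [ModularPair.modularOperator_standard]
      exact U.hasModularOperator
    · rw [← U.modularPair_J]
      exact U.modularPair.isModularConjugation_standard
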